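/- Let $\mathcal H$ be a complex Hilbert space, let $H_s,W_s$ be bounded self-adjoint operators and $\rho_s(0)$ a bounded operator on $\mathcal H$, and let $\|\cdot\|$ be the operator norm. Let $B:\mathbb R^2\to\mathbb C$ satisfy $|B|\le\bar B$, and suppose that at all $(\tau_1,\tau_2)$ with $\tau_1,\tau_2\neq0$ the first- and second-order partial derivatives of $B$ exist, with $|\partial_{\tau_1}B|+|\partial_{\tau_2}B|\le\bar B'$ and all second-order ones bounded by $\bar B''$. *Exact solution.* For a finite real sequence put $\mathcal L_b(\tau_1,\dots,\tau_N)=\sum_{\mathfrak q}\prod_{(i,k)\in\mathfrak q,\ i<k}B(\tau_i,\tau_k)$, the sum running over all pairings $\mathfrak q$ of $\{1,\dots,N\}$ (so it is $1$ for $N=0$ and $0$ for odd $N$), and for $t\ge0$ $$\rho_s(t)=\sum_{m,m'\ge0}(-\mathrm i)^m\mathrm i^{m'}\int_{0<t_1<\dots<t_m<t}\int_{0<t_1'<\dots<t'_{m'}<t} e^{-\mathrm iH_s(t-t_m)}W_s\cdots W_se^{-\mathrm iH_st_1}\,\rho_s(0)\,e^{\mathrm iH_st_1'}W_s\cdots W_se^{\mathrm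 iH_s(t-t'_{m'})}\,\mathcal L_b(-t_m,\dots,-t_1,t_1',\dots,t'_{m'})\,\mathrm dt'\,\mathrm dt .$$ *Scheme.* Let $\Delta t>0$ and $P_0=e^{-\mathrm iH_s\Delta t}$, $P_1=-\mathrm i\Delta t\,e^{-\mathrm iH_s\Delta t/2}W_se^{-\mathrm iH_s\Delta t/2}$, $G_1=\frac{\mathrm i}{2}\Delta t\,W_se^{-\mathrm iH_s\Delta t/2}$, $G_2=\mathrm i\Delta t\,e^{-\mathrm iH_s\Delta t/2}W_s$. The intervals $k-$ and $k+$ ($k\ge1$) have midpoints $-(k-\frac12)\Delta t$ and $(k-\frac12)\Delta t$, and $\mathcal B_{r,r'}$ is $B$ at the midpoints of $r$ and $r'$. Starting from $\Lambda(\,;\,)=\rho_s(0)$, operators $\Lambda(j)$, with one index $j_\ell\in\{0,1,2\}$ for each interval $\ell$ present, are computed by alternating left and right extensions, the $k$-th time step adding the interval $k-$ and then the interval $k+$. Let $e_\ell$ be the unit multi-index at $\ell$. The left extension by a new interval $r$ first sets, for $j$ with values in $\{0,1\}$, $$L(1,j)=G_1\Lambda(j),\qquad L(0,j)=\sum_{\ell:\,j_\ell=0}\mathcal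 B_{r,\ell}\,G_1\Lambda(j+e_\ell),$$ and $L(\cdot,j)=0$ if some $j_\ell=2$; then, for all $j$ (the first argument being the index of $r$), $$\Lambda(0,j)=P_0\Lambda(j)+\sum_{\ell:\,j_\ell\neq2}\mathcal B_{r,\ell}P_1\Lambda(j+e_\ell)+\mathcal B_{r,r}G_2L(1,j)+\sum_{\ell:\,j_\ell=0}\mathcal B_{r,\ell}G_2L(0,j+e_\ell),$$ $$\Lambda(1,j)=P_1\Lambda(j)+G_2L(0,j)+\sum_{\ell:\,j_\ell=0}\mathcal B_{r,\ell}G_2L(1,j+e_\ell),\qquad \Lambda(2,j)=2G_2L(1,j).$$ The right extension is the same with multiplication on the right by $P_0^\dagger,P_1^\dagger,G_1^\dagger,G_2^\dagger$ and with $\mathcal B_{\ell,r}$ in place of $\mathcal B_{r,\ell}$. Let $\tilde\rho_{s,n}=\Lambda(0,\dots,0;0,\dots,0)$ after $n$ time steps. *Theorem.* All the integrals above converge absolutely, the double series for $\rho_s(n\Delta t)$ is (unconditionally) summable, and there is a constant $C$, depending only on $\|H_s\|$, $\|\rho_s(0)\|$, $\|W_s\|$, $\bar B$, $\bar B'$,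 $\bar B''$ and $T=n\Delta t$, such that $$\|\tilde\rho_{s,n}-\rho_s(n\Delta t)\|\le C\,\Delta t^2 .$$ -/

import Mathlib

namespace FRODS

open MeasureTheory

noncomputable section

/-! ### Bath correlation function and bath influence functional -/

/-- Partial derivative in the first time variable. -/
def pd₁ (B : ℝ → ℝ → ℂ) : ℝ → ℝ → ℂ := fun τ₁ τ₂ => deriv (fun s => B s τ₂) τ₁

/-- Partial derivative in the second time variable. -/
def pd₂ (B : ℝ → ℝ → ℂ) : ℝ → ℝ → ℂ := fun τ₁ τ₂ => deriv (fun s => B τ₁ s) τ₂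

/-- Both partial derivatives of `B` exist at `(τ₁, τ₂)`. -/
def HasPartials (B : ℝ → ℝ → ℂ) (τ₁ τ₂ : ℝ) : Prop :=
  DifferentiableAt ℝ (fun s => B s τ₂) τ₁ ∧ DifferentiableAt ℝ (fun s => B τ₁ s) τ₂

/-- The bath correlation function is bounded by `b`, and off the two coordinate axes its first
and second order partial derivatives exist and are bounded by `b'` and `b''`.
Time zero is left out of the differentiability requirements because
bath correlation functions typically depend on `|τ₁| - |τ₂|` and the signs of `τ₁`, `τ₂`. -/
structure BathBounds (B : ℝ → ℝ → ℂ) (b b' b'' : ℝ) : Prop where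
  bound : ∀ τ₁ τ₂, ‖B τ₁ τ₂‖ ≤ b
  partials : ∀ τ₁ τ₂, τ₁ ≠ 0 → τ₂ ≠ 0 → HasPartials B τ₁ τ₂
  bound_partials : ∀ τ₁ τ₂, τ₁ ≠ 0 → τ₂ ≠ 0 → ‖pd₁ B τ₁ τ₂‖ + ‖pd₂ B τ₁ τ₂‖ ≤ b'
  partials₁ : ∀ τ₁ τ₂, τ₁ ≠ 0 → τ₂ ≠ 0 → HasPartials (pd₁ B) τ₁ τ₂
  partials₂ : ∀ τ₁ τ₂, τ₁ ≠ 0 → τ₂ ≠ 0 → HasPartials (pd₂ B) τ₁ τ₂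
  bound₁₁ : ∀ τ₁ τ₂, τ₁ ≠ 0 → τ₂ ≠ 0 → ‖pd₁ (pd₁ B) τ₁ τ₂‖ ≤ b''
  bound₂₁ : ∀ τ₁ τ₂, τ₁ ≠ 0 → τ₂ ≠ 0 → ‖pd₂ (pd₁ B) τ₁ τ₂‖ ≤ b''
  bound₁₂ : ∀ τ₁ τ₂, τ₁ ≠ 0 → τ₂ ≠ 0 → ‖pd₁ (pd₂ B) τ₁ τ₂‖ ≤ b''
  bound₂₂ : ∀ τ₁ τ₂, τ₁ ≠ 0 → τ₂ ≠ 0 → ‖pd₂ (pd₂ B) τ₁ τ₂‖ ≤ b''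

/-- The pairings of `N` points, as the involutions without fixed points. -/
def pairings (N : ℕ) : Finset (Equiv.Perm (Fin N)) :=
  Finset.univ.filter fun σ => ∀ i, σ (σ i) = i ∧ σ i ≠ i

/-- The bath influence functional of a sequence of time points: the sum over all pairings of the
product of `B (τ, τ')` over all pairs, `τ` being the earlier entry of the sequence.
It is `1` for the empty sequence and `0` for a sequence of odd length. -/
def influence (B : ℝ → ℝ → ℂ) {N : ℕ} (τ : Fin N → ℝ) : ℂ :=
  ∑ σ ∈ pairings N, ∏ i ∈ Finset.univ.filter (fun i => i < σ i), B (τ i) (τ (σ i))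

variable {E : Type*} [NormedAddCommGroup E] [InnerProductSpace ℂ E] [CompleteSpace E]

/-- The propagator `exp (-i t H)`. -/
def prop (H : E →L[ℂ] E) (t : ℝ) : E →L[ℂ] E :=
  NormedSpace.exp ((-Complex.I * (t : ℂ)) • H)

/-! ### The exact reduced density matrix -/

/-- For `ts = [t₁, …, t_m]`:
`exp (-i H (t - t_m)) W exp (-i H (t_m - t_{m-1})) W ⋯ W exp (-i H (t₁ - a))`. -/
def leftChain (H W : E →L[ℂ] E) (t : ℝ) : ℝ → List ℝ → (E →L[ℂ] E)
  | a, [] => prop H (t - a)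
  | a, s :: ts => leftChain H W t s ts * W * prop H (s - a)

/-- For `ts = [t₁, …, t_m]`:
`exp (i H (t₁ - a)) W exp (i H (t₂ - t₁)) W ⋯ W exp (i H (t - t_m))`. -/
def rightChain (H W : E →L[ℂ] E) (t : ℝ) : ℝ → List ℝ → (E →L[ℂ] E)
  | a, [] => prop H (-(t - a))
  | a, s :: ts => prop H (-(s - a)) * W * rightChain H W t s ts

/-- The time-ordered simplex `0 < t₁ < ⋯ < t_m < t`. -/
def simplex (m : ℕ) (t : ℝ) : Set (Fin m → ℝ) :=
  {s | StrictMono s ∧ ∀ i, s i ∈ Set.Ioo 0 t}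

/-- The integrand of the `(m, m')` term of the Dyson series; `p.1 = (t₁, …, t_m)` and
`p.2 = (t₁', …, t'_{m'})`, and the influence functional is taken at the sequence
`(-t_m, …, -t₁, t₁', …, t'_{m'})`. -/
def dysonIntegrand (H W ρ₀ : E →L[ℂ] E) (B : ℝ → ℝ → ℂ) (t : ℝ) (m m' : ℕ)
    (p : (Fin m → ℝ) × (Fin m' → ℝ)) : E →L[ℂ] E :=
  influence B (Fin.append (fun i : Fin m => -p.1 i.rev) p.2) •
    (leftChain H W t 0 (List.ofFn p.1) * ρ₀ * rightChain H W t 0 (List.ofFn p.2))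

/-- The `(m, m')` term of the Dyson series. -/
def dysonTerm (H W ρ₀ : E →L[ℂ] E) (B : ℝ → ℝ → ℂ) (t : ℝ) (q : ℕ × ℕ) : E →L[ℂ] E :=
  ((-Complex.I) ^ q.1 * Complex.I ^ q.2) •
    ∫ p in simplex q.1 t ×ˢ simplex q.2 t, dysonIntegrand H W ρ₀ B t q.1 q.2 p

/-- The reduced density matrix `ρ_s(t)`, the sum of the Dyson series. -/
def rhoExact (H W ρ₀ : E →L[ℂ] E) (B : ℝ → ℝ → ℂ) (t : ℝ) : E →L[ℂ] E :=
  ∑' q : ℕ × ℕ, dysonTerm H W ρ₀ B t q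

/-! ### The second-order iterative scheme -/

/-- The one-interval operator without coupling; `h` is the time step. -/
def P0 (H : E →L[ℂ] E) (h : ℝ) : E →L[ℂ] E := prop H h

/-- The one-interval operator with one coupling operator. -/
def P1 (H W : E →L[ℂ] E) (h : ℝ) : E →L[ℂ] E :=
  (-Complex.I * (h : ℂ)) • (prop H (h / 2) * W * prop H (h / 2))

/-- First-stage factor of the one-interval operator with two coupling operators. -/
def G1 (H W : E →L[ℂ] E) (h : ℝ) : E →L[ℂ] E :=
  (Complex.I / 2 * (h : ℂ)) • (W * prop H (h / 2))

/-- Second-stage factor: `G2 * G1 = -(h² / 2) exp (-i h H / 2) W² exp (-i h H / 2)`. -/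
def G2 (H W : E →L[ℂ] E) (h : ℝ) : E →L[ℂ] E :=
  (Complex.I * (h : ℂ)) • (prop H (h / 2) * W)

/-- The intervals of a diagram with `a` intervals on the left and `c` on the right:
`inl i` is the interval `(i+1)-` and `inr i` is the interval `(i+1)+`. -/
abbrev Interval (a c : ℕ) := Fin a ⊕ Fin c

/-- The numbers of circles on the intervals. -/
abbrev Marks (a c : ℕ) := Interval a c → Fin 3

/-- The midpoint of the interval `(i+1)-`. -/
def midL (h : ℝ) (i : ℕ) : ℝ := -((i : ℝ) + 1 / 2) * h

/-- The midpoint of the interval `(i+1)+`. -/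
def midR (h : ℝ) (i : ℕ) : ℝ := ((i : ℝ) + 1 / 2) * h

/-- The midpoint of an interval. -/
def mid (h : ℝ) {a c : ℕ} : Interval a c → ℝ
  | .inl i => midL h i
  | .inr i => midR h i

section Extensions

variable (H W : E →L[ℂ] E) (B : ℝ → ℝ → ℂ) (h : ℝ) {a c : ℕ}

/-- First stage of the left extension: the half-extended diagram `L(x, j)`, where `x` belongs to
the new interval `(a+1)-`. It is zero when one of the indices is `2`. -/
def leftHalf (Λ : Marks a c → (E →L[ℂ] E)) (x : Fin 3) (j : Marks a c) : E →L[ℂ] E :=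
  if x = 2 ∨ ∃ l, j l = 2 then 0
  else if x = 1 then G1 H W h * Λ j
  else ∑ l with j l = 0, B (midL h a) (mid h l) • (G1 H W h * Λ (Function.update j l 1))

/-- The left extension, written for the number `x` of circles on the new interval `(a+1)-` and
the numbers `j` of circles on the old intervals. -/
def leftStep (Λ : Marks a c → (E →L[ℂ] E)) (x : Fin 3) (j : Marks a c) : E →L[ℂ] E :=
  match x with
  | 0 => P0 H h * Λ j
      + ∑ l with j l ≠ 2,
          B (midL h a) (mid h l) • (P1 H W h * Λ (Function.update j l (j l + 1)))
      + B (midL h a) (midL h a) • (G2 H W h * leftHalf H W B h Λ 1 j)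
      + ∑ l with j l = 0, B (midL h a) (mid h l) •
          (G2 H W h * leftHalf H W B h Λ 0 (Function.update j l 1))
  | 1 => P1 H W h * Λ j
      + G2 H W h * leftHalf H W B h Λ 0 j
      + ∑ l with j l = 0, B (midL h a) (mid h l) •
          (G2 H W h * leftHalf H W B h Λ 1 (Function.update j l 1))
  | 2 => (2 : ℂ) • (G2 H W h * leftHalf H W B h Λ 1 j)

/-- The left extension. -/
def leftExt (Λ : Marks a c → (E →L[ℂ] E)) (J : Marks (a + 1) c) : E →L[ℂ] E :=
  leftStep H W B h Λ (J (.inl (Fin.last a))) (fun l => J (l.map Fin.castSucc id))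

/-- First stage of the right extension: the half-extended diagram `R(j, x)`, where `x` belongs to
the new interval `(c+1)+`. It is zero when one of the indices is `2`. -/
def rightHalf (Λ : Marks a c → (E →L[ℂ] E)) (x : Fin 3) (j : Marks a c) : E →L[ℂ] E :=
  if x = 2 ∨ ∃ l, j l = 2 then 0
  else if x = 1 then Λ j * star (G1 H W h)
  else ∑ l with j l = 0, B (mid h l) (midR h c) •
    (Λ (Function.update j l 1) * star (G1 H W h))

/-- The right extension, written for the number `x` of circles on the new interval `(c+1)+` and
the numbers `j` of circles on the old intervals. -/
def rightStep (Λ : Marks a c → (E →L[ℂ] E)) (x : Fin 3) (j : Marks a c) : E →L[ℂ] E :=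
  match x with
  | 0 => Λ j * star (P0 H h)
      + ∑ l with j l ≠ 2,
          B (mid h l) (midR h c) • (Λ (Function.update j l (j l + 1)) * star (P1 H W h))
      + B (midR h c) (midR h c) • (rightHalf H W B h Λ 1 j * star (G2 H W h))
      + ∑ l with j l = 0, B (mid h l) (midR h c) •
          (rightHalf H W B h Λ 0 (Function.update j l 1) * star (G2 H W h))
  | 1 => Λ j * star (P1 H W h)
      + rightHalf H W B h Λ 0 j * star (G2 H W h)
      + ∑ l with j l = 0, B (mid h l) (midR h c) •
          (rightHalf H W B h Λ 1 (Function.update j l 1) * star (G2 H W h))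
  | 2 => (2 : ℂ) • (rightHalf H W B h Λ 1 j * star (G2 H W h))

/-- The right extension. -/
def rightExt (Λ : Marks a c → (E →L[ℂ] E)) (J : Marks a (c + 1)) : E →L[ℂ] E :=
  rightStep H W B h Λ (J (.inr (Fin.last c))) (fun l => J (l.map id Fin.castSucc))

end Extensions

/-- The bold diagrams `Λ(j_{n-}, …, j_{1-}; j_{1+}, …, j_{n+})` after `n` time steps, each being
a left extension followed by a right extension. -/
def diagrams (H W ρ₀ : E →L[ℂ] E) (B : ℝ → ℝ → ℂ) (h : ℝ) : (n : ℕ) → Marks n n → (E →L[ℂ] E)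
  | 0 => fun _ => ρ₀
  | n + 1 => rightExt H W B h (leftExt H W B h (diagrams H W ρ₀ B h n))

/-- The output of the second-order iterative scheme after `n` steps of size `h`. -/
def rhoTilde (H W ρ₀ : E →L[ℂ] E) (B : ℝ → ℝ → ℂ) (h : ℝ) (n : ℕ) : E →L[ℂ] E :=
  diagrams H W ρ₀ B h n (fun _ => 0)

end

end FRODS

/-!
The output of the scheme is, exactly, a finite sum over configurations, that is, over the numbers
`k l` of coupling operators placed at the midpoints of the `2n` intervals `l`. A configuration
carries the operator chain of the Dyson integrand at these midpoints, the volume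
`∏ l, Δt ^ k l / (k l)!` of the corresponding part of the simplices, and the influence functional,
from which the scheme drops some pairings if the configuration is crowded: three points in one
interval, or two points in each of two intervals. Dropping pairings preserves the bound of the
influence functional, and the volume of the crowded configurations is
`O(n * Δt ^ 3 + n ^ 2 * Δt ^ 4) = O(Δt ^ 2)`.

With the full influence functional the sum over configurations is the midpoint rule for the
integrals of the Dyson series. Move the times one after the other to their midpoints. The formula
for the integrand is twice differentiable in each positive time, and a line parallel to an axis
meets the simplex in an interval: the first-order error cancels over each cell contained in it, and
the two boundary cells have length `Δt` and error `O(Δt)`.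

The bounds grow with the number `N = m + m'` of coupling operators like `c ^ N` times the number of
pairings, which is at most `√N!`. Against the volume `T ^ N / (m! m'!)` of the simplices the errors
stay summable.
-/

namespace FRODS

open MeasureTheory

noncomputable section

/-! ### Pairings and the recursion of the influence functional -/

theorem mem_pairings {N : ℕ} {σ : Equiv.Perm (Fin N)} :
    σ ∈ pairings N ↔ ∀ i, σ (σ i) = i ∧ σ i ≠ i := by
  simp [pairings]

theorem forall_fin_add_two_iff {N : ℕ} (k : Fin (N + 1)) {p : Fin (N + 2) → Prop} :
    (∀ i, p i) ↔ p 0 ∧ p k.succ ∧ ∀ i, p (k.succAbove i).succ := by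
  rw [Fin.forall_fin_succ, Fin.forall_iff_succAbove k]

/-- The permutation of `N + 2` points that exchanges `0` and `k.succ` and acts as `σ` on the
remaining points. It is used to build the pairings of `N + 2` points from those of `N` points. -/
def insertPair {N : ℕ} (k : Fin (N + 1)) (σ : Equiv.Perm (Fin N)) : Equiv.Perm (Fin (N + 2)) where
  toFun := Fin.cons k.succ (k.insertNth 0 fun i => (k.succAbove (σ i)).succ)
  invFun := Fin.cons k.succ (k.insertNth 0 fun i => (k.succAbove (σ.symm i)).succ)
  left_inv := (forall_fin_add_two_iff k).2 (by simp)
  right_inv := (forall_fin_add_two_iff k).2 (by simp)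

section InsertPair

variable {N : ℕ} (k : Fin (N + 1)) (σ : Equiv.Perm (Fin N))

theorem insertPair_zero : insertPair k σ 0 = k.succ := rfl

theorem insertPair_succ : insertPair k σ k.succ = 0 := by
  simp [insertPair]

theorem insertPair_succAbove_succ (i : Fin N) :
    insertPair k σ (k.succAbove i).succ = (k.succAbove (σ i)).succ := by
  simp [insertPair]

theorem insertPair_injective : Function.Injective (insertPair k) := fun σ σ' h =>
  Equiv.ext fun i => by
    simpa [insertPair_succAbove_succ] using DFunLike.congr_fun h (k.succAbove i).succ

theorem insertPair_mem_pairings_iff {σ : Equiv.Perm (Fin N)} :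
    insertPair k σ ∈ pairings (N + 2) ↔ σ ∈ pairings N := by
  rw [mem_pairings, mem_pairings, forall_fin_add_two_iff k]
  simp [insertPair_zero, insertPair_succ, insertPair_succAbove_succ, eq_comm (a := (0 : Fin _))]

theorem exists_insertPair_eq {τ : Equiv.Perm (Fin (N + 2))} (hτ : τ ∈ pairings (N + 2))
    (hτ0 : τ 0 = k.succ) : ∃ σ, insertPair k σ = τ := by
  rw [mem_pairings] at hτ
  have hτk : τ k.succ = 0 := by rw [← hτ0, (hτ 0).1]
  have hrest (i : Fin N) : ∃ i', (k.succAbove i').succ = τ (k.succAbove i).succ := by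
    have hne : τ (k.succAbove i).succ ≠ 0 := by simp [← hτk]
    obtain ⟨j, hj⟩ := Fin.exists_succ_eq.2 hne
    have hjk : j ≠ k := by
      rintro rfl
      exact Fin.succ_ne_zero _ (τ.injective (hj.symm.trans hτ0.symm))
    obtain ⟨i', rfl⟩ := Fin.exists_succAbove_eq hjk
    exact ⟨i', hj⟩
  choose f hf using hrest
  have hinv : Function.Involutive f := fun i =>
    Fin.succAbove_right_injective (p := k) <| Fin.succ_injective _ <| by rw [hf, hf, (hτ _).1]
  refine ⟨hinv.toPerm, Equiv.ext <| (forall_fin_add_two_iff k).2 ⟨?_, ?_, fun i => ?_⟩⟩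
  · rw [insertPair_zero, hτ0]
  · rw [insertPair_succ, hτk]
  · rw [insertPair_succAbove_succ, ← hf, hinv.coe_toPerm]

theorem prod_insertPair {M : Type*} [CommMonoid M] (F : Fin (N + 2) → Fin (N + 2) → M) :
    ∏ i with i < insertPair k σ i, F i (insertPair k σ i) =
      F 0 k.succ * ∏ i with i < σ i, F (k.succAbove i).succ (k.succAbove (σ i)).succ := by
  rw [Finset.prod_filter, Finset.prod_filter, Fin.prod_univ_succ, Fin.prod_univ_succAbove _ k,
    insertPair_zero, insertPair_succ, if_pos (Fin.succ_pos _), if_neg (Fin.not_lt_zero _), one_mul]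
  simp only [insertPair_succAbove_succ, Fin.succ_lt_succ_iff, Fin.succAbove_lt_succAbove_iff]

end InsertPair

theorem sum_pairings_add_two {M : Type*} [AddCommMonoid M] {N : ℕ}
    (F : Equiv.Perm (Fin (N + 2)) → M) :
    ∑ σ ∈ pairings (N + 2), F σ = ∑ k, ∑ σ ∈ pairings N, F (insertPair k σ) := by
  rw [← Finset.sum_fiberwise (pairings (N + 2)) (fun σ => σ 0), Fin.sum_univ_succ]
  have hfixed : (pairings (N + 2)).filter (fun σ => σ 0 = 0) = ∅ :=
    Finset.filter_eq_empty_iff.2 fun σ hσ => (mem_pairings.1 hσ 0).2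
  rw [hfixed, Finset.sum_empty, zero_add]
  refine Finset.sum_congr rfl fun k _ => Eq.symm ?_
  refine Finset.sum_nbij (insertPair k) (fun σ hσ => ?_) (insertPair_injective k).injOn
    (fun σ hσ => ?_) fun _ _ => rfl
  · exact Finset.mem_filter.2 ⟨(insertPair_mem_pairings_iff k).2 hσ, insertPair_zero k σ⟩
  · obtain ⟨hσ, hσ0⟩ := Finset.mem_filter.1 hσ
    obtain ⟨σ', rfl⟩ := exists_insertPair_eq k hσ hσ0
    exact ⟨σ', (insertPair_mem_pairings_iff k).1 hσ, rfl⟩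

theorem influence_add_two (B : ℝ → ℝ → ℂ) {N : ℕ} (τ : Fin (N + 2) → ℝ) :
    influence B τ = ∑ k : Fin (N + 1),
      B (τ 0) (τ k.succ) * influence B (fun i => τ (k.succAbove i).succ) := by
  simp only [influence, sum_pairings_add_two, Finset.mul_sum,
    prod_insertPair _ _ fun i j => B (τ i) (τ j)]

theorem influence_zero (B : ℝ → ℝ → ℂ) (τ : Fin 0 → ℝ) : influence B τ = 1 := by
  have : pairings 0 = Finset.univ := by decide
  simp [influence, this]

theorem influence_one (B : ℝ → ℝ → ℂ) (τ : Fin 1 → ℝ) : influence B τ = 0 :=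
  Finset.sum_eq_zero fun _ hσ => absurd (Subsingleton.elim _ _) (mem_pairings.1 hσ 0).2

theorem revPerm_conj_mem_pairings {N : ℕ} {σ : Equiv.Perm (Fin N)} (hσ : σ ∈ pairings N) :
    Fin.revPerm * σ * Fin.revPerm ∈ pairings N := by
  rw [mem_pairings] at hσ ⊢
  intro i
  simp [hσ, Fin.rev_eq_iff]

theorem influence_swap_rev (B : ℝ → ℝ → ℂ) {N : ℕ} (τ : Fin N → ℝ) :
    influence (fun x y => B y x) (fun i => τ i.rev) = influence B τ := by
  refine Finset.sum_bij' (fun σ _ => Fin.revPerm * σ * Fin.revPerm)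
    (fun σ _ => Fin.revPerm * σ * Fin.revPerm) (fun _ => revPerm_conj_mem_pairings)
    (fun _ => revPerm_conj_mem_pairings) (fun σ _ => by ext; simp) (fun σ _ => by ext; simp)
    fun σ hσ => ?_
  rw [mem_pairings] at hσ
  refine Finset.prod_bij' (fun i _ => (σ i).rev) (fun i _ => σ i.rev) ?_ ?_ ?_ ?_ ?_
  · intro i hi; simpa [hσ] using hi
  · intro i hi
    simp only [Finset.mem_filter, Finset.mem_univ, true_and] at hi ⊢
    simpa [hσ, Fin.lt_rev_iff] using hi
  all_goals intro i _; simp [hσ]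

theorem card_pairings_add_two (N : ℕ) :
    (pairings (N + 2)).card = (N + 1) * (pairings N).card := by
  simpa using sum_pairings_add_two (N := N) fun _ => (1 : ℕ)

theorem card_pairings_sq_le (N : ℕ) : (pairings N).card ^ 2 ≤ N.factorial := by
  induction N using Nat.twoStepInduction with
  | zero => decide
  | one => decide
  | more N ih _ =>
    calc (pairings (N + 2)).card ^ 2 = (N + 1) ^ 2 * (pairings N).card ^ 2 := by
          rw [card_pairings_add_two, mul_pow]
      _ ≤ (N + 1) ^ 2 * N.factorial := by gcongr
      _ = (N + 1) * ((N + 1) * N.factorial) := by ring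
      _ ≤ (N + 2) * ((N + 1) * N.factorial) := by gcongr; omega
      _ = (N + 2).factorial := by rw [Nat.factorial_succ, Nat.factorial_succ]

theorem card_pairings_le_sqrt_factorial (N : ℕ) : ((pairings N).card : ℝ) ≤ √N.factorial := by
  apply Real.le_sqrt_of_sq_le
  exact_mod_cast card_pairings_sq_le N

theorem norm_influence_le {B : ℝ → ℝ → ℂ} {b : ℝ} (hB : ∀ x y, ‖B x y‖ ≤ b) {N : ℕ}
    (τ : Fin N → ℝ) : ‖influence B τ‖ ≤ (1 + b) ^ N * √N.factorial := by
  have hb : 0 ≤ b := (norm_nonneg _).trans (hB 0 0)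
  have hpairing (σ : Equiv.Perm (Fin N)) :
      ‖∏ i with i < σ i, B (τ i) (τ (σ i))‖ ≤ (1 + b) ^ N :=
    calc ‖∏ i with i < σ i, B (τ i) (τ (σ i))‖
        ≤ ∏ i with i < σ i, (1 + b) := by
          rw [norm_prod]
          exact Finset.prod_le_prod (fun _ _ => norm_nonneg _) fun _ _ =>
            (hB _ _).trans (by linarith)
      _ ≤ (1 + b) ^ N := by
          rw [Finset.prod_const]
          exact pow_le_pow_right₀ (by linarith) ((Finset.card_le_univ _).trans (by simp))
  calc ‖influence B τ‖ ≤ ∑ σ ∈ pairings N, (1 + b) ^ N :=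
        norm_sum_le_of_le _ fun σ _ => hpairing σ
    _ = (pairings N).card * (1 + b) ^ N := by rw [Finset.sum_const, nsmul_eq_mul]
    _ ≤ (1 + b) ^ N * √N.factorial := by
        rw [mul_comm]
        gcongr
        exact card_pairings_le_sqrt_factorial N

/-! ### The influence functional of lists and multisets -/

/-- The influence functional of a list of time points. -/
def listInfluence (B : ℝ → ℝ → ℂ) (l : List ℝ) : ℂ := influence B l.get

theorem listInfluence_ofFn (B : ℝ → ℝ → ℂ) {N : ℕ} (τ : Fin N → ℝ) :
    listInfluence B (List.ofFn τ) = influence B τ := by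
  have hcast {M : ℕ} (h : M = N) : influence B (fun i => τ (Fin.cast h i)) = influence B τ := by
    subst h; rfl
  rw [listInfluence, ← hcast List.length_ofFn]
  congr 1
  funext i
  simp only [List.get_eq_getElem, List.getElem_ofFn]
  rfl

theorem eraseIdx_ofFn {α : Type*} {N : ℕ} (f : Fin (N + 1) → α) (k : Fin (N + 1)) :
    (List.ofFn f).eraseIdx k = List.ofFn fun i => f (k.succAbove i) := by
  apply List.ext_getElem
  · rw [List.length_eraseIdx_of_lt (by simpa using k.is_le), List.length_ofFn, List.length_ofFn,
      Nat.add_sub_cancel]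
  · intro i _ _
    rw [List.getElem_eraseIdx]
    split_ifs with h <;> simp only [List.getElem_ofFn] <;> simp [Fin.succAbove, Fin.lt_def, h]

theorem listInfluence_nil (B : ℝ → ℝ → ℂ) : listInfluence B [] = 1 := influence_zero B _

theorem listInfluence_cons (B : ℝ → ℝ → ℂ) (x : ℝ) (l : List ℝ) :
    listInfluence B (x :: l) =
      ∑ i : Fin l.length, B x (l.get i) * listInfluence B (l.eraseIdx i) := by
  obtain ⟨N, τ, rfl⟩ : ∃ N, ∃ τ : Fin N → ℝ, l = List.ofFn τ := ⟨_, _, (List.ofFn_get l).symm⟩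
  rw [← List.ofFn_cons, listInfluence_ofFn,
    ← Equiv.sum_comp (finCongr (List.length_ofFn (f := τ))).symm]
  cases N with
  | zero => simpa using influence_one B _
  | succ N =>
    rw [influence_add_two]
    refine Finset.sum_congr rfl fun k _ => ?_
    have hk : ((finCongr (List.length_ofFn (f := τ))).symm k : ℕ) = k := rfl
    rw [hk, eraseIdx_ofFn, listInfluence_ofFn, List.get_eq_getElem, List.getElem_ofFn]
    rfl

theorem listInfluence_swap_reverse (B : ℝ → ℝ → ℂ) (l : List ℝ) :
    listInfluence (fun x y => B y x) l.reverse = listInfluence B l := by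
  obtain ⟨N, τ, rfl⟩ : ∃ N, ∃ τ : Fin N → ℝ, l = List.ofFn τ := ⟨_, _, (List.ofFn_get l).symm⟩
  have hrev : (List.ofFn τ).reverse = List.ofFn fun i => τ i.rev := by
    refine List.ext_getElem (by simp) fun i _ _ => ?_
    simp [Fin.rev, Nat.sub_sub, add_comm]
  rw [hrev, listInfluence_ofFn, listInfluence_ofFn, influence_swap_rev]

theorem sort_coe_eq_self {α : Type*} [LinearOrder α] {l : List α} (hl : l.Pairwise (· ≤ ·)) :
    (l : Multiset α).sort (· ≤ ·) = l :=
  (Multiset.coe_sort l (· ≤ ·)).trans (List.mergeSort_eq_self _ hl)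

theorem sum_get_eraseIdx {α M : Type*} [DecidableEq α] [AddCommMonoid M]
    (F : α → Multiset α → M) (l : List α) :
    ∑ i : Fin l.length, F (l.get i) (l.eraseIdx i) =
      ((l : Multiset α).map fun y => F y ((l : Multiset α).erase y)).sum := by
  rw [Multiset.map_coe, Multiset.sum_coe, ← List.sum_ofFn]
  congr 1
  refine List.ext_getElem (by simp) fun i hi _ => ?_
  have hi : i < l.length := by simpa using hi
  have hperm : (l.eraseIdx i).Perm (l.erase l[i]) := by
    simpa using (List.getElem_cons_eraseIdx_perm hi).erase l[i]
  simp only [List.getElem_ofFn, List.getElem_map, List.get_eq_getElem, Multiset.coe_erase,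
    Multiset.coe_eq_coe.2 hperm]

/-- The influence functional of a multiset of time points, taken in increasing order. -/
def multisetInfluence (B : ℝ → ℝ → ℂ) (M : Multiset ℝ) : ℂ :=
  listInfluence B (M.sort (· ≤ ·))

theorem multisetInfluence_coe (B : ℝ → ℝ → ℂ) {l : List ℝ} (hl : l.Pairwise (· ≤ ·)) :
    multisetInfluence B l = listInfluence B l := by
  rw [multisetInfluence, sort_coe_eq_self hl]

theorem multisetInfluence_zero (B : ℝ → ℝ → ℂ) : multisetInfluence B 0 = 1 := by
  simp [multisetInfluence, listInfluence_nil]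

theorem multisetInfluence_cons_of_le (B : ℝ → ℝ → ℂ) {r : ℝ} {M : Multiset ℝ}
    (hr : ∀ y ∈ M, r ≤ y) :
    multisetInfluence B (r ::ₘ M) =
      (M.map fun y => B r y * multisetInfluence B (M.erase y)).sum := by
  obtain ⟨l, hl, rfl⟩ : ∃ l : List ℝ, l.Pairwise (· ≤ ·) ∧ (l : Multiset ℝ) = M :=
    ⟨M.sort (· ≤ ·), Multiset.pairwise_sort _ _, Multiset.sort_eq _ _⟩
  have hcons : (r :: l).Pairwise (· ≤ ·) := List.pairwise_cons.2 ⟨hr, hl⟩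
  rw [Multiset.cons_coe, multisetInfluence_coe B hcons, listInfluence_cons,
    ← sum_get_eraseIdx fun y M => B r y * multisetInfluence B M]
  exact Finset.sum_congr rfl fun i _ => by
    rw [multisetInfluence_coe B (hl.sublist (List.eraseIdx_sublist _ _))]

theorem multisetInfluence_coe_of_pairwise_ge (B : ℝ → ℝ → ℂ) {l : List ℝ}
    (hl : l.Pairwise (· ≥ ·)) :
    multisetInfluence B l = listInfluence (fun x y => B y x) l := by
  rw [← Multiset.coe_reverse, multisetInfluence_coe B (List.pairwise_reverse.2 hl),
    ← listInfluence_swap_reverse, List.reverse_reverse]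

theorem multisetInfluence_cons_of_ge (B : ℝ → ℝ → ℂ) {r : ℝ} {M : Multiset ℝ}
    (hr : ∀ y ∈ M, y ≤ r) :
    multisetInfluence B (r ::ₘ M) =
      (M.map fun y => B y r * multisetInfluence B (M.erase y)).sum := by
  obtain ⟨l, hl, rfl⟩ : ∃ l : List ℝ, l.Pairwise (· ≥ ·) ∧ (l : Multiset ℝ) = M :=
    ⟨M.sort (· ≥ ·), Multiset.pairwise_sort _ _, Multiset.sort_eq _ _⟩
  have hcons : (r :: l).Pairwise (· ≥ ·) := List.pairwise_cons.2 ⟨hr, hl⟩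
  rw [Multiset.cons_coe, multisetInfluence_coe_of_pairwise_ge B hcons, listInfluence_cons,
    ← sum_get_eraseIdx fun y M => B y r * multisetInfluence B M]
  exact Finset.sum_congr rfl fun i _ => by
    rw [multisetInfluence_coe_of_pairwise_ge B (hl.sublist (List.eraseIdx_sublist _ _))]

/-! ### Weights of the diagrams -/

section Weights

variable {ι : Type*}

/-- The numbers of circles of a diagram as natural numbers. -/
def counts (j : ι → Fin 3) : ι → ℕ := fun l => (j l : ℕ)

theorem counts_le_two (j : ι → Fin 3) (l : ι) : counts j l ≤ 2 :=
  Nat.le_of_lt_succ (j l).is_lt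

theorem counts_le_one {j : ι → Fin 3} {l : ι} (hl : j l ≠ 2) : counts j l ≤ 1 :=
  Nat.le_of_lt_succ (Fin.val_lt_last (n := 2) hl)

theorem counts_eq_two {j : ι → Fin 3} {l : ι} (hl : j l = 2) : counts j l = 2 := by
  simp [counts, hl]

theorem one_le_counts {j : ι → Fin 3} {l : ι} (hl : j l ≠ 0) : 1 ≤ counts j l :=
  Fin.pos_iff_ne_zero.2 hl

section Definitions

variable [DecidableEq ι] [Fintype ι] {V : Type*} [AddCommGroup V] [Module ℂ V]

/-- The first stage of an extension, with the operator of the half interval already absorbed into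
`Λ`: `β l` is the bath correlation between the new interval and the interval `l`. -/
def extHalf (β : ι → ℂ) (Λ : (ι → Fin 3) → V) (x : Fin 3) (j : ι → Fin 3) : V :=
  if x = 2 ∨ ∃ l, j l = 2 then 0
  else if x = 1 then Λ j
  else ∑ l with j l = 0, β l • Λ (Function.update j l 1)

/-- The part of an extension in which the new interval carries `y` coupling operators, of which
`x` remain unpaired; `β₀` is the bath correlation of the new interval with itself. The operator of
the new interval is already absorbed into `Λ`. -/
def extTerm (β : ι → ℂ) (β₀ : ℂ) (Λ : (ι → Fin 3) → V) (y x : Fin 3) (j : ι → Fin 3) : V :=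
  match y, x with
  | 0, 0 => Λ j
  | 0, 1 => 0
  | 0, 2 => 0
  | 1, 0 => ∑ l with j l ≠ 2, β l • Λ (Function.update j l (j l + 1))
  | 1, 1 => Λ j
  | 1, 2 => 0
  | 2, 0 => β₀ • extHalf β Λ 1 j +
      ∑ l with j l = 0, β l • extHalf β Λ 0 (Function.update j l 1)
  | 2, 1 => extHalf β Λ 0 j + ∑ l with j l = 0, β l • extHalf β Λ 1 (Function.update j l 1)
  | 2, 2 => (2 : ℂ) • extHalf β Λ 1 j

variable {V' : Type*} [AddCommGroup V'] [Module ℂ V'] (f : V →ₗ[ℂ] V') (β : ι → ℂ) (β₀ : ℂ)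
  (Λ : (ι → Fin 3) → V)

theorem map_extHalf (x : Fin 3) (j : ι → Fin 3) :
    f (extHalf β Λ x j) = extHalf β (fun i => f (Λ i)) x j := by
  unfold extHalf
  split_ifs <;> simp only [map_zero, map_sum, map_smul]

theorem map_extTerm (y x : Fin 3) (j : ι → Fin 3) :
    f (extTerm β β₀ Λ y x j) = extTerm β β₀ (fun i => f (Λ i)) y x j := by
  match y, x with
  | 0, 0 | 1, 1 => rfl
  | 0, 1 | 0, 2 | 1, 2 => exact map_zero f
  | 1, 0 | 2, 0 | 2, 1 | 2, 2 =>
    simp only [extTerm, map_add, map_sum, map_smul, map_extHalf]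

theorem extTerm_sum_smul {κ : Type*} [Fintype κ] (w : κ → (ι → Fin 3) → ℂ) (O : κ → V)
    (y x : Fin 3) (j : ι → Fin 3) :
    extTerm β β₀ (fun i => ∑ k, w k i • O k) y x j = ∑ k, extTerm β β₀ (w k) y x j • O k := by
  have hcoord (k : κ) : extTerm β β₀ (fun i k => w k i) y x j k = extTerm β β₀ (w k) y x j :=
    map_extTerm (LinearMap.proj (R := ℂ) (φ := fun _ : κ => ℂ) k) β β₀ (fun i k => w k i) y x j
  have hcomb := map_extTerm (Fintype.linearCombination ℂ O) β β₀ (fun i k => w k i) y x j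
  simp only [Fintype.linearCombination_apply, hcoord] at hcomb
  exact hcomb.symm

end Definitions

section Update

variable [DecidableEq ι]

theorem single_add_sub_single {k : ι → ℕ} {l : ι} (hl : k l ≠ 0) :
    Pi.single l 1 + (k - Pi.single l 1) = k := by
  funext l'
  rcases eq_or_ne l' l with rfl | hl'
  · simpa using Nat.add_sub_cancel' (Nat.one_le_iff_ne_zero.2 hl)
  · simp [hl']

theorem counts_update_succ {j : ι → Fin 3} {l : ι} (hl : j l ≠ 2) :
    counts (Function.update j l (j l + 1)) = counts j + Pi.single l 1 := by
  have hval : ((j l + 1 : Fin 3) : ℕ) = (j l : ℕ) + 1 :=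
    Fin.val_add_one_of_lt (Fin.lt_last_iff_ne_last.2 hl)
  funext l'
  rcases eq_or_ne l' l with rfl | hl'
  · simp [counts, hval]
  · simp [counts, hl']

theorem counts_update_one {j : ι → Fin 3} {l : ι} (hl : j l = 0) :
    counts (Function.update j l 1) = counts j + Pi.single l 1 := by
  rw [← counts_update_succ (by rw [hl]; decide), hl, zero_add]

end Update

section Arrangements

variable [Fintype ι]

/-- The number of ways to choose `j l` of `k l` points in order, for each `l`. -/
def arrangements (k j : ι → ℕ) : ℕ := ∏ l, (k l).descFactorial (j l)

theorem arrangements_zero (k : ι → ℕ) : arrangements k 0 = 1 := by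
  simp [arrangements]

theorem arrangements_eq_zero {k j : ι → ℕ} {l : ι} (h : k l < j l) : arrangements k j = 0 :=
  Finset.prod_eq_zero (Finset.mem_univ l) (Nat.descFactorial_of_lt h)

variable [DecidableEq ι]

theorem arrangements_add_single (k j : ι → ℕ) (l : ι) :
    arrangements k (j + Pi.single l 1) = (k l - j l) * arrangements k j := by
  unfold arrangements
  rw [← Finset.mul_prod_erase _ _ (Finset.mem_univ l),
    ← Finset.mul_prod_erase Finset.univ (fun l => (k l).descFactorial (j l)) (Finset.mem_univ l),
    Pi.add_apply, Pi.single_eq_same, Nat.descFactorial_succ, mul_assoc]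
  congr 2
  refine Finset.prod_congr rfl fun l' hl' => ?_
  simp [Finset.ne_of_mem_erase hl']

theorem sum_sub_single {k : ι → ℕ} {l : ι} (hl : k l ≠ 0) :
    ∑ l', (k - Pi.single l 1 : ι → ℕ) l' = ∑ l', k l' - 1 := by
  conv_rhs => rw [← single_add_sub_single hl]
  simp only [Pi.add_apply, Finset.sum_add_distrib, Finset.sum_pi_single', Finset.mem_univ, if_true,
    Nat.add_sub_cancel_left]

end Arrangements

section Exact

variable [Fintype ι]

/-- The weights `v j` of a configuration with `k l` points on each interval `l` are determined by
a function `Φ` of the points that remain after `j l` of the points on `l` have been singled out,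
in order. -/
def HasWeight (k : ι → ℕ) (Φ : (ι → ℕ) → ℂ) (v : (ι → Fin 3) → ℂ) : Prop :=
  ∀ j, v j = arrangements k (counts j) * Φ (k - counts j)

theorem HasWeight.of_forall_ne_two {k : ι → ℕ} {Φ : (ι → ℕ) → ℂ} {v : (ι → Fin 3) → ℂ}
    (hk : ∀ l, k l ≤ 1) (hv : ∀ j, (∃ l, j l = 2) → v j = 0)
    (h : ∀ j, (∀ l, j l ≠ 2) → v j = arrangements k (counts j) * Φ (k - counts j)) :
    HasWeight k Φ v := fun j => by
  by_cases hj : ∃ l, j l = 2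
  · obtain ⟨l, hl⟩ := hj
    have hlt : k l < counts j l := by
      rw [counts_eq_two hl]
      exact Nat.lt_succ_of_le (hk l)
    rw [hv j ⟨l, hl⟩, arrangements_eq_zero hlt, Nat.cast_zero, zero_mul]
  · exact h j (not_exists.1 hj)

variable [DecidableEq ι]

/-- The effect on `Φ` of an additional point which is paired with one of the given points. -/
def pairWith (β : ι → ℂ) (Φ : (ι → ℕ) → ℂ) (k : ι → ℕ) : ℂ :=
  ∑ l, (k l : ℂ) * (β l * Φ (k - Pi.single l 1))

/-- The recursion satisfied by the influence functional `F' y` of `y` points on a new interval in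
addition to the points on the old intervals. -/
structure PairingRecursion (β : ι → ℂ) (β₀ : ℂ) (F : (ι → ℕ) → ℂ) (F' : ℕ → (ι → ℕ) → ℂ) :
    Prop where
  zero : F' 0 = F
  one : F' 1 = pairWith β F
  two : F' 2 = β₀ • F + pairWith β (F' 1)

variable {β : ι → ℂ} {β₀ : ℂ} {Φ F : (ι → ℕ) → ℂ} {F' : ℕ → (ι → ℕ) → ℂ} {k : ι → ℕ}
  {v w : (ι → Fin 3) → ℂ}

theorem HasWeight.sum_update (hv : HasWeight k Φ v) {j u : ι → Fin 3} {S : Finset ι}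
    (hu : ∀ l ∈ S, counts (Function.update j l (u l)) = counts j + Pi.single l 1)
    (hS : ∀ l ∉ S, k l ≤ counts j l) :
    ∑ l ∈ S, β l • v (Function.update j l (u l)) =
      arrangements k (counts j) * pairWith β Φ (k - counts j) := by
  rw [pairWith, Finset.mul_sum, ← Finset.sum_subset (Finset.subset_univ S)]
  · refine Finset.sum_congr rfl fun l hl => ?_
    rw [hv, hu l hl, arrangements_add_single, tsub_add_eq_tsub_tsub, Pi.sub_apply, smul_eq_mul]
    push_cast
    ring
  · intro l _ hl
    rw [Pi.sub_apply, Nat.sub_eq_zero_of_le (hS l hl)]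
    simp

theorem HasWeight.sum_update_succ (hv : HasWeight k Φ v) (hk : ∀ l, k l ≤ 2) :
    HasWeight k (pairWith β Φ)
      fun j => ∑ l with j l ≠ 2, β l • v (Function.update j l (j l + 1)) := fun j =>
  hv.sum_update (fun _ hl => counts_update_succ (Finset.mem_filter.1 hl).2) fun l hl =>
    (hk l).trans (counts_eq_two (by simpa using hl)).ge

theorem HasWeight.sum_update_one (hv : HasWeight k Φ v) (hk : ∀ l, k l ≤ 1) :
    HasWeight k (pairWith β Φ)
      fun j => ∑ l with j l = 0, β l • v (Function.update j l 1) := fun j =>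
  hv.sum_update (u := fun _ => 1) (fun _ hl => counts_update_one (Finset.mem_filter.1 hl).2)
    fun l hl => (hk l).trans (one_le_counts (by simpa using hl))

theorem HasWeight.extHalf_one (hw : HasWeight k F w) (hk : ∀ l, k l ≤ 1) :
    HasWeight k F (extHalf β w 1) :=
  .of_forall_ne_two hk (fun j hj => by simp [extHalf, hj]) fun j hj => by
    simpa [extHalf, hj] using hw j

theorem HasWeight.extHalf_zero (hw : HasWeight k F w) (hk : ∀ l, k l ≤ 1) :
    HasWeight k (pairWith β F) (extHalf β w 0) :=
  .of_forall_ne_two hk (fun j hj => by simp [extHalf, hj]) fun j hj => by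
    simpa [extHalf, hj] using hw.sum_update_one hk j

theorem HasWeight.extTerm_eq (hw : HasWeight k F w) (hF : PairingRecursion β β₀ F F') {y : Fin 3}
    (hy : y = 2 → ∀ l, k l ≤ 1) (hk : ∀ l, k l ≤ 2) (x : Fin 3) (j : ι → Fin 3) :
    extTerm β β₀ w y x j =
      (y : ℕ).descFactorial x * arrangements k (counts j) * F' (y - x) (k - counts j) := by
  match y, x with
  | 0, 0 => simpa [extTerm, hF.zero] using hw j
  | 0, 1 => simp [extTerm]
  | 0, 2 => simp [extTerm]
  | 1, 0 => simpa [extTerm, hF.one] using hw.sum_update_succ hk j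
  | 1, 1 => simpa [extTerm, hF.zero] using hw j
  | 1, 2 => simp [extTerm, Nat.descFactorial]
  | 2, 0 =>
    have hsum := (hw.extHalf_zero (β := β) (hy rfl)).sum_update_one (β := β) (hy rfl) j
    beta_reduce at hsum
    rw [extTerm, hsum, hw.extHalf_one (hy rfl) j]
    simp only [hF.two, hF.one, Fin.val_two, Fin.val_zero,
      Nat.descFactorial_zero, Nat.cast_one, one_mul, tsub_zero, Pi.add_apply, Pi.smul_apply,
      smul_eq_mul]
    ring
  | 2, 1 =>
    have hsum := (hw.extHalf_one (β := β) (hy rfl)).sum_update_one (β := β) (hy rfl) j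
    beta_reduce at hsum
    rw [extTerm, hsum, hw.extHalf_zero (hy rfl) j]
    simp only [hF.one, Fin.val_two, Fin.val_one,
      Nat.descFactorial_one, Nat.cast_ofNat, Nat.add_one_sub_one]
    ring
  | 2, 2 =>
    simp only [extTerm, hw.extHalf_one (hy rfl) j, hF.zero, Fin.val_two, Nat.descFactorial_self,
      Nat.factorial_two, Nat.cast_ofNat, tsub_self, smul_eq_mul]
    ring

end Exact

section Bound

variable [Fintype ι]

/-- The bound on the weights of a configuration which corresponds to `HasWeight`. -/
def WeightLE (k : ι → ℕ) (φ : ℕ → ℝ) (v : (ι → Fin 3) → ℂ) : Prop :=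
  ∀ j, ‖v j‖ ≤ arrangements k (counts j) * φ (∑ l, (k - counts j) l)

variable {φ ψ g : ℕ → ℝ} {k : ι → ℕ} {v w : (ι → Fin 3) → ℂ}

theorem WeightLE.mono (hv : WeightLE k φ v) (h : ∀ N, φ N ≤ ψ N) : WeightLE k ψ v := fun j =>
  (hv j).trans (mul_le_mul_of_nonneg_left (h _) (Nat.cast_nonneg _))

theorem WeightLE.of_forall_ne_two (hφ : ∀ N, 0 ≤ φ N) (hv : ∀ j, (∃ l, j l = 2) → v j = 0)
    (h : ∀ j, (∀ l, j l ≠ 2) → ‖v j‖ ≤ arrangements k (counts j) * φ (∑ l, (k - counts j) l)) :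
    WeightLE k φ v := fun j => by
  by_cases hj : ∃ l, j l = 2
  · rw [hv j hj, norm_zero]
    exact mul_nonneg (Nat.cast_nonneg _) (hφ _)
  · exact h j (not_exists.1 hj)

variable [DecidableEq ι] {β : ι → ℂ} {β₀ : ℂ} {b : ℝ}

theorem WeightLE.norm_sum_update_le (hv : WeightLE k φ v) (hβ : ∀ l, ‖β l‖ ≤ b) (hb : 0 ≤ b)
    (hφ : ∀ N, 0 ≤ φ N) {j u : ι → Fin 3} {S : Finset ι}
    (hu : ∀ l ∈ S, counts (Function.update j l (u l)) = counts j + Pi.single l 1) :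
    ‖∑ l ∈ S, β l • v (Function.update j l (u l))‖ ≤ arrangements k (counts j) *
      (b * (∑ l, (k - counts j) l : ℕ) * φ (∑ l, (k - counts j) l - 1)) := by
  set A : ℝ := arrangements k (counts j) * b * φ (∑ l, (k - counts j) l - 1) with hA
  have hA0 : 0 ≤ A := mul_nonneg (by positivity) (hφ _)
  have hterm : ∀ l ∈ S, ‖β l • v (Function.update j l (u l))‖ ≤ ((k - counts j) l : ℕ) * A := by
    intro l hl
    have hvl := hv (Function.update j l (u l))
    rw [hu l hl, arrangements_add_single, tsub_add_eq_tsub_tsub] at hvl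
    rw [norm_smul]
    by_cases h0 : (k - counts j) l = 0
    · have hnorm : ‖v (Function.update j l (u l))‖ ≤ 0 := by
        rwa [show k l - counts j l = 0 from h0, zero_mul, Nat.cast_zero, zero_mul] at hvl
      rw [le_antisymm hnorm (norm_nonneg _), h0, mul_zero, Nat.cast_zero, zero_mul]
    · rw [sum_sub_single h0] at hvl
      calc _ ≤ b * _ := mul_le_mul (hβ l) hvl (norm_nonneg _) hb
        _ = _ := by rw [hA, Pi.sub_apply]; push_cast; ring
  calc _ ≤ ∑ l ∈ S, ((k - counts j) l : ℕ) * A := norm_sum_le_of_le _ hterm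
    _ ≤ ∑ l, ((k - counts j) l : ℕ) * A :=
      Finset.sum_le_sum_of_subset_of_nonneg (Finset.subset_univ S) fun l _ _ => by positivity
    _ = _ := by rw [← Finset.sum_mul, hA]; push_cast; ring

theorem WeightLE.sum_update_succ (hv : WeightLE k φ v) (hβ : ∀ l, ‖β l‖ ≤ b) (hb : 0 ≤ b)
    (hφ : ∀ N, 0 ≤ φ N) :
    WeightLE k (fun N => b * N * φ (N - 1))
      fun j => ∑ l with j l ≠ 2, β l • v (Function.update j l (j l + 1)) := fun _ =>
  hv.norm_sum_update_le hβ hb hφ fun _ hl => counts_update_succ (Finset.mem_filter.1 hl).2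

theorem WeightLE.sum_update_one (hv : WeightLE k φ v) (hβ : ∀ l, ‖β l‖ ≤ b) (hb : 0 ≤ b)
    (hφ : ∀ N, 0 ≤ φ N) :
    WeightLE k (fun N => b * N * φ (N - 1))
      fun j => ∑ l with j l = 0, β l • v (Function.update j l 1) := fun _ =>
  hv.norm_sum_update_le (u := fun _ => 1) hβ hb hφ fun _ hl =>
    counts_update_one (Finset.mem_filter.1 hl).2

theorem WeightLE.extHalf_one (hw : WeightLE k g w) (hg : ∀ N, 0 ≤ g N) :
    WeightLE k g (extHalf β w 1) :=
  .of_forall_ne_two hg (fun j hj => by simp [extHalf, hj]) fun j hj => by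
    simpa [extHalf, hj] using hw j

theorem WeightLE.extHalf_zero (hw : WeightLE k g w) (hβ : ∀ l, ‖β l‖ ≤ b) (hb : 0 ≤ b)
    (hg : ∀ N, 0 ≤ g N) (hrec : ∀ N : ℕ, b * N * g (N - 1) ≤ g (N + 1)) :
    WeightLE k (fun N => g (N + 1)) (extHalf β w 0) :=
  .of_forall_ne_two (fun _ => hg _) (fun j hj => by simp [extHalf, hj]) fun j hj => by
    simpa [extHalf, hj] using ((hw.sum_update_one hβ hb hg).mono hrec) j

theorem WeightLE.extTerm_two_zero (hw : WeightLE k g w) (hβ : ∀ l, ‖β l‖ ≤ b) (hb : 0 ≤ b)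
    (hg : ∀ N, 0 ≤ g N) (hrec : ∀ N : ℕ, b * N * g (N - 1) ≤ g (N + 1))
    (hβ₀ : ‖β₀‖ ≤ b) :
    WeightLE k (fun N => g (N + 2)) (extTerm β β₀ w 2 0) := by
  intro j
  have hself : ‖β₀ • extHalf β w 1 j‖ ≤
      b * (arrangements k (counts j) * g (∑ l, (k - counts j) l)) := by
    rw [norm_smul]
    exact mul_le_mul hβ₀ (hw.extHalf_one hg j) (norm_nonneg _) hb
  have hpair := (hw.extHalf_zero hβ hb hg hrec).sum_update_one hβ hb (fun _ => hg _) j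
  refine (norm_add_le_of_le hself hpair).trans ?_
  generalize ∑ l, (k - counts j) l = M
  beta_reduce
  have hM : b * M * g (M - 1 + 1) = b * M * g M := by
    rcases Nat.eq_zero_or_pos M with rfl | hpos
    · simp
    · rw [Nat.sub_add_cancel hpos]
  calc _ = arrangements k (counts j) * (b * (M + 1 : ℕ) * g (M + 1 - 1)) := by
        rw [hM, Nat.add_sub_cancel]; push_cast; ring
    _ ≤ _ := mul_le_mul_of_nonneg_left (hrec (M + 1)) (Nat.cast_nonneg _)

theorem WeightLE.norm_extTerm_two_one_le (hw : WeightLE k g w) (hβ : ∀ l, ‖β l‖ ≤ b) (hb : 0 ≤ b)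
    (hg : ∀ N, 0 ≤ g N) (hrec : ∀ N : ℕ, b * N * g (N - 1) ≤ g (N + 1))
    (j : ι → Fin 3) :
    ‖extTerm β β₀ w 2 1 j‖ ≤
      2 * (arrangements k (counts j) * g (∑ l, (k - counts j) l + 1)) := by
  have hhalf := hw.extHalf_zero hβ hb hg hrec j
  have hpair := (((hw.extHalf_one (β := β) hg).sum_update_one hβ hb hg).mono hrec) j
  rw [two_mul]
  exact norm_add_le_of_le hhalf hpair

theorem WeightLE.norm_extTerm_le (hw : WeightLE k g w) (hβ : ∀ l, ‖β l‖ ≤ b) (hb : 0 ≤ b)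
    (hg : ∀ N, 0 ≤ g N) (hrec : ∀ N : ℕ, b * N * g (N - 1) ≤ g (N + 1))
    (hβ₀ : ‖β₀‖ ≤ b) (y x : Fin 3) (j : ι → Fin 3) :
    ‖extTerm β β₀ w y x j‖ ≤ (y : ℕ).descFactorial x * arrangements k (counts j) *
      g ((y - x) + ∑ l, (k - counts j) l) := by
  match y, x with
  | 0, 0 => simpa [extTerm] using hw j
  | 0, 1 => simp [extTerm]
  | 0, 2 => simp [extTerm]
  | 1, 0 => simpa [extTerm, add_comm] using ((hw.sum_update_succ hβ hb hg).mono hrec) j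
  | 1, 1 => simpa [extTerm] using hw j
  | 1, 2 => simp [extTerm, Nat.descFactorial]
  | 2, 0 => simpa [add_comm] using hw.extTerm_two_zero hβ hb hg hrec hβ₀ j
  | 2, 1 =>
    refine (hw.norm_extTerm_two_one_le hβ hb hg hrec j).trans (le_of_eq ?_)
    simp [Nat.descFactorial, add_comm, mul_assoc]
  | 2, 2 =>
    have hhalf := hw.extHalf_one (β := β) hg j
    simp only [extTerm, norm_smul, Complex.norm_ofNat, Fin.val_two, Nat.descFactorial_self,
      Nat.factorial_two, Nat.cast_ofNat, tsub_self, zero_add]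
    linarith

end Bound

end Weights

/-! ### Propagators and the interaction picture -/

section Propagator

variable {E : Type*} [NormedAddCommGroup E] [InnerProductSpace ℂ E] [CompleteSpace E]

theorem prop_add (H : E →L[ℂ] E) (s t : ℝ) : prop H (s + t) = prop H s * prop H t := by
  let _ : NormedAlgebra ℚ (E →L[ℂ] E) := NormedAlgebra.restrictScalars ℚ ℂ (E →L[ℂ] E)
  unfold prop
  rw [← NormedSpace.exp_add_of_commute, ← add_smul]
  · push_cast; ring_nf
  · exact ((Commute.refl H).smul_left _).smul_right _

theorem prop_zero (H : E →L[ℂ] E) : prop H 0 = 1 := by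
  simp [prop]

theorem prop_mul_neg (H : E →L[ℂ] E) (s : ℝ) : prop H s * prop H (-s) = 1 := by
  rw [← prop_add, add_neg_cancel, prop_zero]

theorem prop_neg_mul (H : E →L[ℂ] E) (s : ℝ) : prop H (-s) * prop H s = 1 := by
  rw [← prop_add, neg_add_cancel, prop_zero]

theorem star_prop {H : E →L[ℂ] E} (hH : IsSelfAdjoint H) (s : ℝ) :
    star (prop H s) = prop H (-s) := by
  unfold prop
  rw [NormedSpace.star_exp, star_smul, hH.star_eq]
  simp

theorem norm_prop_le {H : E →L[ℂ] E} (hH : IsSelfAdjoint H) (s : ℝ) : ‖prop H s‖ ≤ 1 := by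
  have hsq : ‖prop H s‖ * ‖prop H s‖ ≤ 1 := by
    rw [← CStarRing.norm_star_mul_self, star_prop hH, prop_neg_mul]
    exact ContinuousLinearMap.norm_id_le
  exact (sq_le_one_iff₀ (norm_nonneg _)).1 (by rwa [sq])

/-- The coupling operator in the interaction picture. -/
def coupling (H W : E →L[ℂ] E) (s : ℝ) : E →L[ℂ] E := prop H (-s) * W * prop H s

theorem norm_coupling_le {H : E →L[ℂ] E} (hH : IsSelfAdjoint H) (W : E →L[ℂ] E) (s : ℝ) :
    ‖coupling H W s‖ ≤ ‖W‖ :=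
  calc ‖coupling H W s‖ ≤ ‖prop H (-s)‖ * ‖W‖ * ‖prop H s‖ := norm_mul₃_le
    _ ≤ 1 * ‖W‖ * 1 := by gcongr <;> exact norm_prop_le hH _
    _ = ‖W‖ := by ring

theorem coupling_pow (H W : E →L[ℂ] E) (s : ℝ) (y : ℕ) :
    coupling H W s ^ y = prop H (-s) * W ^ y * prop H s := by
  induction y with
  | zero => simp [prop_neg_mul]
  | succ y ih =>
    rw [pow_succ, ih, coupling]
    calc prop H (-s) * W ^ y * prop H s * (prop H (-s) * W * prop H s)
        = prop H (-s) * W ^ y * (prop H s * prop H (-s)) * W * prop H s := by noncomm_ring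
      _ = _ := by rw [prop_mul_neg, pow_succ]; noncomm_ring

theorem leftChain_eq (H W : E →L[ℂ] E) (t : ℝ) (l : List ℝ) (a : ℝ) :
    leftChain H W t a l = prop H t * (l.map (coupling H W)).reverse.prod * prop H (-a) := by
  induction l generalizing a with
  | nil => simp [leftChain, sub_eq_add_neg, prop_add]
  | cons s l ih =>
    rw [leftChain, ih, List.map_cons, List.reverse_cons, List.prod_append, List.prod_singleton,
      sub_eq_add_neg, prop_add, coupling]
    noncomm_ring

theorem rightChain_eq (H W : E →L[ℂ] E) (t : ℝ) (l : List ℝ) (a : ℝ) :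
    rightChain H W t a l = prop H a * (l.map (coupling H W)).prod * prop H (-t) := by
  induction l generalizing a with
  | nil => simp [rightChain, sub_eq_add_neg, prop_add]
  | cons s l ih =>
    rw [rightChain, ih, List.map_cons, List.prod_cons, neg_sub, sub_eq_add_neg, prop_add,
      coupling]
    noncomm_ring

/-- The product of the coupling operators at the times of the lists `l` (left of the initial
density matrix, in decreasing order) and `l'` (right of it), up to time `t`. -/
def sandwich (H W ρ₀ : E →L[ℂ] E) (t t' : ℝ) (l l' : List ℝ) : E →L[ℂ] E :=
  prop H t * (l.map (coupling H W)).reverse.prod * ρ₀ * (l'.map (coupling H W)).prod *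
    prop H (-t')

theorem norm_prod_coupling_le {H : E →L[ℂ] E} (hH : IsSelfAdjoint H) (W : E →L[ℂ] E)
    (l : List ℝ) : ‖(l.map (coupling H W)).prod‖ ≤ ‖W‖ ^ l.length := by
  induction l with
  | nil =>
    rw [List.map_nil, List.prod_nil, List.length_nil, pow_zero]
    exact ContinuousLinearMap.norm_id_le
  | cons s l ih =>
    rw [List.map_cons, List.prod_cons, List.length_cons, pow_succ']
    exact (norm_mul_le _ _).trans
      (mul_le_mul (norm_coupling_le hH W s) ih (norm_nonneg _) (norm_nonneg _))

theorem norm_sandwich_le {H : E →L[ℂ] E} (hH : IsSelfAdjoint H) (W ρ₀ : E →L[ℂ] E) (t t' : ℝ)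
    (l l' : List ℝ) :
    ‖sandwich H W ρ₀ t t' l l'‖ ≤ ‖ρ₀‖ * ‖W‖ ^ (l.length + l'.length) := by
  have hl := norm_prod_coupling_le hH W l.reverse
  rw [List.length_reverse, List.map_reverse] at hl
  calc _ ≤ ‖prop H t‖ * ‖(l.map (coupling H W)).reverse.prod‖ * ‖ρ₀‖ *
        ‖(l'.map (coupling H W)).prod‖ * ‖prop H (-t')‖ :=
        (norm_mul_le _ _).trans <| mul_le_mul_of_nonneg_right
          ((norm_mul_le _ _).trans <| mul_le_mul_of_nonneg_right norm_mul₃_le (norm_nonneg _))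
          (norm_nonneg _)
    _ ≤ 1 * ‖W‖ ^ l.length * ‖ρ₀‖ * ‖W‖ ^ l'.length * 1 := by
        gcongr
        exacts [norm_prop_le hH _, norm_prod_coupling_le hH W l', norm_prop_le hH _]
    _ = _ := by rw [pow_add]; ring

theorem dysonIntegrand_eq (H W ρ₀ : E →L[ℂ] E) (B : ℝ → ℝ → ℂ) (t : ℝ) (m m' : ℕ)
    (p : (Fin m → ℝ) × (Fin m' → ℝ)) :
    dysonIntegrand H W ρ₀ B t m m' p =
      influence B (Fin.append (fun i : Fin m => -p.1 i.rev) p.2) •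
        sandwich H W ρ₀ t t (List.ofFn p.1) (List.ofFn p.2) := by
  rw [dysonIntegrand, leftChain_eq, rightChain_eq, sandwich, neg_zero, prop_zero]
  simp only [mul_one, one_mul, mul_assoc]

end Propagator

/-! ### Adding an interval to a configuration -/

section Configurations

variable {ι ι' : Type*} [Fintype ι'] [Fintype ι]

/-- The time points of a configuration with `k l` points at the time `μ l` for each `l`. -/
def timeMultiset (μ : ι → ℝ) (k : ι → ℕ) : Multiset ℝ := ∑ l, k l • {μ l}

theorem sum_map_timeMultiset (μ : ι → ℝ) (k : ι → ℕ) (f : ℝ → ℂ) :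
    ((timeMultiset μ k).map f).sum = ∑ l, (k l : ℂ) * f (μ l) := by
  have hmap : (timeMultiset μ k).map f = ∑ l, k l • {f (μ l)} := by
    rw [timeMultiset, ← Multiset.coe_mapAddMonoidHom, map_sum]
    simp only [Multiset.coe_mapAddMonoidHom, Multiset.map_nsmul, Multiset.map_singleton]
  rw [hmap, ← Multiset.coe_sumAddMonoidHom, map_sum]
  simp only [Multiset.coe_sumAddMonoidHom, Multiset.sum_nsmul, Multiset.sum_singleton,
    nsmul_eq_mul]

theorem mem_range_of_mem_timeMultiset {μ : ι → ℝ} {k : ι → ℕ} {x : ℝ}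
    (hx : x ∈ timeMultiset μ k) : x ∈ Set.range μ := by
  obtain ⟨l, _, hl⟩ := Multiset.mem_sum.1 hx
  exact ⟨l, (Multiset.mem_singleton.1 (Multiset.mem_of_mem_nsmul hl)).symm⟩

theorem timeMultiset_eq_cons [DecidableEq ι] (μ : ι → ℝ) {k : ι → ℕ} {l : ι} (hl : k l ≠ 0) :
    timeMultiset μ k = μ l ::ₘ timeMultiset μ (k - Pi.single l 1) := by
  have hsingle : ∑ l', (Pi.single l 1 : ι → ℕ) l' • ({μ l'} : Multiset ℝ) = {μ l} := by
    rw [Finset.sum_eq_single_of_mem l (Finset.mem_univ l) fun l' _ h => by simp [h]]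
    simp
  conv_lhs => rw [← single_add_sub_single hl]
  simp only [timeMultiset, Pi.add_apply, add_smul, Finset.sum_add_distrib]
  rw [hsingle, Multiset.singleton_add]

theorem pairingRecursion_multisetInfluence [DecidableEq ι] (B : ℝ → ℝ → ℂ) (μ : ι → ℝ) (r : ℝ)
    (β : ℝ → ℂ)
    (hcons : ∀ M : Multiset ℝ, (∀ y ∈ M, y = r ∨ y ∈ Set.range μ) →
      multisetInfluence B (r ::ₘ M) =
        (M.map fun y => β y * multisetInfluence B (M.erase y)).sum) :
    PairingRecursion (fun l => β (μ l)) (β r)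
      (fun k => multisetInfluence B (timeMultiset μ k))
      (fun y k => multisetInfluence B (Multiset.replicate y r + timeMultiset μ k)) where
  zero := by simp
  one := by
    funext k
    rw [Multiset.replicate_one, Multiset.singleton_add,
      hcons _ fun y hy => Or.inr (mem_range_of_mem_timeMultiset hy), sum_map_timeMultiset]
    refine Finset.sum_congr rfl fun l _ => ?_
    by_cases hl : k l = 0
    · simp [hl]
    · rw [timeMultiset_eq_cons μ hl, Multiset.erase_cons_head]
  two := by
    funext k
    have hmem : ∀ y ∈ r ::ₘ timeMultiset μ k, y = r ∨ y ∈ Set.range μ := fun y hy =>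
      (Multiset.mem_cons.1 hy).imp id mem_range_of_mem_timeMultiset
    rw [Multiset.replicate_succ, Multiset.replicate_one, Multiset.cons_add,
      Multiset.singleton_add, hcons _ hmem, Multiset.map_cons, Multiset.sum_cons,
      Multiset.erase_cons_head, sum_map_timeMultiset]
    refine congrArg₂ (· + ·) rfl (Finset.sum_congr rfl fun l _ => ?_)
    by_cases hl : k l = 0
    · simp [hl]
    · beta_reduce
      rw [Multiset.singleton_add, timeMultiset_eq_cons μ hl,
        Multiset.erase_cons_tail_of_mem (Multiset.mem_cons_self _ _), Multiset.erase_cons_head]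

theorem sum_pi_option_equiv {α M : Type*} [Fintype α] [AddCommMonoid M] [DecidableEq ι]
    [DecidableEq ι'] (e : Option ι ≃ ι') (F : α → (ι → α) → M) :
    ∑ K : ι' → α, F (K (e none)) (fun l => K (e (some l))) = ∑ y, ∑ k, F y k := by
  rw [← Fintype.sum_prod_type' F]
  exact Fintype.sum_equiv ((e.arrowCongr (.refl α)).symm.trans Equiv.piOptionEquivProd) _ _
    fun K => rfl

theorem arrangements_option_equiv (e : Option ι ≃ ι') (K J : ι' → ℕ) :
    arrangements K J = (K (e none)).descFactorial (J (e none)) *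
      arrangements (fun l => K (e (some l))) (fun l => J (e (some l))) := by
  rw [arrangements, ← e.prod_comp, Fintype.prod_option, arrangements]

theorem timeMultiset_option_equiv (e : Option ι ≃ ι') (μ : ι' → ℝ) (K : ι' → ℕ) :
    timeMultiset μ K = Multiset.replicate (K (e none)) (μ (e none)) +
      timeMultiset (fun l => μ (e (some l))) (fun l => K (e (some l))) := by
  rw [timeMultiset, ← e.sum_comp, Fintype.sum_option, Multiset.nsmul_singleton, timeMultiset]

/-- At most one interval carries two coupling operators. -/
def AtMostOneDouble {ι : Type*} (K : ι → Fin 3) : Prop := ∀ i j, K i = 2 → K j = 2 → i = j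

variable {V : Type*} [AddCommGroup V] [Module ℂ V] [DecidableEq ι'] [DecidableEq ι]

/-- The elements `Λ J` are combinations of the elements `O K` of the configurations `K`. The
weights are bounded in terms of `g`, and they are given by the influence functional of the
unpaired points if at most one interval carries two coupling operators. -/
structure Expands (B : ℝ → ℝ → ℂ) (g : ℕ → ℝ) (μ : ι → ℝ) (O Λ : (ι → Fin 3) → V)
    (w : (ι → Fin 3) → (ι → Fin 3) → ℂ) : Prop where
  expand : ∀ J, Λ J = ∑ K, w K J • O K
  bound : ∀ K, WeightLE (counts K) g (w K)
  exact : ∀ K, AtMostOneDouble K →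
    HasWeight (counts K) (fun k => multisetInfluence B (timeMultiset μ k)) (w K)

theorem Expands.extend {B : ℝ → ℝ → ℂ} {g : ℕ → ℝ} {b : ℝ} {μ : ι' → ℝ} {e : Option ι ≃ ι'}
    {O Λ : (ι → Fin 3) → V} {w : (ι → Fin 3) → (ι → Fin 3) → ℂ} {O' : (ι' → Fin 3) → V}
    {β : ℝ → ℂ} (hΛ : Expands B g (fun l => μ (e (some l))) O Λ w) (T : Fin 3 → V →ₗ[ℂ] V)
    (hO : ∀ K, T (K (e none)) (O fun l => K (e (some l))) = O' K)
    (hcons : ∀ M : Multiset ℝ, (∀ y ∈ M, y ∈ Set.range μ) →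
      multisetInfluence B (μ (e none) ::ₘ M) =
        (M.map fun y => β y * multisetInfluence B (M.erase y)).sum)
    (hβ : ∀ y, ‖β y‖ ≤ b) (hg : ∀ N, 0 ≤ g N)
    (hrec : ∀ N : ℕ, b * N * g (N - 1) ≤ g (N + 1)) :
    Expands B g μ O'
      (fun J => ∑ y, extTerm (fun l => β (μ (e (some l)))) (β (μ (e none)))
        (fun j => T y (Λ j)) y (J (e none)) fun l => J (e (some l)))
      (fun K J => extTerm (fun l => β (μ (e (some l)))) (β (μ (e none)))
        (w fun l => K (e (some l))) (K (e none)) (J (e none)) fun l => J (e (some l))) where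
  expand J := by
    simp only [hΛ.expand, map_sum, map_smul, extTerm_sum_smul, ← hO]
    exact (sum_pi_option_equiv e fun y k => extTerm (fun l => β (μ (e (some l))))
      (β (μ (e none))) (w k) y (J (e none)) (fun l => J (e (some l))) • T y (O k)).symm
  bound K J := by
    refine ((hΛ.bound _).norm_extTerm_le (fun l => hβ _) ((norm_nonneg _).trans (hβ 0)) hg hrec
      (hβ _) _ _ _).trans (le_of_eq ?_)
    rw [arrangements_option_equiv e, ← e.sum_comp, Fintype.sum_option]
    push_cast
    rfl
  exact K hK J := by
    have hrest : AtMostOneDouble fun l => K (e (some l)) := fun i j hi hj =>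
      Option.some_injective _ (e.injective (hK _ _ hi hj))
    have hsimple : K (e none) = 2 → ∀ l, counts (fun l => K (e (some l))) l ≤ 1 := fun hnew l =>
      counts_le_one fun hl => Option.some_ne_none l (e.injective (hK _ _ hl hnew))
    have hrecursion := pairingRecursion_multisetInfluence B (fun l => μ (e (some l)))
      (μ (e none)) β fun M hM => hcons M fun y hy => by
        rcases hM y hy with rfl | ⟨l, rfl⟩ <;> exact Set.mem_range_self _
    beta_reduce
    rw [(hΛ.exact _ hrest).extTerm_eq hrecursion hsimple (counts_le_two _),
      arrangements_option_equiv e, timeMultiset_option_equiv e]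
    push_cast
    rfl

end Configurations

/-! ### Expansion of the scheme over configurations -/

section SchemeExpansion

variable {a c : ℕ}

/-- A left extension adds the interval `(a+1)-`. -/
def optionIntervalLeft (a c : ℕ) : Option (Interval a c) ≃ Interval (a + 1) c :=
  Equiv.ofBijective (fun o => o.elim (.inl (Fin.last a)) (Sum.map Fin.castSucc id)) <| by
    constructor
    · rintro (_ | i | i) (_ | j | j) <;> simp [Fin.castSucc_ne_last, (Fin.castSucc_ne_last _).symm]
    · rintro (i | i)
      · exact i.lastCases ⟨none, rfl⟩ fun i => ⟨some (.inl i), rfl⟩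
      · exact ⟨some (.inr i), rfl⟩

/-- A right extension adds the interval `(c+1)+`. -/
def optionIntervalRight (a c : ℕ) : Option (Interval a c) ≃ Interval a (c + 1) :=
  Equiv.ofBijective (fun o => o.elim (.inr (Fin.last c)) (Sum.map id Fin.castSucc)) <| by
    constructor
    · rintro (_ | i | i) (_ | j | j) <;> simp [Fin.castSucc_ne_last, (Fin.castSucc_ne_last _).symm]
    · rintro (i | i)
      · exact ⟨some (.inl i), rfl⟩
      · exact i.lastCases ⟨none, rfl⟩ fun i => ⟨some (.inr i), rfl⟩

theorem optionIntervalLeft_some (l : Interval a c) :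
    optionIntervalLeft a c (some l) = l.map Fin.castSucc id := rfl

theorem optionIntervalRight_some (l : Interval a c) :
    optionIntervalRight a c (some l) = l.map id Fin.castSucc := rfl

theorem mid_optionIntervalLeft_some (h : ℝ) (l : Interval a c) :
    mid h (optionIntervalLeft a c (some l)) = mid h l := by
  rcases l with i | i <;> rfl

theorem mid_optionIntervalRight_some (h : ℝ) (l : Interval a c) :
    mid h (optionIntervalRight a c (some l)) = mid h l := by
  rcases l with i | i <;> rfl

theorem midL_le_mid {h : ℝ} (hh : 0 ≤ h) (l : Interval (a + 1) c) : midL h a ≤ mid h l := by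
  rcases l with i | i
  · have hi : (i : ℝ) ≤ a := by exact_mod_cast Nat.le_of_lt_succ i.is_lt
    exact mul_le_mul_of_nonneg_right (by linarith) hh
  · refine mul_le_mul_of_nonneg_right ?_ hh
    linarith [a.cast_nonneg (α := ℝ), (i : ℕ).cast_nonneg (α := ℝ)]

theorem mid_le_midR {h : ℝ} (hh : 0 ≤ h) (l : Interval a (c + 1)) : mid h l ≤ midR h c := by
  rcases l with i | i
  · refine mul_le_mul_of_nonneg_right ?_ hh
    linarith [c.cast_nonneg (α := ℝ), (i : ℕ).cast_nonneg (α := ℝ)]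
  · have hi : (i : ℝ) ≤ c := by exact_mod_cast Nat.le_of_lt_succ i.is_lt
    exact mul_le_mul_of_nonneg_right (by linarith) hh

variable {E : Type*} [NormedAddCommGroup E] [InnerProductSpace ℂ E] [CompleteSpace E]

/-- The one-interval operator with `y` coupling operators. -/
def stepOp (H W : E →L[ℂ] E) (h : ℝ) : Fin 3 → (E →L[ℂ] E)
  | 0 => P0 H h
  | 1 => P1 H W h
  | 2 => G2 H W h * G1 H W h

theorem stepOp_eq (H W : E →L[ℂ] E) (h : ℝ) (y : Fin 3) :
    stepOp H W h y = ((-Complex.I * (h : ℂ)) ^ (y : ℕ) / ((y : ℕ).factorial : ℂ)) •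
      (prop H (h / 2) * W ^ (y : ℕ) * prop H (h / 2)) := by
  match y with
  | 0 => simp [stepOp, P0, ← prop_add]
  | 1 => simp [stepOp, P1]
  | 2 =>
    simp only [stepOp, G1, G2, smul_mul_smul_comm, Fin.val_two, pow_two, Nat.factorial_two]
    congr 1
    push_cast
    ring

theorem star_stepOp {H W : E →L[ℂ] E} (hH : IsSelfAdjoint H) (hW : IsSelfAdjoint W) (h : ℝ)
    (y : Fin 3) :
    star (stepOp H W h y) = ((Complex.I * (h : ℂ)) ^ (y : ℕ) / ((y : ℕ).factorial : ℂ)) •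
      (prop H (-(h / 2)) * W ^ (y : ℕ) * prop H (-(h / 2))) := by
  rw [stepOp_eq, star_smul, star_mul, star_mul, star_pow, hW.star_eq, star_prop hH, mul_assoc]
  congr 1
  simp

section Extensions

variable (H W : E →L[ℂ] E) (B : ℝ → ℝ → ℂ) (h : ℝ) (Λ : Marks a c → (E →L[ℂ] E))
  (x : Fin 3) (j : Marks a c)

theorem G2_mul_leftHalf :
    G2 H W h * leftHalf H W B h Λ x j = extHalf (fun l => B (midL h a) (mid h l))
      (fun i => stepOp H W h 2 * Λ i) x j := by
  simp only [stepOp, mul_assoc]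
  exact map_extHalf (LinearMap.mulLeft ℂ (G2 H W h)) _ (fun i => G1 H W h * Λ i) x j

theorem rightHalf_mul_star_G2 :
    rightHalf H W B h Λ x j * star (G2 H W h) = extHalf (fun l => B (mid h l) (midR h c))
      (fun i => Λ i * star (stepOp H W h 2)) x j := by
  simp only [stepOp, star_mul, ← mul_assoc]
  exact map_extHalf (LinearMap.mulRight ℂ (star (G2 H W h))) _ (fun i => Λ i * star (G1 H W h)) x j

theorem leftStep_eq_sum_extTerm :
    leftStep H W B h Λ x j =
      ∑ y, extTerm (fun l => B (midL h a) (mid h l)) (B (midL h a) (midL h a))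
        (fun i => stepOp H W h y * Λ i) y x j := by
  rw [Fin.sum_univ_three]
  match x with
  | 0 => simp only [leftStep, extTerm, G2_mul_leftHalf, stepOp, add_assoc]
  | 1 => simp only [leftStep, extTerm, G2_mul_leftHalf, stepOp, add_assoc, zero_add]
  | 2 => simp only [leftStep, extTerm, G2_mul_leftHalf, zero_add]

theorem rightStep_eq_sum_extTerm :
    rightStep H W B h Λ x j =
      ∑ y, extTerm (fun l => B (mid h l) (midR h c)) (B (midR h c) (midR h c))
        (fun i => Λ i * star (stepOp H W h y)) y x j := by
  rw [Fin.sum_univ_three]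
  match x with
  | 0 => simp only [rightStep, extTerm, rightHalf_mul_star_G2, stepOp, add_assoc]
  | 1 => simp only [rightStep, extTerm, rightHalf_mul_star_G2, stepOp, add_assoc, zero_add]
  | 2 => simp only [rightStep, extTerm, rightHalf_mul_star_G2, zero_add]

end Extensions

/-- The time points of a configuration with `k i` points at the midpoint of the `i`-th interval,
in increasing order. -/
def timeList (h : ℝ) : (a : ℕ) → (Fin a → ℕ) → List ℝ
  | 0, _ => []
  | a + 1, k => timeList h a (fun i => k i.castSucc) ++ List.replicate (k (Fin.last a)) (midR h a)

/-- The product of the one-interval prefactors `z ^ k / k!`. -/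
def prefactor (z : ℂ) {a : ℕ} (k : Fin a → ℕ) : ℂ := ∏ i, z ^ k i / ((k i).factorial : ℂ)

/-- The operator of the configuration with `k l` coupling operators at the midpoint of each
interval `l`. -/
def chainOp (H W ρ₀ : E →L[ℂ] E) (h : ℝ) (k : Interval a c → ℕ) : E →L[ℂ] E :=
  (prefactor (-Complex.I * h) (fun i => k (.inl i)) *
    prefactor (Complex.I * h) (fun i => k (.inr i))) •
    sandwich H W ρ₀ (a * h) (c * h) (timeList h a fun i => k (.inl i))
      (timeList h c fun i => k (.inr i))

theorem stepOp_mul_chainOp (H W ρ₀ : E →L[ℂ] E) (h : ℝ) (K : Marks (a + 1) c) :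
    stepOp H W h (K (.inl (Fin.last a))) *
        chainOp H W ρ₀ h (counts fun l => K (optionIntervalLeft a c (some l))) =
      chainOp H W ρ₀ h (counts K) := by
  have hfinal : prop H (((a + 1 : ℕ) : ℝ) * h) * prop H (-midR h a) = prop H (h / 2) := by
    rw [← prop_add, midR]; congr 1; push_cast; ring
  have hmid : prop H (midR h a) = prop H (h / 2) * prop H (a * h) := by
    rw [← prop_add, midR]; congr 1; ring
  simp only [chainOp, prefactor, Fin.prod_univ_castSucc, timeList, stepOp_eq, smul_mul_smul_comm]
  simp only [counts, optionIntervalLeft_some, Sum.map_inl, Sum.map_inr, id]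
  congr 1
  · ring
  · simp only [sandwich, List.map_append, List.map_replicate, List.reverse_append,
      List.reverse_replicate, List.prod_append, List.prod_replicate, coupling_pow, ← mul_assoc]
    rw [hfinal, hmid]
    simp only [← mul_assoc]

theorem chainOp_mul_star_stepOp {H W : E →L[ℂ] E} (hH : IsSelfAdjoint H) (hW : IsSelfAdjoint W)
    (ρ₀ : E →L[ℂ] E) (h : ℝ) (K : Marks a (c + 1)) :
    chainOp H W ρ₀ h (counts fun l => K (optionIntervalRight a c (some l))) *
        star (stepOp H W h (K (.inr (Fin.last c)))) =
      chainOp H W ρ₀ h (counts K) := by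
  have hfinal : prop H (midR h c) * prop H (-(((c + 1 : ℕ) : ℝ) * h)) = prop H (-(h / 2)) := by
    rw [← prop_add, midR]; congr 1; push_cast; ring
  have hmid : prop H (-midR h c) = prop H (-(c * h)) * prop H (-(h / 2)) := by
    rw [← prop_add, midR]; congr 1; ring
  simp only [chainOp, prefactor, Fin.prod_univ_castSucc, timeList, star_stepOp hH hW,
    smul_mul_smul_comm]
  simp only [counts, optionIntervalRight_some, Sum.map_inl, Sum.map_inr, id]
  congr 1
  · ring
  · simp only [sandwich, List.map_append, List.map_replicate, List.prod_append,
      List.prod_replicate, coupling_pow, mul_assoc]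
    rw [hfinal, hmid]
    simp only [mul_assoc]

variable {H W ρ₀ : E →L[ℂ] E} {B : ℝ → ℝ → ℂ} {h b : ℝ} {g : ℕ → ℝ}
  {Λ : Marks a c → (E →L[ℂ] E)} {w : Marks a c → Marks a c → ℂ}

theorem exists_expands_leftExt
    (hΛ : Expands B g (mid h) (fun K => chainOp H W ρ₀ h (counts K)) Λ w) (hh : 0 ≤ h)
    (hB : ∀ x y, ‖B x y‖ ≤ b) (hg : ∀ N, 0 ≤ g N)
    (hrec : ∀ N : ℕ, b * N * g (N - 1) ≤ g (N + 1)) :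
    ∃ w', Expands B g (mid h) (fun K => chainOp H W ρ₀ h (counts K)) (leftExt H W B h Λ) w' := by
  have hΛ' : Expands B g (fun l => mid h (optionIntervalLeft a c (some l)))
      (fun K => chainOp H W ρ₀ h (counts K)) Λ w := by
    simpa only [mid_optionIntervalLeft_some] using hΛ
  have hext := hΛ'.extend (fun y => LinearMap.mulLeft ℂ (stepOp H W h y))
    (fun K => stepOp_mul_chainOp H W ρ₀ h K)
    (fun M hM => multisetInfluence_cons_of_le B fun y hy => by
      obtain ⟨l, rfl⟩ := hM y hy
      exact midL_le_mid hh l)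
    (fun y => hB _ y) hg hrec
  have hstep : leftExt H W B h Λ = _ := funext fun J => leftStep_eq_sum_extTerm H W B h Λ _ _
  simp only [mid_optionIntervalLeft_some] at hext
  exact ⟨_, hstep ▸ hext⟩

theorem exists_expands_rightExt (hH : IsSelfAdjoint H) (hW : IsSelfAdjoint W)
    (hΛ : Expands B g (mid h) (fun K => chainOp H W ρ₀ h (counts K)) Λ w) (hh : 0 ≤ h)
    (hB : ∀ x y, ‖B x y‖ ≤ b) (hg : ∀ N, 0 ≤ g N)
    (hrec : ∀ N : ℕ, b * N * g (N - 1) ≤ g (N + 1)) :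
    ∃ w', Expands B g (mid h) (fun K => chainOp H W ρ₀ h (counts K)) (rightExt H W B h Λ) w' := by
  have hΛ' : Expands B g (fun l => mid h (optionIntervalRight a c (some l)))
      (fun K => chainOp H W ρ₀ h (counts K)) Λ w := by
    simpa only [mid_optionIntervalRight_some] using hΛ
  have hext := hΛ'.extend (fun y => LinearMap.mulRight ℂ (star (stepOp H W h y)))
    (fun K => chainOp_mul_star_stepOp hH hW ρ₀ h K)
    (fun M hM => multisetInfluence_cons_of_ge B fun y hy => by
      obtain ⟨l, rfl⟩ := hM y hy
      exact mid_le_midR hh l)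
    (fun y => hB y _) hg hrec
  have hstep : rightExt H W B h Λ = _ := funext fun J => rightStep_eq_sum_extTerm H W B h Λ _ _
  simp only [mid_optionIntervalRight_some] at hext
  exact ⟨_, hstep ▸ hext⟩

theorem exists_expands_diagrams (ρ₀ : E →L[ℂ] E) (hH : IsSelfAdjoint H) (hW : IsSelfAdjoint W)
    (hh : 0 ≤ h) (hB : ∀ x y, ‖B x y‖ ≤ b) (hg : ∀ N, 0 ≤ g N) (hg0 : 1 ≤ g 0)
    (hrec : ∀ N : ℕ, b * N * g (N - 1) ≤ g (N + 1)) (n : ℕ) :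
    ∃ w, Expands B g (mid h) (fun K => chainOp H W ρ₀ h (counts K))
      (diagrams H W ρ₀ B h n) w := by
  induction n with
  | zero =>
    refine ⟨fun _ _ => 1, fun _ => ?_, fun K J => ?_, fun K _ _ => ?_⟩
    · simp [diagrams, chainOp, prefactor, sandwich, timeList, prop_zero]
    · simpa [arrangements] using hg0
    · simp [arrangements, timeMultiset, multisetInfluence_zero]
  | succ n ih =>
    obtain ⟨w, hw⟩ := ih
    obtain ⟨w', hw'⟩ := exists_expands_leftExt hw hh hB hg hrec
    exact exists_expands_rightExt hH hW hw' hh hB hg hrec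

theorem exists_rhoTilde_eq (ρ₀ : E →L[ℂ] E) (hH : IsSelfAdjoint H) (hW : IsSelfAdjoint W)
    (hh : 0 ≤ h) (hB : ∀ x y, ‖B x y‖ ≤ b) (hg : ∀ N, 0 ≤ g N) (hg0 : 1 ≤ g 0)
    (hrec : ∀ N : ℕ, b * N * g (N - 1) ≤ g (N + 1)) (n : ℕ) :
    ∃ w : Marks n n → ℂ,
      rhoTilde H W ρ₀ B h n = ∑ K, w K • chainOp H W ρ₀ h (counts K) ∧
      (∀ K, ‖w K‖ ≤ g (∑ l, counts K l)) ∧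
      ∀ K, AtMostOneDouble K →
        w K = multisetInfluence B (timeMultiset (mid h) (counts K)) := by
  obtain ⟨w, hw⟩ := exists_expands_diagrams ρ₀ hH hW hh hB hg hg0 hrec n
  have hzero : counts (fun _ : Interval n n => (0 : Fin 3)) = 0 := rfl
  refine ⟨fun K => w K fun _ => 0, hw.expand _, fun K => ?_, fun K hK => ?_⟩
  · simpa only [hzero, arrangements_zero, tsub_zero, Nat.cast_one, one_mul] using
      hw.bound K fun _ => 0
  · simpa only [hzero, arrangements_zero, tsub_zero, Nat.cast_one, one_mul] using
      hw.exact K hK fun _ => 0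

end SchemeExpansion

/-! ### The composite midpoint rule in one variable -/

section OneVariable

/-- The midpoint of the interval of the uniform grid with step `h` that contains `x`. -/
def gridMid (h x : ℝ) : ℝ := midR h ⌊x / h⌋₊

theorem measurable_gridMid (h : ℝ) : Measurable (gridMid h) := by
  have hfloor : Measurable fun x : ℝ => (⌊x / h⌋₊ : ℝ) :=
    measurable_from_nat.comp (Nat.measurable_floor.comp (measurable_id.div_const h))
  exact (hfloor.add_const _).mul_const _

theorem midR_pos {h : ℝ} (hh : 0 < h) (i : ℕ) : 0 < midR h i := by
  unfold midR; positivity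

theorem gridMid_pos {h : ℝ} (hh : 0 < h) (x : ℝ) : 0 < gridMid h x := midR_pos hh _

theorem gridMid_eq {h x : ℝ} (hh : 0 < h) {i : ℕ} (hix : i * h ≤ x) (hxi : x < (i + 1) * h) :
    gridMid h x = midR h i := by
  have hfloor : ⌊x / h⌋₊ = i := by
    rw [Nat.floor_eq_iff (div_nonneg (le_trans (by positivity) hix) hh.le)]
    exact ⟨(le_div_iff₀ hh).2 hix, (div_lt_iff₀ hh).2 hxi⟩
  rw [gridMid, hfloor]

theorem floor_mul_le {h x : ℝ} (hh : 0 < h) (hx : 0 ≤ x) : (⌊x / h⌋₊ : ℝ) * h ≤ x :=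
  (le_div_iff₀ hh).1 (Nat.floor_le (by positivity))

theorem lt_floor_add_one_mul {h : ℝ} (hh : 0 < h) (x : ℝ) : x < (⌊x / h⌋₊ + 1) * h :=
  (div_lt_iff₀ hh).1 (Nat.lt_floor_add_one _)

theorem abs_sub_gridMid_le {h x : ℝ} (hh : 0 < h) (hx : 0 ≤ x) : |x - gridMid h x| ≤ h := by
  rw [gridMid, midR, abs_le]
  constructor <;> nlinarith [floor_mul_le hh hx, lt_floor_add_one_mul hh x]

theorem gridMid_mono {h : ℝ} (hh : 0 < h) : Monotone (gridMid h) := fun x y hxy => by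
  unfold gridMid midR
  gcongr

theorem abs_sub_midR_le {h x : ℝ} {i : ℕ} (hx : x ∈ Set.Icc (i * h) ((i + 1) * h)) :
    |x - midR h i| ≤ h := by
  rw [midR, abs_le]
  constructor <;> nlinarith [hx.1, hx.2]

theorem integral_sub_midR (h : ℝ) (i : ℕ) :
    ∫ x in (i * h)..((i + 1) * h), (x - midR h i) = 0 := by
  rw [intervalIntegral.integral_sub (by simp) (by simp), integral_id,
    intervalIntegral.integral_const, midR, smul_eq_mul]
  ring

variable {F : Type*} [NormedAddCommGroup F]

theorem aestronglyMeasurable_comp_of_continuousOn {X Y : Type*} [MeasurableSpace X]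
    [TopologicalSpace Y] [MeasurableSpace Y] [OpensMeasurableSpace Y]
    [SecondCountableTopology Y] {μ : Measure X} {f : Y → F} {g : X → Y} {U : Set Y} {S : Set X}
    (hf : ContinuousOn f U) (hU : MeasurableSet U) (hg : Measurable g) (hS : MeasurableSet S)
    (hSU : Set.MapsTo g S U) : AEStronglyMeasurable (fun x => f (g x)) (μ.restrict S) := by
  have hext : StronglyMeasurable (Function.extend ((↑) : U → Y) (U.domRestrict f) fun _ => 0) :=
    (MeasurableEmbedding.subtype_coe hU).stronglyMeasurable_extend
      (continuousOn_iff_continuous_domRestrict.1 hf).stronglyMeasurable stronglyMeasurable_const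
  refine ((hext.comp_measurable hg).aestronglyMeasurable (μ := μ.restrict S)).congr ?_
  filter_upwards [ae_restrict_mem hS] with x hx
  exact Subtype.val_injective.extend_apply (U.domRestrict f) _ (⟨g x, hSU hx⟩ : U)

variable [NormedSpace ℝ F]

theorem intervalIntegral_comp_gridMid_cell {h : ℝ} (hh : 0 < h) (i : ℕ) (f : ℝ → ℝ → F) :
    ∫ x in (i * h)..((i + 1) * h), f x (gridMid h x) =
      ∫ x in (i * h)..((i + 1) * h), f x (midR h i) := by
  refine intervalIntegral.integral_congr_ae ?_
  filter_upwards [(Set.countable_singleton ((i + 1) * h)).ae_notMem volume] with x hne hx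
  rw [Set.uIoc_of_le (by nlinarith)] at hx
  rw [gridMid_eq hh hx.1.le (lt_of_le_of_ne hx.2 hne)]

theorem norm_sub_sub_smul_le_of_norm_deriv_le {φ φ' φ'' : ℝ → F} {s : Set ℝ} {M x c : ℝ}
    (hs : Convex ℝ s) (hφ : ∀ z ∈ s, HasDerivAt φ (φ' z) z)
    (hφ' : ∀ z ∈ s, HasDerivAt φ' (φ'' z) z) (hM : ∀ z ∈ s, ‖φ'' z‖ ≤ M)
    (hc : c ∈ s) (hx : x ∈ s) : ‖φ x - φ c - (x - c) • φ' c‖ ≤ M * |x - c| ^ 2 := by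
  have hsub : Set.uIcc c x ⊆ s := (segment_eq_uIcc c x).symm.le.trans (hs.segment_subset hc hx)
  have hslope : ∀ z ∈ Set.uIcc c x, ‖φ' z - (1 : ℝ) • φ' c‖ ≤ M * |x - c| := fun z hz => by
    rw [one_smul]
    refine (hs.norm_image_sub_le_of_norm_hasDerivWithin_le
      (fun z hz => (hφ' z hz).hasDerivWithinAt) hM hc (hsub hz)).trans ?_
    exact mul_le_mul_of_nonneg_left (Set.abs_sub_left_of_mem_uIcc hz)
      ((norm_nonneg _).trans (hM c hc))
  calc ‖φ x - φ c - (x - c) • φ' c‖ = ‖(φ x - x • φ' c) - (φ c - c • φ' c)‖ := by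
        congr 1; rw [sub_smul]; abel
    _ ≤ M * |x - c| * ‖x - c‖ := (convex_uIcc c x).norm_image_sub_le_of_norm_hasDerivWithin_le
        (fun z hz => ((hφ z (hsub hz)).sub
          ((hasDerivAt_id z).smul_const (φ' c))).hasDerivWithinAt)
        hslope Set.left_mem_uIcc Set.right_mem_uIcc
    _ = M * |x - c| ^ 2 := by rw [Real.norm_eq_abs]; ring

/-- `φ` is twice differentiable on the positive half-line, and its derivatives of order `0`, `1`
and `2` are bounded by `K`, `K * L` and `K * L ^ 2`. The geometric growth of the bounds makes the
class stable under products, with `L` replaced by the sum of the two rates. -/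
def C2Bound (φ : ℝ → F) (K L : ℝ) : Prop :=
  ∃ φ' φ'' : ℝ → F, ∀ x, 0 < x → HasDerivAt φ (φ' x) x ∧ HasDerivAt φ' (φ'' x) x ∧
    ‖φ x‖ ≤ K ∧ ‖φ' x‖ ≤ K * L ∧ ‖φ'' x‖ ≤ K * L ^ 2

namespace C2Bound

variable {φ : ℝ → F} {K L : ℝ}

theorem mul_nonneg (hφ : C2Bound φ K L) : 0 ≤ K * L := by
  obtain ⟨φ', φ'', hφ⟩ := hφ
  exact (norm_nonneg _).trans (hφ 1 one_pos).2.2.2.1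

theorem mul_sq_nonneg (hφ : C2Bound φ K L) : 0 ≤ K * L ^ 2 := by
  obtain ⟨φ', φ'', hφ⟩ := hφ
  exact (norm_nonneg _).trans (hφ 1 one_pos).2.2.2.2

theorem norm_le (hφ : C2Bound φ K L) {x : ℝ} (hx : 0 < x) : ‖φ x‖ ≤ K := by
  obtain ⟨φ', φ'', hφ⟩ := hφ
  exact (hφ x hx).2.2.1

theorem continuousOn (hφ : C2Bound φ K L) : ContinuousOn φ (Set.Ioi 0) := by
  obtain ⟨φ', φ'', hφ⟩ := hφ
  exact fun x hx => (hφ x hx).1.continuousAt.continuousWithinAt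

theorem norm_sub_le (hφ : C2Bound φ K L) {x y : ℝ} (hx : 0 < x) (hy : 0 < y) :
    ‖φ x - φ y‖ ≤ K * L * |x - y| := by
  obtain ⟨φ', φ'', hφ⟩ := hφ
  exact Convex.norm_image_sub_le_of_norm_hasDerivWithin_le (s := Set.Ioi 0) (f' := φ')
    (fun z hz => (hφ z hz).1.hasDerivWithinAt) (fun z hz => (hφ z hz).2.2.2.1)
    (convex_Ioi 0) hy hx

theorem integrableOn_comp (hφ : C2Bound φ K L) {g : ℝ → ℝ} (hg : Measurable g) {S : Set ℝ}
    (hS : MeasurableSet S) (hgS : Set.MapsTo g S (Set.Ioi 0)) (hfin : volume S ≠ ⊤) :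
    IntegrableOn (fun x => φ (g x)) S := by
  refine IntegrableOn.of_bound hfin.lt_top
    (aestronglyMeasurable_comp_of_continuousOn hφ.continuousOn measurableSet_Ioi hg hS hgS) K ?_
  filter_upwards [ae_restrict_mem hS] with x hx
  exact hφ.norm_le (hgS hx)

theorem intervalIntegrable (hφ : C2Bound φ K L) {x y : ℝ} (hx : 0 ≤ x) (hxy : x ≤ y) :
    IntervalIntegrable φ volume x y := by
  rw [intervalIntegrable_iff_integrableOn_Ioc_of_le hxy]
  exact hφ.integrableOn_comp measurable_id measurableSet_Ioc (fun z hz => hx.trans_lt hz.1)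
    (by simp)

theorem intervalIntegrable_sub_gridMid (hφ : C2Bound φ K L) {h : ℝ} (hh : 0 < h) {x y : ℝ}
    (hx : 0 ≤ x) (hxy : x ≤ y) :
    IntervalIntegrable (fun z => φ z - φ (gridMid h z)) volume x y := by
  refine (hφ.intervalIntegrable hx hxy).sub ?_
  rw [intervalIntegrable_iff_integrableOn_Ioc_of_le hxy]
  exact hφ.integrableOn_comp (measurable_gridMid h) measurableSet_Ioc
    (fun z _ => gridMid_pos hh z) (by simp)

variable [CompleteSpace F]

-- The linear Taylor term at the midpoint integrates to zero, which gains one order.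
theorem norm_integral_cell_le (hφ : C2Bound φ K L) {h : ℝ} (hh : 0 < h) (i : ℕ) :
    ‖∫ x in (i * h)..((i + 1) * h), (φ x - φ (gridMid h x))‖ ≤ K * L ^ 2 * h ^ 3 := by
  have hcell : (i : ℝ) * h ≤ (i + 1) * h := by nlinarith
  have hint : IntervalIntegrable φ volume (i * h) ((i + 1) * h) :=
    hφ.intervalIntegrable (by positivity) hcell
  have hM := hφ.mul_sq_nonneg
  obtain ⟨φ', φ'', hφ⟩ := hφ
  have hTaylor : ∀ x ∈ Set.uIoc (i * h) ((i + 1) * h),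
      ‖φ x - φ (midR h i) - (x - midR h i) • φ' (midR h i)‖ ≤ K * L ^ 2 * h ^ 2 := by
    intro x hx
    rw [Set.uIoc_of_le hcell] at hx
    refine (norm_sub_sub_smul_le_of_norm_deriv_le (convex_Ioi 0) (fun z hz => (hφ z hz).1)
      (fun z hz => (hφ z hz).2.1) (fun z hz => (hφ z hz).2.2.2.2) (midR_pos hh i)
      (lt_of_le_of_lt (by positivity) hx.1)).trans ?_
    have hdist : |x - midR h i| ≤ h := abs_sub_midR_le (Set.Ioc_subset_Icc_self hx)
    gcongr
  have hlinear : ∫ x in (i * h)..((i + 1) * h), (x - midR h i) • φ' (midR h i) = 0 := by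
    rw [intervalIntegral.integral_smul_const, integral_sub_midR, zero_smul]
  calc ‖∫ x in (i * h)..((i + 1) * h), (φ x - φ (gridMid h x))‖
      = ‖∫ x in (i * h)..((i + 1) * h),
          (φ x - φ (midR h i) - (x - midR h i) • φ' (midR h i))‖ := by
        rw [intervalIntegral_comp_gridMid_cell hh i fun x c => φ x - φ c,
          intervalIntegral.integral_sub (hint.sub (by simp))
            (Continuous.intervalIntegrable (by fun_prop) _ _), hlinear, sub_zero]
    _ ≤ K * L ^ 2 * h ^ 2 * |(i + 1) * h - i * h| :=
        intervalIntegral.norm_integral_le_of_norm_le_const hTaylor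
    _ = K * L ^ 2 * h ^ 3 := by
        rw [show (i + 1) * h - i * h = h by ring, abs_of_pos hh]; ring

theorem norm_integral_cells_le (hφ : C2Bound φ K L) {h : ℝ} (hh : 0 < h) (i : ℕ) :
    ‖∫ z in (0 : ℝ)..(i * h), (φ z - φ (gridMid h z))‖ ≤ i * (K * L ^ 2 * h ^ 3) := by
  induction i with
  | zero => simp
  | succ i ih =>
    push_cast
    rw [← intervalIntegral.integral_add_adjacent_intervals
      (hφ.intervalIntegrable_sub_gridMid hh (y := i * h) le_rfl (by positivity))
      (hφ.intervalIntegrable_sub_gridMid hh (by positivity) (by nlinarith))]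
    exact (norm_add_le_of_le ih (hφ.norm_integral_cell_le hh i)).trans (by linarith)

theorem norm_integral_zero_le (hφ : C2Bound φ K L) {h x : ℝ} (hh : 0 < h) (hx : 0 ≤ x) :
    ‖∫ z in (0 : ℝ)..x, (φ z - φ (gridMid h z))‖ ≤ (K * L ^ 2 * x + K * L) * h ^ 2 := by
  have hKL := hφ.mul_nonneg
  have hKL2 := hφ.mul_sq_nonneg
  set i := ⌊x / h⌋₊
  have hix : (i : ℝ) * h ≤ x := floor_mul_le hh hx
  have hxi : |x - i * h| ≤ h := by
    rw [abs_of_nonneg (sub_nonneg.2 hix)]; linarith [lt_floor_add_one_mul hh x]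
  have hlast : ‖∫ z in (i * h)..x, (φ z - φ (gridMid h z))‖ ≤ K * L * h * |x - i * h| := by
    refine intervalIntegral.norm_integral_le_of_norm_le_const fun z hz => ?_
    rw [Set.uIoc_of_le hix] at hz
    have hz : 0 < z := lt_of_le_of_lt (by positivity) hz.1
    exact (hφ.norm_sub_le hz (gridMid_pos hh z)).trans
      (mul_le_mul_of_nonneg_left (abs_sub_gridMid_le hh hz.le) hKL)
  rw [← intervalIntegral.integral_add_adjacent_intervals
    (hφ.intervalIntegrable_sub_gridMid hh (y := i * h) le_rfl (by positivity))
    (hφ.intervalIntegrable_sub_gridMid hh (by positivity) hix)]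
  calc _ ≤ (i : ℝ) * (K * L ^ 2 * h ^ 3) + K * L * h * |x - i * h| :=
        norm_add_le_of_le (hφ.norm_integral_cells_le hh i) hlast
    _ = K * L ^ 2 * (i * h) * h ^ 2 + K * L * h * |x - i * h| := by ring
    _ ≤ K * L ^ 2 * x * h ^ 2 + K * L * h * h := by gcongr
    _ = _ := by ring

end C2Bound

theorem exists_ae_eq_Ioc_of_ordConnected {S : Set ℝ} {a b : ℝ} (hS : S.OrdConnected)
    (hne : S.Nonempty) (hSab : S ⊆ Set.Icc a b) :
    ∃ α β, a ≤ α ∧ α ≤ β ∧ β ≤ b ∧ S =ᵐ[volume] Set.Ioc α β := by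
  have hbelow : BddBelow S := bddBelow_Icc.mono hSab
  have habove : BddAbove S := bddAbove_Icc.mono hSab
  have hsub : S ⊆ Set.Icc (sInf S) (sSup S) := subset_Icc_csInf_csSup hbelow habove
  have hsup : Set.Ioo (sInf S) (sSup S) ⊆ S := by
    intro z hz
    obtain ⟨u, hu, huz⟩ := exists_lt_of_csInf_lt hne hz.1
    obtain ⟨v, hv, hvz⟩ := exists_lt_of_lt_csSup hne hz.2
    exact hS.out hu hv ⟨huz.le, hvz.le⟩
  exact ⟨sInf S, sSup S, le_csInf hne fun z hz => (hSab hz).1, csInf_le_csSup hne hbelow habove,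
    csSup_le hne fun z hz => (hSab hz).2,
    ((LE.le.eventuallyLE hsub).trans Ioc_ae_eq_Icc.symm.le).antisymm
      (Ioo_ae_eq_Ioc.symm.le.trans (LE.le.eventuallyLE hsup))⟩

theorem C2Bound.norm_setIntegral_le [CompleteSpace F] {φ : ℝ → F} {K L h T : ℝ}
    (hφ : C2Bound φ K L) (hh : 0 < h) (hT : 0 ≤ T) {S : Set ℝ} (hS : S.OrdConnected)
    (hST : S ⊆ Set.Icc 0 T) :
    ‖∫ z in S, (φ z - φ (gridMid h z))‖ ≤ 2 * (K * L ^ 2 * T + K * L) * h ^ 2 := by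
  have hKL := hφ.mul_nonneg
  have hKL2 := hφ.mul_sq_nonneg
  rcases S.eq_empty_or_nonempty with rfl | hne
  · simp only [Measure.restrict_empty, integral_zero_measure, norm_zero]
    positivity
  obtain ⟨α, β, hα, hαβ, hβ, hSαβ⟩ := exists_ae_eq_Ioc_of_ordConnected hS hne hST
  have hbound : ∀ x, 0 ≤ x → x ≤ T → ‖∫ z in (0 : ℝ)..x, (φ z - φ (gridMid h z))‖ ≤
      (K * L ^ 2 * T + K * L) * h ^ 2 := fun x hx hxT =>
    (hφ.norm_integral_zero_le hh hx).trans (by gcongr)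
  rw [setIntegral_congr_set hSαβ, ← intervalIntegral.integral_of_le hαβ,
    ← intervalIntegral.integral_interval_sub_left
      (hφ.intervalIntegrable_sub_gridMid hh le_rfl (hα.trans hαβ))
      (hφ.intervalIntegrable_sub_gridMid hh le_rfl hα)]
  refine (norm_sub_le_of_le (hbound β (hα.trans hαβ) hβ)
    (hbound α hα (hαβ.trans hβ))).trans (le_of_eq ?_)
  ring

end OneVariable

/-! ### Integrals over time-ordered simplices -/

section Simplex

theorem measurableSet_simplex (m : ℕ) (T : ℝ) : MeasurableSet (simplex m T) := by
  have hsimplex : simplex m T = (⋂ i : Fin m, ⋂ j : Fin m, {s | i < j → s i < s j}) ∩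
      ⋂ i : Fin m, {s | s i ∈ Set.Ioo 0 T} := by
    ext s
    simp only [simplex, StrictMono, Set.mem_inter_iff, Set.mem_iInter, Set.mem_ofPred_eq]
  rw [hsimplex]
  refine MeasurableSet.inter (MeasurableSet.iInter fun i => MeasurableSet.iInter fun j => ?_)
    (MeasurableSet.iInter fun i => measurableSet_Ioo.preimage (measurable_pi_apply i))
  by_cases hij : i < j
  · simpa [hij] using measurableSet_lt (measurable_pi_apply i) (measurable_pi_apply j)
  · simp [hij]

/-- The open cube `(0, T) ^ m`, the union of the images of the simplex under permutations of the
coordinates up to a null set. -/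
def cube (m : ℕ) (T : ℝ) : Set (Fin m → ℝ) := Set.univ.pi fun _ => Set.Ioo 0 T

theorem simplex_subset_cube (m : ℕ) (T : ℝ) : simplex m T ⊆ cube m T :=
  fun _ hs i _ => hs.2 i

theorem mem_cube_of_comp_perm_mem_simplex {m : ℕ} {T : ℝ} {s : Fin m → ℝ}
    {σ : Equiv.Perm (Fin m)} (hs : s ∘ σ ∈ simplex m T) : s ∈ cube m T := fun i _ => by
  simpa using hs.2 (σ.symm i)

theorem volume_cube (m : ℕ) (T : ℝ) : volume (cube m T) = ENNReal.ofReal T ^ m := by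
  simp [cube, Real.volume_pi_Ioo]

theorem ae_apply_ne_apply {ι : Type*} [Fintype ι] {i j : ι} (hij : i ≠ j) :
    ∀ᵐ s : ι → ℝ, s i ≠ s j := by
  classical
  let diagonal : Submodule ℝ (ι → ℝ) :=
    LinearMap.ker (LinearMap.proj (R := ℝ) (φ := fun _ : ι => ℝ) i - LinearMap.proj j)
  have hproper : diagonal ≠ ⊤ := fun htop => by
    have hmem : (Pi.single i 1 : ι → ℝ) ∈ diagonal := htop ▸ Submodule.mem_top
    simp [diagonal, LinearMap.mem_ker, hij.symm] at hmem
  rw [ae_iff]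
  convert Measure.addHaar_submodule volume diagonal hproper using 2
  ext s
  simp [diagonal, LinearMap.mem_ker, sub_eq_zero]

theorem ae_injective (ι : Type*) [Fintype ι] : ∀ᵐ s : ι → ℝ, Function.Injective s := by
  have hne : ∀ᵐ s : ι → ℝ, ∀ i j, i ≠ j → s i ≠ s j := by
    simp only [ae_all_iff]
    exact fun i j hij => ae_apply_ne_apply hij
  filter_upwards [hne] with s hs i j
  exact not_imp_not.1 (hs i j)

theorem cube_ae_eq_iUnion_perm (m : ℕ) (T : ℝ) :
    cube m T =ᵐ[volume] ⋃ σ : Equiv.Perm (Fin m), {s : Fin m → ℝ | s ∘ σ ∈ simplex m T} := by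
  rw [Filter.eventuallyEq_set]
  filter_upwards [ae_injective (Fin m)] with s hs
  rw [Set.mem_iUnion]
  exact ⟨fun hcube => ⟨Tuple.sort s, (Tuple.monotone_sort s).strictMono_of_injective
    (hs.comp (Tuple.sort s).injective), fun i => hcube _ (Set.mem_univ _)⟩,
    fun ⟨σ, hσ⟩ => mem_cube_of_comp_perm_mem_simplex hσ⟩

theorem pairwise_disjoint_comp_perm_mem_simplex (m : ℕ) (T : ℝ) :
    Pairwise (Function.onFun Disjoint fun σ : Equiv.Perm (Fin m) =>
      {s : Fin m → ℝ | s ∘ σ ∈ simplex m T}) := by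
  intro σ τ hστ
  refine Set.disjoint_left.2 fun s hσ hτ => hστ ?_
  have hcomp : s ∘ σ = s ∘ τ := by
    refine (StrictMono.range_inj hσ.1 hτ.1).1 ?_
    rw [σ.surjective.range_comp, τ.surjective.range_comp]
  have hs : Function.Injective s := (Equiv.injective_comp σ s).1 hσ.1.injective
  exact Equiv.ext fun i => hs (congrFun hcomp i)

section NormedSpace

variable {F : Type*} [NormedAddCommGroup F] [NormedSpace ℝ F]

theorem setIntegral_comp_perm {m : ℕ} (σ : Equiv.Perm (Fin m)) (g : (Fin m → ℝ) → F)
    (S : Set (Fin m → ℝ)) : ∫ s in {s | s ∘ σ ∈ S}, g (s ∘ σ) = ∫ s in S, g s :=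
  (volume_preserving_arrowCongr' σ.symm (MeasurableEquiv.refl ℝ)
    (MeasurePreserving.id volume)).setIntegral_preimage_emb
    (MeasurableEquiv.measurableEmbedding _) g S

theorem setIntegral_cube {m : ℕ} {T : ℝ} {g : (Fin m → ℝ) → F}
    (hg : ∀ (σ : Equiv.Perm (Fin m)) s, g (s ∘ σ) = g s) (hint : IntegrableOn g (cube m T)) :
    ∫ s in cube m T, g s = (m.factorial : ℝ) • ∫ s in simplex m T, g s := by
  have hmeas : ∀ σ : Equiv.Perm (Fin m),
      MeasurableSet {s : Fin m → ℝ | s ∘ σ ∈ simplex m T} := fun σ =>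
    (measurableSet_simplex m T).preimage (measurable_pi_lambda _ fun i => measurable_pi_apply _)
  have hpiece : ∀ σ : Equiv.Perm (Fin m),
      ∫ s in {s : Fin m → ℝ | s ∘ σ ∈ simplex m T}, g s = ∫ s in simplex m T, g s := fun σ => by
    simpa only [hg] using setIntegral_comp_perm σ g (simplex m T)
  rw [setIntegral_congr_set (cube_ae_eq_iUnion_perm m T), integral_iUnion_fintype hmeas
    (pairwise_disjoint_comp_perm_mem_simplex m T)
    fun σ => hint.mono_set fun s => mem_cube_of_comp_perm_mem_simplex]
  simp only [hpiece, Finset.sum_const, Finset.card_univ, Fintype.card_perm, Fintype.card_fin,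
    Nat.cast_smul_eq_nsmul]

end NormedSpace

theorem volume_cube_lt_top (m : ℕ) (T : ℝ) : volume (cube m T) < ⊤ :=
  volume_cube m T ▸ ENNReal.pow_lt_top ENNReal.ofReal_lt_top

theorem volume_simplex_lt_top (m : ℕ) (T : ℝ) : volume (simplex m T) < ⊤ :=
  (measure_mono (simplex_subset_cube m T)).trans_lt (volume_cube_lt_top m T)

theorem volume_simplex (m : ℕ) {T : ℝ} (hT : 0 ≤ T) :
    volume.real (simplex m T) = T ^ m / m.factorial := by
  have hcube := setIntegral_cube (m := m) (T := T) (g := fun _ => (1 : ℝ)) (fun _ _ => rfl)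
    (integrableOn_const (volume_cube_lt_top m T).ne)
  simp only [setIntegral_const, smul_eq_mul, mul_one] at hcube
  rw [measureReal_def, volume_cube, ENNReal.toReal_pow, ENNReal.toReal_ofReal hT] at hcube
  rw [hcube]
  field_simp

end Simplex

/-! ### Functions that are constant on the cells of the grid -/

section GridCells

-- The monomials of `(∑ l, X l) ^ m` in the algebra of formal sums over `M`, expanded twice.
theorem sum_comp_sum_eq_sum_multinomial {ι M F : Type*} [Fintype ι] [DecidableEq ι]
    [AddCommMonoid M] [AddCommMonoid F] (m : ℕ) (x : ι → M) (G : M → F) :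
    ∑ c : Fin m → ι, G (∑ i, x (c i)) = ∑ k ∈ Finset.univ.piAntidiag m,
      Nat.multinomial Finset.univ k • G (∑ l, k l • x l) := by
  let X : ι → AddMonoidAlgebra ℕ M := fun l => AddMonoidAlgebra.single (x l) 1
  let eval : AddMonoidAlgebra ℕ M →+ F := (Finsupp.linearCombination ℕ G).toAddMonoidHom.comp
    AddMonoidAlgebra.coeffAddEquiv.toAddMonoidHom
  have heval : ∀ y, eval (AddMonoidAlgebra.single y 1) = G y := fun y => by simp [eval]
  have hpow := congrArg eval
    ((Fintype.sum_pow X m).symm.trans (Finset.sum_pow_eq_sum_piAntidiag Finset.univ X m))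
  simpa only [X, AddMonoidAlgebra.single_pow, AddMonoidAlgebra.prod_single, one_pow,
    Finset.prod_const_one, ← nsmul_eq_mul, map_sum, map_nsmul, heval] using hpow

/-- The volume of the set of ordered time points of which `k l` lie in the `l`-th of a family of
intervals of length `h`. -/
def cellWeight {ι : Type*} [Fintype ι] (h : ℝ) (k : ι → ℕ) : ℝ :=
  ∏ l, h ^ k l / ((k l).factorial : ℝ)

theorem pow_div_factorial_mul_multinomial {ι : Type*} [Fintype ι] (h : ℝ) {m : ℕ} {k : ι → ℕ}
    (hk : ∑ l, k l = m) :
    h ^ m / m.factorial * Nat.multinomial Finset.univ k = cellWeight h k := by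
  have hspec : ((∏ l, (k l).factorial : ℕ) : ℝ) * Nat.multinomial Finset.univ k = m.factorial := by
    rw [← hk]; exact_mod_cast Nat.multinomial_spec Finset.univ k
  have hprod : ((∏ l, (k l).factorial : ℕ) : ℝ) ≠ 0 := by
    exact_mod_cast (Finset.prod_pos fun l _ => Nat.factorial_pos _).ne'
  rw [cellWeight, Finset.prod_div_distrib, Finset.prod_pow_eq_pow_sum, hk, ← Nat.cast_prod,
    eq_div_iff hprod, div_mul_eq_mul_div, div_mul_eq_mul_div, div_eq_iff (by positivity), ← hspec]
  ring

/-- The cell of the grid of `(0, n * h) ^ m` with index `c`. -/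
def gridCell (h : ℝ) {m n : ℕ} (c : Fin m → Fin n) : Set (Fin m → ℝ) :=
  Set.univ.pi fun i => Set.Ico ((c i : ℕ) * h) (((c i : ℕ) + 1) * h)

variable {h : ℝ} {m n : ℕ}

theorem gridMid_of_mem_gridCell (hh : 0 < h) {c : Fin m → Fin n} {s : Fin m → ℝ}
    (hs : s ∈ gridCell h c) (i : Fin m) : gridMid h (s i) = midR h (c i) :=
  gridMid_eq hh (hs i (Set.mem_univ _)).1 (hs i (Set.mem_univ _)).2

theorem iUnion_gridCell (hh : 0 < h) (m n : ℕ) :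
    ⋃ c : Fin m → Fin n, gridCell h c = Set.univ.pi fun _ => Set.Ico (0 : ℝ) (n * h) := by
  ext s
  simp only [gridCell, Set.mem_iUnion, Set.mem_pi, Set.mem_univ, true_implies, Set.mem_Ico]
  constructor
  · rintro ⟨c, hc⟩ i
    have hci : ((c i : ℕ) : ℝ) + 1 ≤ n := by exact_mod_cast (c i).is_lt
    refine ⟨le_trans (by positivity) (hc i).1, (hc i).2.trans_le ?_⟩
    gcongr
  · intro hs
    have hfloor : ∀ i, ⌊s i / h⌋₊ < n := fun i =>
      (Nat.floor_lt (div_nonneg (hs i).1 hh.le)).2 ((div_lt_iff₀ hh).2 (hs i).2)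
    exact ⟨fun i => ⟨⌊s i / h⌋₊, hfloor i⟩, fun i =>
      ⟨floor_mul_le hh (hs i).1, lt_floor_add_one_mul hh _⟩⟩

theorem cube_ae_eq_iUnion_gridCell (hh : 0 < h) (m n : ℕ) :
    cube m (n * h) =ᵐ[volume] ⋃ c : Fin m → Fin n, gridCell h c := by
  rw [iUnion_gridCell hh]
  exact Measure.univ_pi_Ioo_ae_eq_Icc.trans Measure.univ_pi_Ico_ae_eq_Icc.symm

theorem measurableSet_gridCell (h : ℝ) (c : Fin m → Fin n) : MeasurableSet (gridCell h c) :=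
  MeasurableSet.univ_pi fun _ => measurableSet_Ico

theorem volume_gridCell (hh : 0 ≤ h) (c : Fin m → Fin n) :
    volume (gridCell h c) = ENNReal.ofReal (h ^ m) := by
  simp only [gridCell, Real.volume_pi_Ico, add_mul, one_mul, add_sub_cancel_left,
    Finset.prod_const, Finset.card_univ, Fintype.card_fin, ENNReal.ofReal_pow hh]

theorem disjoint_gridCell (hh : 0 < h) :
    Pairwise (Function.onFun Disjoint (gridCell (m := m) (n := n) h)) := by
  intro c c' hcc
  refine Set.disjoint_left.2 fun s hs hs' => hcc (funext fun i => ?_)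
  have hmid : midR h (c i) = midR h (c' i) :=
    (gridMid_of_mem_gridCell hh hs i).symm.trans (gridMid_of_mem_gridCell hh hs' i)
  exact Fin.ext (Nat.cast_injective (add_right_cancel (mul_right_cancel₀ hh.ne' hmid)))

variable {F : Type*} [NormedAddCommGroup F]

theorem integrableOn_gridCell_comp_gridMid (hh : 0 < h) (c : Fin m → Fin n)
    (g : (Fin m → ℝ) → F) :
    IntegrableOn (fun s : Fin m → ℝ => g fun i => gridMid h (s i)) (gridCell h c) := by
  refine IntegrableOn.congr_fun (f := fun _ => g fun i => midR h (c i))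
    (integrableOn_const (by rw [volume_gridCell hh.le]; exact ENNReal.ofReal_ne_top))
    (fun s hs => ?_) (measurableSet_gridCell h c)
  simp only [gridMid_of_mem_gridCell hh hs]

theorem integrableOn_cube_comp_gridMid (hh : 0 < h) (m n : ℕ) (g : (Fin m → ℝ) → F) :
    IntegrableOn (fun s : Fin m → ℝ => g fun i => gridMid h (s i)) (cube m (n * h)) := by
  rw [integrableOn_congr_set_ae (cube_ae_eq_iUnion_gridCell hh m n), integrableOn_finite_iUnion]
  exact fun c => integrableOn_gridCell_comp_gridMid hh c g

variable [NormedSpace ℝ F] [CompleteSpace F]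

theorem setIntegral_cube_comp_gridMid (hh : 0 < h) (m n : ℕ) (g : (Fin m → ℝ) → F) :
    ∫ s in cube m (n * h), g (fun i => gridMid h (s i)) =
      h ^ m • ∑ c : Fin m → Fin n, g fun i => midR h (c i) := by
  rw [setIntegral_congr_set (cube_ae_eq_iUnion_gridCell hh m n),
    integral_iUnion_fintype (measurableSet_gridCell h) (disjoint_gridCell hh)
      (integrableOn_gridCell_comp_gridMid hh · g), Finset.smul_sum]
  refine Finset.sum_congr rfl fun c _ => ?_
  have hconst : ∀ s ∈ gridCell h c, g (fun i => gridMid h (s i)) = g fun i => midR h (c i) :=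
    fun s hs => by simp only [gridMid_of_mem_gridCell hh hs]
  rw [setIntegral_congr_fun (measurableSet_gridCell h c) hconst, setIntegral_const,
    measureReal_def, volume_gridCell hh.le, ENNReal.toReal_ofReal (by positivity)]

theorem setIntegral_simplex_gridMid (hh : 0 < h) (m n : ℕ) (G : Multiset ℝ → F) :
    ∫ s in simplex m (n * h), G (∑ i, {gridMid h (s i)}) =
      ∑ k ∈ (Finset.univ : Finset (Fin n)).piAntidiag m,
        cellWeight h k • G (∑ i, k i • {midR h i}) := by
  have hsymm := setIntegral_cube (g := fun s : Fin m → ℝ => G (∑ i, {gridMid h (s i)}))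
    (fun σ s => congrArg G (Equiv.sum_comp σ fun i => ({gridMid h (s i)} : Multiset ℝ)))
    (integrableOn_cube_comp_gridMid hh m n fun x => G (∑ i, {x i}))
  rw [setIntegral_cube_comp_gridMid hh m n fun x => G (∑ i, {x i}),
    ← inv_smul_eq_iff₀ (by positivity), sum_comp_sum_eq_sum_multinomial m
      (fun l : Fin n => ({midR h l} : Multiset ℝ)) G, Finset.smul_sum, Finset.smul_sum] at hsymm
  rw [← hsymm]
  refine Finset.sum_congr rfl fun k hk => ?_
  rw [← pow_div_factorial_mul_multinomial h (Finset.mem_piAntidiag.1 hk).1, smul_smul,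
    ← Nat.cast_smul_eq_nsmul ℝ, smul_smul, div_eq_inv_mul]

end GridCells

/-! ### The midpoint rule on time-ordered simplices -/

section SimplexMidpoint

variable {F : Type*} [NormedAddCommGroup F]

/-- The open positive orthant: the bath correlation function is smooth away from the hyperplanes
where a time vanishes. -/
def orthant (m : ℕ) : Set (Fin m → ℝ) := {s | ∀ i, 0 < s i}

theorem measurableSet_orthant (m : ℕ) : MeasurableSet (orthant m) := by
  have hpi : orthant m = Set.univ.pi fun _ => Set.Ioi 0 := by ext s; simp [orthant]
  rw [hpi]
  exact MeasurableSet.univ_pi fun _ => measurableSet_Ioi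

theorem simplex_subset_orthant (m : ℕ) (T : ℝ) : simplex m T ⊆ orthant m :=
  fun _ hs i => (hs.2 i).1

/-- Only the first `i` coordinates of `s` are moved to the midpoints of the grid, so that increasing
`i` replaces one coordinate at a time. -/
def partialGrid (h : ℝ) {m : ℕ} (i : ℕ) (s : Fin m → ℝ) : Fin m → ℝ :=
  fun j => if (j : ℕ) < i then gridMid h (s j) else s j

theorem partialGrid_mem_orthant {h : ℝ} (hh : 0 < h) {m : ℕ} (i : ℕ) {s : Fin m → ℝ}
    (hs : s ∈ orthant m) : partialGrid h i s ∈ orthant m := by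
  intro j
  unfold partialGrid
  split_ifs
  · exact gridMid_pos hh _
  · exact hs j

theorem measurable_partialGrid (h : ℝ) {m : ℕ} (i : ℕ) :
    Measurable (partialGrid h i : (Fin m → ℝ) → Fin m → ℝ) := by
  refine measurable_pi_lambda _ fun j => ?_
  unfold partialGrid
  split_ifs
  · exact (measurable_gridMid h).comp (measurable_pi_apply j)
  · exact measurable_pi_apply j

theorem partialGrid_zero (h : ℝ) {m : ℕ} (s : Fin m → ℝ) : partialGrid h 0 s = s := by
  funext i; simp [partialGrid]

theorem partialGrid_self (h : ℝ) {m : ℕ} (s : Fin m → ℝ) :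
    partialGrid h m s = fun i => gridMid h (s i) := by
  funext i; simp [partialGrid]

theorem partialGrid_insertNth (h : ℝ) {m : ℕ} (i : Fin (m + 1)) (x : ℝ) (s : Fin m → ℝ) :
    partialGrid h i (i.insertNth x s : Fin (m + 1) → ℝ) = i.insertNth x (partialGrid h i s) := by
  funext j
  rcases Fin.eq_self_or_eq_succAbove i j with rfl | ⟨j, rfl⟩
  · simp [partialGrid]
  · have hj : ((i.succAbove j : Fin (m + 1)) : ℕ) < i ↔ (j : ℕ) < i := by
      grind [Fin.succAbove]
    simp only [partialGrid, Fin.insertNth_apply_succAbove, hj]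

theorem partialGrid_succ_insertNth (h : ℝ) {m : ℕ} (i : Fin (m + 1)) (x : ℝ) (s : Fin m → ℝ) :
    partialGrid h (i + 1) (i.insertNth x s : Fin (m + 1) → ℝ) =
      i.insertNth (gridMid h x) (partialGrid h i s) := by
  funext j
  rcases Fin.eq_self_or_eq_succAbove i j with rfl | ⟨j, rfl⟩
  · simp [partialGrid]
  · have hj : ((i.succAbove j : Fin (m + 1)) : ℕ) < i + 1 ↔ (j : ℕ) < i := by
      grind [Fin.succAbove]
    simp only [partialGrid, Fin.insertNth_apply_succAbove, hj]

theorem integrableOn_simplex_comp {m : ℕ} {T K : ℝ} {f : (Fin m → ℝ) → F}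
    (hf : ContinuousOn f (orthant m)) (hK : ∀ s ∈ orthant m, ‖f s‖ ≤ K)
    {g : (Fin m → ℝ) → Fin m → ℝ} (hg : Measurable g)
    (hgo : Set.MapsTo g (orthant m) (orthant m)) :
    IntegrableOn (fun s => f (g s)) (simplex m T) := by
  refine IntegrableOn.of_bound (volume_simplex_lt_top m T)
    (aestronglyMeasurable_comp_of_continuousOn hf (measurableSet_orthant m) hg
      (measurableSet_simplex m T) (hgo.mono_left (simplex_subset_orthant m T))) K ?_
  filter_upwards [ae_restrict_mem (measurableSet_simplex m T)] with s hs
  exact hK _ (hgo (simplex_subset_orthant m T hs))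

theorem ordConnected_insertNth_mem_simplex {m : ℕ} (i : Fin (m + 1)) (s : Fin m → ℝ) (T : ℝ) :
    {x | i.insertNth x s ∈ simplex (m + 1) T}.OrdConnected := by
  refine ⟨fun x hx y hy z hz => ?_⟩
  have hmono : Monotone fun a => (i.insertNth a s : Fin (m + 1) → ℝ) := fun a b hab =>
    Fin.insertNth_le_iff.2 (by simpa using hab)
  have hother : ∀ a b j, j ≠ i →
      (i.insertNth a s : Fin (m + 1) → ℝ) j = (i.insertNth b s : Fin (m + 1) → ℝ) j := by
    intro a b j hj
    obtain ⟨j, rfl⟩ := Fin.exists_succAbove_eq hj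
    simp
  refine ⟨fun j k hjk => ?_, fun j =>
    ⟨(hx.2 j).1.trans_le (hmono hz.1 j), (hmono hz.2 j).trans_lt (hy.2 j).2⟩⟩
  by_cases hj : j = i
  · exact ((hmono hz.2 j).trans_lt (hy.1 hjk)).trans_eq (hother _ _ k (hj ▸ hjk.ne'))
  · exact (hother _ _ j hj).trans_lt ((hx.1 hjk).trans_le (hmono hz.1 k))

theorem mem_simplex_of_insertNth {m : ℕ} {i : Fin (m + 1)} {s : Fin m → ℝ} {T x : ℝ}
    (h : i.insertNth x s ∈ simplex (m + 1) T) : s ∈ simplex m T ∧ x ∈ Set.Ioo 0 T := by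
  refine ⟨⟨fun j k hjk => ?_, fun j => ?_⟩, ?_⟩
  · have := h.1 (Fin.succAbove_lt_succAbove_iff (p := i) |>.2 hjk)
    rwa [Fin.insertNth_apply_succAbove, Fin.insertNth_apply_succAbove] at this
  · have := h.2 (i.succAbove j)
    rwa [Fin.insertNth_apply_succAbove] at this
  · have := h.2 i
    rwa [Fin.insertNth_apply_same] at this

theorem insertNth_mem_orthant {m : ℕ} (i : Fin (m + 1)) {x : ℝ} (hx : 0 < x) {s : Fin m → ℝ}
    (hs : s ∈ orthant m) : i.insertNth x s ∈ orthant (m + 1) := by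
  intro j
  rcases Fin.eq_self_or_eq_succAbove i j with rfl | ⟨j, rfl⟩
  · rwa [Fin.insertNth_apply_same]
  · rw [Fin.insertNth_apply_succAbove]; exact hs j

variable [NormedSpace ℝ F]

theorem setIntegral_eq_integral_setIntegral_insertNth {m : ℕ} (i : Fin (m + 1))
    {S : Set (Fin (m + 1) → ℝ)} (hS : MeasurableSet S) {u : (Fin (m + 1) → ℝ) → F}
    (hu : IntegrableOn u S) :
    ∫ s in S, u s = ∫ s : Fin m → ℝ, ∫ x in {x | i.insertNth x s ∈ S}, u (i.insertNth x s) := by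
  let e := MeasurableEquiv.piFinSuccAbove (fun _ : Fin (m + 1) => ℝ) i
  have he : MeasurePreserving e.symm volume volume :=
    (volume_preserving_piFinSuccAbove (fun _ : Fin (m + 1) => ℝ) i).symm e
  have hint : Integrable (fun p : ℝ × (Fin m → ℝ) => S.indicator u (e.symm p))
      (volume.prod volume) :=
    (he.integrable_comp_emb e.symm.measurableEmbedding).2 ((integrable_indicator_iff hS).2 hu)
  rw [← integral_indicator hS, ← he.integral_comp e.symm.measurableEmbedding]
  refine (integral_prod_symm _ hint).trans (integral_congr_ae (Filter.Eventually.of_forall ?_))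
  intro s
  have hslice : MeasurableSet {x | i.insertNth x s ∈ S} :=
    hS.preimage (e.symm.measurable.comp measurable_prodMk_right)
  exact integral_indicator hslice

variable [CompleteSpace F]

theorem norm_setIntegral_slice_le {m : ℕ} {T K L h : ℝ} (hh : 0 < h) (hT : 0 ≤ T)
    {f : (Fin (m + 1) → ℝ) → F} {i : Fin (m + 1)}
    (hC : ∀ s ∈ orthant (m + 1), C2Bound (fun x => f (Function.update s i x)) K L)
    {s : Fin m → ℝ} (hs : s ∈ orthant m) :
    ‖∫ x in {x | i.insertNth x s ∈ simplex (m + 1) T},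
        (f (partialGrid h i (i.insertNth x s : Fin (m + 1) → ℝ)) -
          f (partialGrid h (i + 1) (i.insertNth x s : Fin (m + 1) → ℝ)))‖ ≤
      2 * (K * L ^ 2 * T + K * L) * h ^ 2 := by
  have hslice : C2Bound (fun x => f (i.insertNth x (partialGrid h i s))) K L := by
    simpa only [Fin.update_insertNth] using
      hC _ (insertNth_mem_orthant i one_pos (partialGrid_mem_orthant hh i hs))
  simp only [partialGrid_insertNth, partialGrid_succ_insertNth]
  exact hslice.norm_setIntegral_le hh hT (ordConnected_insertNth_mem_simplex i s T)
    fun x hx => Set.Ioo_subset_Icc_self (mem_simplex_of_insertNth hx).2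

theorem norm_setIntegral_coordinate_le {m : ℕ} {T K L M h : ℝ} (hh : 0 < h) (hT : 0 ≤ T)
    {f : (Fin (m + 1) → ℝ) → F} (hf : ContinuousOn f (orthant (m + 1)))
    (hM : ∀ s ∈ orthant (m + 1), ‖f s‖ ≤ M) {i : Fin (m + 1)}
    (hC : ∀ s ∈ orthant (m + 1), C2Bound (fun x => f (Function.update s i x)) K L) :
    ‖∫ s in simplex (m + 1) T, (f (partialGrid h i s) - f (partialGrid h (i + 1) s))‖ ≤
      2 * (K * L ^ 2 * T + K * L) * h ^ 2 * (T ^ m / m.factorial) := by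
  have hint : ∀ k, IntegrableOn (fun s => f (partialGrid h k s)) (simplex (m + 1) T) := fun k =>
    integrableOn_simplex_comp hf hM (measurable_partialGrid h k)
      fun s hs => partialGrid_mem_orthant hh k hs
  rw [setIntegral_eq_integral_setIntegral_insertNth i (measurableSet_simplex _ _)
    ((hint i).fun_sub (hint (i + 1)))]
  set κ := 2 * (K * L ^ 2 * T + K * L) * h ^ 2
  refine (norm_integral_le_of_norm_le (g := (simplex m T).indicator fun _ => κ) ?_
    (Filter.Eventually.of_forall fun s => ?_)).trans_eq ?_
  · rw [integrable_indicator_iff (measurableSet_simplex m T), integrableOn_const_iff]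
    exact Or.inr (volume_simplex_lt_top m T)
  · by_cases hs : s ∈ simplex m T
    · rw [Set.indicator_of_mem hs]
      exact norm_setIntegral_slice_le hh hT hC (simplex_subset_orthant m T hs)
    · have hempty : {x | i.insertNth x s ∈ simplex (m + 1) T} = ∅ :=
        Set.eq_empty_of_forall_notMem fun x hx => hs (mem_simplex_of_insertNth hx).1
      simp [hs, hempty]
  · rw [integral_indicator (measurableSet_simplex m T), setIntegral_const, volume_simplex m hT,
      smul_eq_mul, mul_comm]

/-- Bound for the error made by moving all `m` times in a simplex of size `T` to the midpoints of a
grid of step `h`; the truncated subtraction is harmless since the bound vanishes for `m = 0`. -/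
def midpointError (m : ℕ) (T K L h : ℝ) : ℝ :=
  m * (2 * (K * L ^ 2 * T + K * L) * h ^ 2 * (T ^ (m - 1) / (m - 1).factorial))

theorem norm_setIntegral_simplex_sub_le {m : ℕ} {T K L M h : ℝ} (hh : 0 < h) (hT : 0 ≤ T)
    {f : (Fin m → ℝ) → F} (hf : ContinuousOn f (orthant m)) (hM : ∀ s ∈ orthant m, ‖f s‖ ≤ M)
    (hC : ∀ i, ∀ s ∈ orthant m, C2Bound (fun x => f (Function.update s i x)) K L) :
    ‖(∫ s in simplex m T, f s) - ∫ s in simplex m T, f (fun i => gridMid h (s i))‖ ≤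
      midpointError m T K L h := by
  have hint : ∀ i, IntegrableOn (fun s => f (partialGrid h i s)) (simplex m T) := fun i =>
    integrableOn_simplex_comp hf hM (measurable_partialGrid h i)
      fun s hs => partialGrid_mem_orthant hh i hs
  have htelescope := Finset.sum_range_sub' (fun i => ∫ s in simplex m T, f (partialGrid h i s)) m
  simp only [partialGrid_zero, partialGrid_self] at htelescope
  rw [← htelescope]
  refine (norm_sum_le_of_le _ (fun i hi => ?_ : ∀ i ∈ Finset.range m, _ ≤
    2 * (K * L ^ 2 * T + K * L) * h ^ 2 * (T ^ (m - 1) / (m - 1).factorial))).trans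
    (le_of_eq (by simp [midpointError]))
  rw [← integral_sub (hint i) (hint (i + 1))]
  rw [Finset.mem_range] at hi
  obtain ⟨m, rfl⟩ := Nat.exists_eq_add_of_le' (Nat.one_le_of_lt hi)
  exact norm_setIntegral_coordinate_le hh hT hf hM (hC ⟨i, hi⟩)

end SimplexMidpoint

/-! ### Products of functions with bounded derivatives -/

section C2

variable {V : Type*} [NormedAddCommGroup V] [NormedSpace ℝ V]

theorem C2Bound.const {c : V} {K L : ℝ} (hc : ‖c‖ ≤ K) (hL : 0 ≤ L) :
    C2Bound (fun _ => c) K L := by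
  have hK : 0 ≤ K := (norm_nonneg c).trans hc
  exact ⟨fun _ => 0, fun _ => 0, fun x _ => ⟨hasDerivAt_const _ _, hasDerivAt_const _ _, hc,
    by rw [norm_zero]; positivity, by rw [norm_zero]; positivity⟩⟩

theorem C2Bound.congr {φ ψ : ℝ → V} {K L K' L' : ℝ} (h : C2Bound φ K L) (hφ : ∀ x, φ x = ψ x)
    (hK : K = K') (hL : L = L') : C2Bound ψ K' L' := by
  rw [← hK, ← hL, ← funext hφ]
  exact h

theorem C2Bound.nonneg {φ : ℝ → V} {K L : ℝ} (hφ : C2Bound φ K L) : 0 ≤ K := by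
  obtain ⟨φ', φ'', h⟩ := hφ
  exact (norm_nonneg _).trans (h 1 one_pos).2.2.1

theorem C2Bound.mono {φ : ℝ → V} {K L K' L' : ℝ} (hφ : C2Bound φ K L) (hK : K ≤ K')
    (hL0 : 0 ≤ L) (hL : L ≤ L') : C2Bound φ K' L' := by
  have hK0 := hφ.nonneg
  obtain ⟨φ', φ'', h⟩ := hφ
  refine ⟨φ', φ'', fun x hx => ⟨(h x hx).1, (h x hx).2.1, (h x hx).2.2.1.trans hK,
    (h x hx).2.2.2.1.trans ?_, (h x hx).2.2.2.2.trans ?_⟩⟩ <;> gcongr <;> linarith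

theorem leibniz_bound {K₁ L₁ K₂ L₂ a₀ a₁ a₂ c₀ c₁ c₂ : ℝ} (ha₀ : 0 ≤ a₀) (ha₁ : 0 ≤ a₁)
    (ha₂ : 0 ≤ a₂) (hc₀ : 0 ≤ c₀) (hc₁ : 0 ≤ c₁) (hc₂ : 0 ≤ c₂) (h₀ : a₀ ≤ K₁) (h₁ : a₁ ≤ K₁ * L₁)
    (h₂ : a₂ ≤ K₁ * L₁ ^ 2) (k₀ : c₀ ≤ K₂) (k₁ : c₁ ≤ K₂ * L₂) (k₂ : c₂ ≤ K₂ * L₂ ^ 2) :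
    a₀ * c₀ ≤ K₁ * K₂ ∧ a₀ * c₁ + a₁ * c₀ ≤ K₁ * K₂ * (L₁ + L₂) ∧
      a₀ * c₂ + a₁ * c₁ + (a₁ * c₁ + a₂ * c₀) ≤ K₁ * K₂ * (L₁ + L₂) ^ 2 := by
  have h₀₀ := mul_le_mul h₀ k₀ hc₀ (ha₀.trans h₀)
  have h₁₀ := mul_le_mul h₁ k₀ hc₀ (ha₁.trans h₁)
  have h₀₁ := mul_le_mul h₀ k₁ hc₁ (ha₀.trans h₀)
  have h₂₀ := mul_le_mul h₂ k₀ hc₀ (ha₂.trans h₂)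
  have h₁₁ := mul_le_mul h₁ k₁ hc₁ (ha₁.trans h₁)
  have h₀₂ := mul_le_mul h₀ k₂ hc₂ (ha₀.trans h₀)
  refine ⟨h₀₀, ?_, ?_⟩ <;> linarith

theorem C2Bound.bilinear {V₁ V₂ : Type*} [NormedAddCommGroup V₁] [NormedSpace ℝ V₁]
    [NormedAddCommGroup V₂] [NormedSpace ℝ V₂] (β : V₁ →L[ℝ] V₂ →L[ℝ] V) (hβ : ‖β‖ ≤ 1)
    {φ : ℝ → V₁} {ψ : ℝ → V₂} {K₁ L₁ K₂ L₂ : ℝ} (hφ : C2Bound φ K₁ L₁) (hψ : C2Bound ψ K₂ L₂) :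
    C2Bound (fun x => β (φ x) (ψ x)) (K₁ * K₂) (L₁ + L₂) := by
  have hle : ∀ v w, ‖β v w‖ ≤ ‖v‖ * ‖w‖ := fun v w => by
    simpa using β.le_of_opNorm₂_le_of_le hβ le_rfl le_rfl
  obtain ⟨φ', φ'', hφ⟩ := hφ
  obtain ⟨ψ', ψ'', hψ⟩ := hψ
  refine ⟨fun x => β (φ x) (ψ' x) + β (φ' x) (ψ x),
    fun x => β (φ x) (ψ'' x) + β (φ' x) (ψ' x) + (β (φ' x) (ψ' x) + β (φ'' x) (ψ x)),
    fun x hx => ?_⟩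
  obtain ⟨hφ₁, hφ₂, hφK, hφL, hφLL⟩ := hφ x hx
  obtain ⟨hψ₁, hψ₂, hψK, hψL, hψLL⟩ := hψ x hx
  have hderiv {u u' : ℝ → V₁} {v v' : ℝ → V₂} (hu : HasDerivAt u (u' x) x)
      (hv : HasDerivAt v (v' x) x) := β.hasDerivAt_of_bilinear (fun _ => hu) fun _ => hv
  obtain ⟨hK, hL, hLL⟩ := leibniz_bound (norm_nonneg _) (norm_nonneg _) (norm_nonneg _)
    (norm_nonneg _) (norm_nonneg _) (norm_nonneg _) hφK hφL hφLL hψK hψL hψLL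
  exact ⟨hderiv hφ₁ hψ₁, (hderiv hφ₁ hψ₂).add (hderiv hφ₂ hψ₁), (hle _ _).trans hK,
    (norm_add_le_of_le (hle _ _) (hle _ _)).trans hL,
    (norm_add_le_of_le (norm_add_le_of_le (hle _ _) (hle _ _))
      (norm_add_le_of_le (hle _ _) (hle _ _))).trans hLL⟩

theorem C2Bound.mul {A : Type*} [NormedRing A] [NormedAlgebra ℝ A] {φ ψ : ℝ → A}
    {K₁ L₁ K₂ L₂ : ℝ} (hφ : C2Bound φ K₁ L₁) (hψ : C2Bound ψ K₂ L₂) :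
    C2Bound (fun x => φ x * ψ x) (K₁ * K₂) (L₁ + L₂) :=
  C2Bound.bilinear (ContinuousLinearMap.mul ℝ A) (ContinuousLinearMap.opNorm_mul_le ℝ A) hφ hψ

theorem C2Bound.smul [NormedSpace ℂ V] [IsScalarTower ℝ ℂ V] {φ : ℝ → ℂ} {ψ : ℝ → V}
    {K₁ L₁ K₂ L₂ : ℝ} (hφ : C2Bound φ K₁ L₁) (hψ : C2Bound ψ K₂ L₂) :
    C2Bound (fun x => φ x • ψ x) (K₁ * K₂) (L₁ + L₂) :=
  C2Bound.bilinear (ContinuousLinearMap.lsmul ℝ ℂ) ContinuousLinearMap.opNorm_lsmul_le hφ hψ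

theorem C2Bound.add {φ ψ : ℝ → V} {K₁ K₂ L : ℝ} (hφ : C2Bound φ K₁ L) (hψ : C2Bound ψ K₂ L) :
    C2Bound (fun x => φ x + ψ x) (K₁ + K₂) L := by
  obtain ⟨φ', φ'', hφ⟩ := hφ
  obtain ⟨ψ', ψ'', hψ⟩ := hψ
  refine ⟨fun x => φ' x + ψ' x, fun x => φ'' x + ψ'' x, fun x hx => ?_⟩
  obtain ⟨hφ₁, hφ₂, hφK, hφL, hφLL⟩ := hφ x hx
  obtain ⟨hψ₁, hψ₂, hψK, hψL, hψLL⟩ := hψ x hx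
  rw [add_mul, add_mul]
  exact ⟨hφ₁.add hψ₁, hφ₂.add hψ₂, norm_add_le_of_le hφK hψK, norm_add_le_of_le hφL hψL,
    norm_add_le_of_le hφLL hψLL⟩

theorem C2Bound.finset_sum {ι : Type*} (s : Finset ι) {φ : ι → ℝ → V} {K L : ℝ} (hL : 0 ≤ L)
    (h : ∀ i ∈ s, C2Bound (φ i) K L) : C2Bound (fun x => ∑ i ∈ s, φ i x) (s.card * K) L := by
  classical
  induction s using Finset.induction_on with
  | empty => simpa using C2Bound.const (c := (0 : V)) (K := 0) (by simp) hL
  | insert i s hi ih =>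
    simp only [Finset.sum_insert hi, Finset.card_insert_of_notMem hi]
    exact ((h i (Finset.mem_insert_self i s)).add
      (ih fun j hj => h j (Finset.mem_insert_of_mem hj))).congr (fun _ => rfl)
      (by push_cast; ring) rfl

theorem C2Bound.list_prod {A : Type*} [NormedRing A] [NormedAlgebra ℝ A] {ι : Type*} (l : List ι)
    {φ : ι → ℝ → A} {K L : ℝ} (hone : ‖(1 : A)‖ ≤ 1) (h : ∀ i ∈ l, C2Bound (φ i) K L) :
    C2Bound (fun x => (l.map fun i => φ i x).prod) (K ^ l.length) (l.length * L) := by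
  induction l with
  | nil => simpa using C2Bound.const (c := (1 : A)) (K := 1) (L := 0) hone le_rfl
  | cons i l ih =>
    simp only [List.map_cons, List.prod_cons, List.length_cons]
    exact ((h i List.mem_cons_self).mul (ih fun j hj => h j (List.mem_cons_of_mem i hj))).congr
      (fun _ => rfl) (by ring) (by push_cast; ring)

theorem C2Bound.finset_prod {A : Type*} [NormedCommRing A] [NormedAlgebra ℝ A] {ι : Type*}
    (s : Finset ι) {φ : ι → ℝ → A} {K L : ℝ} (hone : ‖(1 : A)‖ ≤ 1)
    (h : ∀ i ∈ s, C2Bound (φ i) K L) :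
    C2Bound (fun x => ∏ i ∈ s, φ i x) (K ^ s.card) (s.card * L) := by
  simpa using C2Bound.list_prod s.toList hone fun i hi => h i (Finset.mem_toList.1 hi)

end C2

/-! ### Regularity of the Dyson integrand -/

section Regularity

variable {E : Type*} [NormedAddCommGroup E] [InnerProductSpace ℂ E] [CompleteSpace E]

theorem hasDerivAt_prop (H : E →L[ℂ] E) (t : ℝ) :
    HasDerivAt (prop H) (prop H t * (-Complex.I • H)) t := by
  have hprop : ∀ t : ℝ, prop H t = NormedSpace.exp (t • (-Complex.I • H)) := fun t => by
    rw [prop, mul_comm, mul_smul, Complex.coe_smul]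
  rw [hprop, funext hprop]
  exact hasDerivAt_exp_smul_const (𝕂 := ℝ) (-Complex.I • H) t

theorem c2Bound_prop {H : E →L[ℂ] E} (hH : IsSelfAdjoint H) : C2Bound (prop H) 1 ‖H‖ := by
  set X : E →L[ℂ] E := -Complex.I • H with hX
  have hnorm : ‖X‖ = ‖H‖ := by simp [hX, norm_smul]
  refine ⟨fun t => prop H t * X, fun t => prop H t * X * X, fun t _ =>
    ⟨hasDerivAt_prop H t, (hasDerivAt_prop H t).mul_const X, norm_prop_le hH t, ?_, ?_⟩⟩
  · rw [← hnorm]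
    exact norm_mul_le_of_le (norm_prop_le hH t) le_rfl
  · rw [← hnorm, pow_two, ← mul_assoc]
    exact norm_mul_le_of_le (norm_mul_le_of_le (norm_prop_le hH t) le_rfl) le_rfl

theorem c2Bound_prop_neg {H : E →L[ℂ] E} (hH : IsSelfAdjoint H) :
    C2Bound (fun t => prop H (-t)) 1 ‖H‖ :=
  (c2Bound_prop hH.neg).congr (fun t => by simp [prop]) rfl (norm_neg H)

theorem c2Bound_coupling {H : E →L[ℂ] E} (hH : IsSelfAdjoint H) (W : E →L[ℂ] E) :
    C2Bound (coupling H W) ‖W‖ (2 * ‖H‖) :=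
  (((c2Bound_prop_neg hH).mul (C2Bound.const (c := W) le_rfl le_rfl)).mul (c2Bound_prop hH)).congr
    (fun _ => rfl) (by ring) (by ring)

theorem sandwich_ofFn (H W ρ₀ : E →L[ℂ] E) (t t' : ℝ) {m m' : ℕ} (s : Fin m → ℝ)
    (s' : Fin m' → ℝ) :
    sandwich H W ρ₀ t t' (List.ofFn s) (List.ofFn s') =
      prop H t * ((List.finRange m).reverse.map fun i => coupling H W (s i)).prod * ρ₀ *
        ((List.finRange m').map fun i => coupling H W (s' i)).prod * prop H (-t') := by
  rw [sandwich, List.map_ofFn, List.map_ofFn, List.ofFn_eq_map, List.ofFn_eq_map,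
    ← List.map_reverse]
  rfl

theorem c2Bound_sandwich {H : E →L[ℂ] E} (hH : IsSelfAdjoint H) (W ρ₀ : E →L[ℂ] E) (t t' : ℝ)
    {m m' : ℕ} {s : ℝ → Fin m → ℝ} {s' : ℝ → Fin m' → ℝ}
    (hs : ∀ i, C2Bound (fun x => coupling H W (s x i)) ‖W‖ (2 * ‖H‖))
    (hs' : ∀ i, C2Bound (fun x => coupling H W (s' x i)) ‖W‖ (2 * ‖H‖)) :
    C2Bound (fun x => sandwich H W ρ₀ t t' (List.ofFn (s x)) (List.ofFn (s' x)))
      (‖ρ₀‖ * ‖W‖ ^ (m + m')) ((m + m' : ℕ) * (2 * ‖H‖)) := by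
  have hleft := C2Bound.list_prod (List.finRange m).reverse
    (φ := fun i x => coupling H W (s x i)) ContinuousLinearMap.norm_id_le fun i _ => hs i
  have hright := C2Bound.list_prod (List.finRange m')
    (φ := fun i x => coupling H W (s' x i)) ContinuousLinearMap.norm_id_le fun i _ => hs' i
  rw [List.length_reverse, List.length_finRange] at hleft
  rw [List.length_finRange] at hright
  refine (((((C2Bound.const (norm_prop_le hH t) le_rfl).mul hleft).mul
    (C2Bound.const (c := ρ₀) le_rfl le_rfl)).mul hright).mul
    (C2Bound.const (norm_prop_le hH (-t')) le_rfl)).congr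
    (fun x => (sandwich_ofFn H W ρ₀ t t' (s x) (s' x)).symm) ?_ ?_
  · rw [pow_add]; ring
  · push_cast; ring

theorem continuous_prop (H : E →L[ℂ] E) : Continuous (prop H) :=
  continuous_iff_continuousAt.2 fun t => (hasDerivAt_prop H t).continuousAt

theorem continuous_coupling (H W : E →L[ℂ] E) : Continuous (coupling H W) :=
  (((continuous_prop H).comp continuous_neg).mul continuous_const).mul (continuous_prop H)

theorem continuous_sandwich (H W ρ₀ : E →L[ℂ] E) (t t' : ℝ) (m m' : ℕ) :
    Continuous fun p : (Fin m → ℝ) × (Fin m' → ℝ) =>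
      sandwich H W ρ₀ t t' (List.ofFn p.1) (List.ofFn p.2) := by
  simp only [sandwich_ofFn]
  have hcoupling := continuous_coupling H W
  have hleft : Continuous fun p : (Fin m → ℝ) × (Fin m' → ℝ) =>
      ((List.finRange m).reverse.map fun i => coupling H W (p.1 i)).prod :=
    continuous_list_prod _ fun i _ => by fun_prop
  have hright : Continuous fun p : (Fin m → ℝ) × (Fin m' → ℝ) =>
      ((List.finRange m').map fun i => coupling H W (p.2 i)).prod :=
    continuous_list_prod _ fun i _ => by fun_prop
  exact (((continuous_const.mul hleft).mul continuous_const).mul hright).mul continuous_const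

end Regularity

section Bath

/-- Bounds on `B` and on its derivatives in one time variable at a time, without the mixed ones:
this is all that a midpoint rule applied to the times one after the other sees of `B`. -/
structure PureBathBounds (B : ℝ → ℝ → ℂ) (b b' b'' : ℝ) : Prop where
  bound : ∀ τ₁ τ₂, ‖B τ₁ τ₂‖ ≤ b
  partials : ∀ τ₁ τ₂, τ₁ ≠ 0 → τ₂ ≠ 0 → HasPartials B τ₁ τ₂
  bound_partials : ∀ τ₁ τ₂, τ₁ ≠ 0 → τ₂ ≠ 0 → ‖pd₁ B τ₁ τ₂‖ + ‖pd₂ B τ₁ τ₂‖ ≤ b'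
  partial₁₁ : ∀ τ₁ τ₂, τ₁ ≠ 0 → τ₂ ≠ 0 → DifferentiableAt ℝ (fun s => pd₁ B s τ₂) τ₁
  partial₂₂ : ∀ τ₁ τ₂, τ₁ ≠ 0 → τ₂ ≠ 0 → DifferentiableAt ℝ (fun s => pd₂ B τ₁ s) τ₂
  bound₁₁ : ∀ τ₁ τ₂, τ₁ ≠ 0 → τ₂ ≠ 0 → ‖pd₁ (pd₁ B) τ₁ τ₂‖ ≤ b''
  bound₂₂ : ∀ τ₁ τ₂, τ₁ ≠ 0 → τ₂ ≠ 0 → ‖pd₂ (pd₂ B) τ₁ τ₂‖ ≤ b''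

variable {B : ℝ → ℝ → ℂ} {b b' b'' : ℝ}

theorem BathBounds.pure (hB : BathBounds B b b' b'') : PureBathBounds B b b' b'' where
  bound := hB.bound
  partials := hB.partials
  bound_partials := hB.bound_partials
  partial₁₁ x y hx hy := (hB.partials₁ x y hx hy).1
  partial₂₂ x y hx hy := (hB.partials₂ x y hx hy).2
  bound₁₁ := hB.bound₁₁
  bound₂₂ := hB.bound₂₂

namespace PureBathBounds

theorem nonneg (hB : PureBathBounds B b b' b'') : 0 ≤ b ∧ 0 ≤ b' ∧ 0 ≤ b'' :=
  ⟨(norm_nonneg _).trans (hB.bound 0 0),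
    (add_nonneg (norm_nonneg _) (norm_nonneg _)).trans
      (hB.bound_partials 1 1 one_ne_zero one_ne_zero),
    (norm_nonneg _).trans (hB.bound₁₁ 1 1 one_ne_zero one_ne_zero)⟩

theorem flip (hB : PureBathBounds B b b' b'') : PureBathBounds (fun x y => B y x) b b' b'' where
  bound x y := hB.bound y x
  partials x y hx hy := (hB.partials y x hy hx).symm
  bound_partials x y hx hy := by rw [add_comm]; exact hB.bound_partials y x hy hx
  partial₁₁ x y hx hy := hB.partial₂₂ y x hy hx
  partial₂₂ x y hx hy := hB.partial₁₁ y x hy hx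
  bound₁₁ x y hx hy := hB.bound₂₂ y x hy hx
  bound₂₂ x y hx hy := hB.bound₁₁ y x hy hx

theorem norm_pd₁_le (hB : PureBathBounds B b b' b'') {x y : ℝ} (hx : x ≠ 0) (hy : y ≠ 0) :
    ‖pd₁ B x y‖ ≤ (1 + b) * (1 + b' + b'') := by
  obtain ⟨hb, hb', hb''⟩ := hB.nonneg
  calc ‖pd₁ B x y‖ ≤ b' := by
        linarith [hB.bound_partials x y hx hy, norm_nonneg (pd₂ B x y)]
    _ ≤ (1 + b) * (1 + b' + b'') := by nlinarith [mul_nonneg hb (add_nonneg hb' hb'')]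

theorem norm_pd₁_pd₁_le (hB : PureBathBounds B b b' b'') {x y : ℝ} (hx : x ≠ 0) (hy : y ≠ 0) :
    ‖pd₁ (pd₁ B) x y‖ ≤ (1 + b) * (1 + b' + b'') ^ 2 := by
  obtain ⟨hb, hb', hb''⟩ := hB.nonneg
  calc ‖pd₁ (pd₁ B) x y‖ ≤ b'' := hB.bound₁₁ x y hx hy
    _ ≤ (1 + b' + b'') ^ 2 := by nlinarith [mul_nonneg hb' hb'']
    _ ≤ (1 + b) * (1 + b' + b'') ^ 2 := by nlinarith [mul_nonneg hb (sq_nonneg (1 + b' + b''))]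

theorem c2Bound_fst (hB : PureBathBounds B b b' b'') {y ε : ℝ} (hy : y ≠ 0)
    (hε : ε = 1 ∨ ε = -1) : C2Bound (fun x => B (ε * x) y) (1 + b) (1 + b' + b'') := by
  refine ⟨fun x => ε • pd₁ B (ε * x) y, fun x => ε • ε • pd₁ (pd₁ B) (ε * x) y, fun x hx => ?_⟩
  have hεx : ε * x ≠ 0 := by rcases hε with rfl | rfl <;> simp [hx.ne']
  have hnorm : ‖ε‖ = 1 := by rcases hε with rfl | rfl <;> simp
  have hd : HasDerivAt (fun x : ℝ => ε * x) ε x := by simpa using (hasDerivAt_id x).const_mul ε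
  refine ⟨(hB.partials _ y hεx hy).1.hasDerivAt.scomp x hd,
    ((hB.partial₁₁ _ y hεx hy).hasDerivAt.scomp x hd).const_smul ε, ?_, ?_, ?_⟩
  · exact (hB.bound _ _).trans (by linarith)
  · rw [norm_smul, hnorm, one_mul]
    exact hB.norm_pd₁_le hεx hy
  · rw [norm_smul, norm_smul, hnorm, one_mul, one_mul]
    exact hB.norm_pd₁_pd₁_le hεx hy

theorem c2Bound_snd (hB : PureBathBounds B b b' b'') {y ε : ℝ} (hy : y ≠ 0)
    (hε : ε = 1 ∨ ε = -1) : C2Bound (fun x => B y (ε * x)) (1 + b) (1 + b' + b'') :=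
  hB.flip.c2Bound_fst hy hε

theorem norm_sub_le (hB : PureBathBounds B b b' b'') {x x' y : ℝ} (hx : 0 < x * x')
    (hy : y ≠ 0) : ‖B x y - B x' y‖ ≤ (1 + b) * (1 + b' + b'') * |x - x'| := by
  rcases pos_and_pos_or_neg_and_neg_of_mul_pos hx with ⟨hx, hx'⟩ | ⟨hx, hx'⟩
  · simpa using (hB.c2Bound_fst hy (Or.inl rfl)).norm_sub_le hx hx'
  · simpa [neg_add_eq_sub, abs_sub_comm] using
      (hB.c2Bound_fst hy (Or.inr rfl)).norm_sub_le (neg_pos.2 hx) (neg_pos.2 hx')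

theorem continuousOn (hB : PureBathBounds B b b' b'') :
    ContinuousOn (fun p : ℝ × ℝ => B p.1 p.2) {p | p.1 ≠ 0 ∧ p.2 ≠ 0} := by
  rintro ⟨x, y⟩ ⟨hx, hy⟩
  apply ContinuousAt.continuousWithinAt
  simp only at hx hy
  set c := (1 + b) * (1 + b' + b'')
  have hzero : Filter.Tendsto (fun p : ℝ × ℝ => c * |p.1 - x| + c * |p.2 - y|) (nhds (x, y))
      (nhds 0) := by
    have hcont : Continuous fun p : ℝ × ℝ => c * |p.1 - x| + c * |p.2 - y| := by fun_prop
    simpa using hcont.tendsto (x, y)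
  have hsign₁ : ∀ᶠ p : ℝ × ℝ in nhds (x, y), 0 < p.1 * x :=
    (by fun_prop : Continuous fun p : ℝ × ℝ => p.1 * x).continuousAt.eventually_const_lt
      (by simpa using mul_self_pos.2 hx)
  have hsign₂ : ∀ᶠ p : ℝ × ℝ in nhds (x, y), 0 < p.2 * y :=
    (by fun_prop : Continuous fun p : ℝ × ℝ => p.2 * y).continuousAt.eventually_const_lt
      (by simpa using mul_self_pos.2 hy)
  rw [ContinuousAt, tendsto_iff_norm_sub_tendsto_zero]
  refine squeeze_zero' (Filter.Eventually.of_forall fun _ => norm_nonneg _) ?_ hzero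
  filter_upwards [hsign₁, hsign₂] with p hp₁ hp₂
  calc ‖B p.1 p.2 - B x y‖ = ‖(B p.1 p.2 - B x p.2) + (B x p.2 - B x y)‖ := by
        rw [sub_add_sub_cancel]
    _ ≤ _ := norm_add_le_of_le (hB.norm_sub_le hp₁ (left_ne_zero_of_mul hp₂.ne'))
        (hB.flip.norm_sub_le hp₂ hx)

theorem continuousOn_influence (hB : PureBathBounds B b b' b'') (N : ℕ) :
    ContinuousOn (fun τ : Fin N → ℝ => influence B τ) {τ | ∀ i, τ i ≠ 0} := by
  unfold influence
  refine continuousOn_finsetSum _ fun σ _ => continuousOn_finsetProd _ fun i _ => ?_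
  exact hB.continuousOn.comp (f := fun τ : Fin N → ℝ => (τ i, τ (σ i)))
    (by fun_prop) fun τ hτ => ⟨hτ _, hτ _⟩

end PureBathBounds

theorem c2Bound_influence {K L : ℝ} (hK : 1 ≤ K) (hL : 0 ≤ L) {N : ℕ} {τ : ℝ → Fin N → ℝ}
    (h : ∀ i k, i ≠ k → C2Bound (fun x => B (τ x i) (τ x k)) K L) :
    C2Bound (fun x => influence B (τ x)) (K ^ N * √N.factorial) (N * L) := by
  have hprod : ∀ σ ∈ pairings N, C2Bound
      (fun x => ∏ i ∈ Finset.univ.filter (fun i => i < σ i), B (τ x i) (τ x (σ i)))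
      (K ^ N) (N * L) := by
    intro σ hσ
    have hcard : (Finset.univ.filter (fun i => i < σ i)).card ≤ N := by
      simpa using Finset.card_le_univ (Finset.univ.filter (fun i => i < σ i))
    refine (C2Bound.finset_prod (Finset.univ.filter (fun i => i < σ i))
      (φ := fun i x => B (τ x i) (τ x (σ i))) (by simp)
      fun i _ => h i (σ i) (mem_pairings.1 hσ i).2.symm).mono ?_ (by positivity) ?_
    · exact pow_le_pow_right₀ hK hcard
    · gcongr
  refine (C2Bound.finset_sum _ (by positivity) hprod).mono ?_ (by positivity) le_rfl
  rw [mul_comm]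
  gcongr
  exact card_pairings_le_sqrt_factorial N

theorem PureBathBounds.c2Bound_influence_path (hB : PureBathBounds B b b' b'') {N : ℕ}
    {τ : ℝ → Fin N → ℝ} (j : Fin N) {ε : ℝ} (hε : ε = 1 ∨ ε = -1) (hj : ∀ x, τ x j = ε * x)
    (hτ : ∀ i, i ≠ j → ∃ c, c ≠ 0 ∧ ∀ x, τ x i = c) :
    C2Bound (fun x => influence B (τ x)) ((1 + b) ^ N * √N.factorial)
      (N * (1 + b' + b'')) := by
  obtain ⟨hb, hb', hb''⟩ := hB.nonneg
  refine c2Bound_influence (by linarith) (by positivity) fun i k hik => ?_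
  rcases eq_or_ne i j with rfl | hi
  · obtain ⟨c, hc, hτk⟩ := hτ k hik.symm
    simp only [hj, hτk]
    exact hB.c2Bound_fst hc hε
  obtain ⟨c, hc, hτi⟩ := hτ i hi
  rcases eq_or_ne k j with rfl | hk
  · simp only [hj, hτi]
    exact hB.c2Bound_snd hc hε
  · obtain ⟨d, -, hτk⟩ := hτ k hk
    simp only [hτi, hτk]
    exact C2Bound.const ((hB.bound _ _).trans (by linarith)) (by positivity)

end Bath

/-! ### The midpoint rule on products of two simplices -/

section ProductMidpoint

variable {F : Type*} [NormedAddCommGroup F]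

theorem measurable_gridMid_pi (h : ℝ) (m : ℕ) :
    Measurable fun (s : Fin m → ℝ) i => gridMid h (s i) :=
  measurable_pi_lambda _ fun i => (measurable_gridMid h).comp (measurable_pi_apply i)

theorem integrableOn_prod_simplex_comp {m m' : ℕ} {T K : ℝ}
    {f : (Fin m → ℝ) → (Fin m' → ℝ) → F}
    (hf : ContinuousOn (fun p : (Fin m → ℝ) × (Fin m' → ℝ) => f p.1 p.2)
      (orthant m ×ˢ orthant m')) (hK : ∀ s s', ‖f s s'‖ ≤ K)
    {g : (Fin m → ℝ) → Fin m → ℝ} {g' : (Fin m' → ℝ) → Fin m' → ℝ} (hg : Measurable g)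
    (hg' : Measurable g') (hgo : Set.MapsTo g (orthant m) (orthant m))
    (hgo' : Set.MapsTo g' (orthant m') (orthant m')) :
    IntegrableOn (fun p : (Fin m → ℝ) × (Fin m' → ℝ) => f (g p.1) (g' p.2))
      (simplex m T ×ˢ simplex m' T) := by
  have hmeas : AEStronglyMeasurable
      (fun p : (Fin m → ℝ) × (Fin m' → ℝ) => f (g p.1) (g' p.2))
      (volume.restrict (simplex m T ×ˢ simplex m' T)) :=
    aestronglyMeasurable_comp_of_continuousOn hf
      ((measurableSet_orthant m).prod (measurableSet_orthant m'))
      ((hg.comp measurable_fst).prodMk (hg'.comp measurable_snd))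
      ((measurableSet_simplex m T).prod (measurableSet_simplex m' T)) fun p hp =>
      ⟨hgo (simplex_subset_orthant m T hp.1), hgo' (simplex_subset_orthant m' T hp.2)⟩
  refine IntegrableOn.of_bound ?_ hmeas K (Filter.Eventually.of_forall fun p => hK _ _)
  rw [Measure.volume_eq_prod, Measure.prod_prod]
  exact ENNReal.mul_lt_top (volume_simplex_lt_top m T) (volume_simplex_lt_top m' T)

variable [NormedSpace ℝ F] [CompleteSpace F]

theorem norm_setIntegral_simplex_prod_sub_le {Y : Type*} [MeasurableSpace Y] {ν : Measure Y}
    [SFinite ν] {S : Set Y} (hS : ν S < ⊤) {m : ℕ} {h T K L M : ℝ} (hh : 0 < h) (hT : 0 ≤ T)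
    {f : (Fin m → ℝ) → Y → F} (hf : ∀ y ∈ S, ContinuousOn (fun s => f s y) (orthant m))
    (hM : ∀ y ∈ S, ∀ s ∈ orthant m, ‖f s y‖ ≤ M)
    (hC : ∀ y ∈ S, ∀ i, ∀ s ∈ orthant m, C2Bound (fun x => f (Function.update s i x) y) K L)
    (hint : IntegrableOn (fun p : (Fin m → ℝ) × Y => f p.1 p.2) (simplex m T ×ˢ S)
      (volume.prod ν))
    (hint' : IntegrableOn (fun p : (Fin m → ℝ) × Y => f (fun i => gridMid h (p.1 i)) p.2)
      (simplex m T ×ˢ S) (volume.prod ν)) :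
    ‖(∫ p in simplex m T ×ˢ S, f p.1 p.2 ∂(volume.prod ν)) -
      ∫ p in simplex m T ×ˢ S, f (fun i => gridMid h (p.1 i)) p.2 ∂(volume.prod ν)‖ ≤
      midpointError m T K L h * ν.real S := by
  have hswap : IntegrableOn (fun z : Y × (Fin m → ℝ) =>
      f z.2 z.1 - f (fun i => gridMid h (z.2 i)) z.1) (S ×ˢ simplex m T) (ν.prod volume) :=
    (hint.sub hint').swap
  rw [← integral_sub hint hint', ← setIntegral_prod_swap]
  simp only [Prod.fst_swap, Prod.snd_swap]
  rw [setIntegral_prod _ hswap]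
  refine norm_setIntegral_le_of_norm_le_const hS fun y hy => ?_
  have hinty {g : (Fin m → ℝ) → Fin m → ℝ} (hg : Measurable g)
      (hgo : Set.MapsTo g (orthant m) (orthant m)) :
      IntegrableOn (fun s => f (g s) y) (simplex m T) :=
    integrableOn_simplex_comp (hf y hy) (hM y hy) hg hgo
  have hid : IntegrableOn (fun s => f s y) (simplex m T) := hinty measurable_id fun s hs => hs
  dsimp only
  rw [integral_sub hid (hinty (measurable_gridMid_pi h m) fun s _ i => gridMid_pos hh _)]
  exact norm_setIntegral_simplex_sub_le hh hT (hf y hy) (hM y hy) (hC y hy)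

theorem norm_setIntegral_prod_simplex_sub_le {m m' : ℕ} {h T K L : ℝ} (hh : 0 < h) (hT : 0 ≤ T)
    {f : (Fin m → ℝ) → (Fin m' → ℝ) → F}
    (hf : ContinuousOn (fun p : (Fin m → ℝ) × (Fin m' → ℝ) => f p.1 p.2)
      (orthant m ×ˢ orthant m')) (hK : ∀ s s', ‖f s s'‖ ≤ K)
    (hl : ∀ s ∈ orthant m, ∀ s' ∈ orthant m', ∀ i,
      C2Bound (fun x => f (Function.update s i x) s') K L)
    (hr : ∀ s ∈ orthant m, ∀ s' ∈ orthant m', ∀ i,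
      C2Bound (fun x => f s (Function.update s' i x)) K L) :
    ‖(∫ p in simplex m T ×ˢ simplex m' T, f p.1 p.2) -
      ∫ p in simplex m T ×ˢ simplex m' T, f (fun i => gridMid h (p.1 i))
        (fun i => gridMid h (p.2 i))‖ ≤
      midpointError m T K L h * (T ^ m' / m'.factorial) +
        midpointError m' T K L h * (T ^ m / m.factorial) := by
  have hgrid : ∀ {m : ℕ} (s : Fin m → ℝ), (fun i => gridMid h (s i)) ∈ orthant m :=
    fun s i => gridMid_pos hh _
  have hint := integrableOn_prod_simplex_comp (T := T) hf hK measurable_id measurable_id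
    (Set.mapsTo_id _) (Set.mapsTo_id _)
  have hint' := integrableOn_prod_simplex_comp (T := T) hf hK (measurable_gridMid_pi h m)
    measurable_id (fun s _ => hgrid s) (Set.mapsTo_id _)
  have hint'' := integrableOn_prod_simplex_comp (T := T) hf hK (measurable_gridMid_pi h m)
    (measurable_gridMid_pi h m') (fun s _ => hgrid s) (fun s _ => hgrid s)
  have hswap (g : (Fin m → ℝ) → (Fin m' → ℝ) → F) :
      ∫ p in simplex m' T ×ˢ simplex m T, g p.2 p.1 =
        ∫ p in simplex m T ×ˢ simplex m' T, g p.1 p.2 :=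
    setIntegral_prod_swap _ _ fun p : (Fin m → ℝ) × (Fin m' → ℝ) => g p.1 p.2
  have hleft := norm_setIntegral_simplex_prod_sub_le (volume_simplex_lt_top m' T) hh hT (f := f)
    (fun s' hs' => hf.comp (f := fun s => (s, s')) (by fun_prop)
      fun s hs => ⟨hs, simplex_subset_orthant m' T hs'⟩)
    (fun s' _ s _ => hK s s') (fun s' hs' i s hs => hl s hs s' (simplex_subset_orthant m' T hs') i)
    hint hint'
  have hright := norm_setIntegral_simplex_prod_sub_le (volume_simplex_lt_top m T) hh hT
    (f := fun s' s => f (fun i => gridMid h (s i)) s')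
    (fun s _ => hf.comp (f := fun s' => (fun i => gridMid h (s i), s')) (by fun_prop)
      fun s' hs' => ⟨hgrid s, hs'⟩)
    (fun s _ s' _ => hK _ s') (fun s _ i s' hs' => hr _ (hgrid s) s' hs' i)
    hint'.swap hint''.swap
  rw [← Measure.volume_eq_prod, volume_simplex _ hT] at hleft hright
  rw [hswap fun s s' => f (fun i => gridMid h (s i)) s',
    hswap fun s s' => f (fun i => gridMid h (s i)) fun i => gridMid h (s' i)] at hright
  exact (norm_sub_le_norm_sub_add_norm_sub _ _ _).trans (add_le_add hleft hright)

theorem setIntegral_prod_simplex_gridMid {h : ℝ} (hh : 0 < h) {m m' : ℕ}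
    (n : ℕ) {f : (Fin m → ℝ) → (Fin m' → ℝ) → F} {G : Multiset ℝ → Multiset ℝ → F}
    (hfG : ∀ s ∈ orthant m, ∀ s' ∈ orthant m', Monotone s → Monotone s' →
      f s s' = G (∑ i, {s i}) (∑ i, {s' i}))
    (hint : IntegrableOn (fun p : (Fin m → ℝ) × (Fin m' → ℝ) =>
      f (fun i => gridMid h (p.1 i)) (fun i => gridMid h (p.2 i)))
      (simplex m (n * h) ×ˢ simplex m' (n * h))) :
    ∫ p in simplex m (n * h) ×ˢ simplex m' (n * h),
      f (fun i => gridMid h (p.1 i)) (fun i => gridMid h (p.2 i)) =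
    ∑ k ∈ (Finset.univ : Finset (Fin n)).piAntidiag m,
      ∑ k' ∈ (Finset.univ : Finset (Fin n)).piAntidiag m',
        (cellWeight h k * cellWeight h k') •
          G (∑ i, k i • {midR h i}) (∑ i, k' i • {midR h i}) := by
  have hmono : ∀ {m : ℕ} (s : Fin m → ℝ), s ∈ simplex m (n * h) →
      Monotone fun i => gridMid h (s i) := fun s hs => (gridMid_mono hh).comp hs.1.monotone
  have hinner : ∀ s ∈ simplex m (n * h), ∫ s' in simplex m' (n * h),
      f (fun i => gridMid h (s i)) (fun i => gridMid h (s' i)) =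
      ∑ k' ∈ (Finset.univ : Finset (Fin n)).piAntidiag m',
        cellWeight h k' • G (∑ i, {gridMid h (s i)}) (∑ i, k' i • {midR h i}) := by
    intro s hs
    rw [← setIntegral_simplex_gridMid hh m' n]
    exact setIntegral_congr_fun (measurableSet_simplex m' _) fun s' hs' =>
      hfG _ (fun _ => gridMid_pos hh _) _ (fun _ => gridMid_pos hh _) (hmono s hs) (hmono s' hs')
  rw [Measure.volume_eq_prod] at hint ⊢
  rw [setIntegral_prod _ hint, setIntegral_congr_fun (measurableSet_simplex m _) hinner,
    setIntegral_simplex_gridMid hh m n (fun M =>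
      ∑ k' ∈ (Finset.univ : Finset (Fin n)).piAntidiag m',
        cellWeight h k' • G M (∑ i, k' i • {midR h i}))]
  simp only [Finset.smul_sum, smul_smul]

end ProductMidpoint

/-! ### The midpoint rule for the Dyson series -/

section DysonMidpoint

variable {E : Type*} [NormedAddCommGroup E] [InnerProductSpace ℂ E] [CompleteSpace E]

/-- Bound for the integrand of the Dyson series with `N` coupling operators of norm `w`, initial
operator of norm `ρ` and bath correlation function bounded by `b`. -/
def dysonBound (ρ w b : ℝ) (N : ℕ) : ℝ := (1 + b) ^ N * √N.factorial * (ρ * w ^ N)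

/-- Rate at which each derivative of the integrand of the Dyson series with respect to one of its
`N` times grows relative to `dysonBound`; `η` is the norm of the system Hamiltonian. -/
def dysonRate (η b' b'' : ℝ) (N : ℕ) : ℝ := N * (1 + b' + b'' + 2 * η)

variable {H W : E →L[ℂ] E} {B : ℝ → ℝ → ℂ} {b b' b'' : ℝ}

theorem norm_dysonIntegrand_le (hH : IsSelfAdjoint H) (W ρ₀ : E →L[ℂ] E)
    (hB : ∀ x y, ‖B x y‖ ≤ b) (t : ℝ) {m m' : ℕ} (p : (Fin m → ℝ) × (Fin m' → ℝ)) :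
    ‖dysonIntegrand H W ρ₀ B t m m' p‖ ≤ dysonBound ‖ρ₀‖ ‖W‖ b (m + m') := by
  have hb : 0 ≤ b := (norm_nonneg _).trans (hB 0 0)
  rw [dysonIntegrand_eq, dysonBound]
  refine (norm_smul_le _ _).trans (mul_le_mul (norm_influence_le hB _) ?_ (norm_nonneg _)
    (by positivity))
  simpa only [List.length_ofFn] using
    norm_sandwich_le hH W ρ₀ t t (List.ofFn p.1) (List.ofFn p.2)

theorem continuousOn_dysonIntegrand (H W : E →L[ℂ] E) (hB : PureBathBounds B b b' b'')
    (ρ₀ : E →L[ℂ] E) (t : ℝ) (m m' : ℕ) :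
    ContinuousOn (dysonIntegrand H W ρ₀ B t m m') (orthant m ×ˢ orthant m') := by
  have hcont : Continuous fun p : (Fin m → ℝ) × (Fin m' → ℝ) =>
      Fin.append (fun i : Fin m => -p.1 i.rev) p.2 :=
    continuous_pi <| Fin.addCases
      (fun i => by simp only [Fin.append_left]; fun_prop)
      (fun i => by simp only [Fin.append_right]; fun_prop)
  have hne : ∀ p ∈ orthant m ×ˢ orthant m', ∀ i,
      Fin.append (fun i : Fin m => -p.1 i.rev) p.2 i ≠ 0 := fun p hp => Fin.addCases
    (fun i => by simpa only [Fin.append_left] using neg_ne_zero.2 (hp.1 _).ne')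
    (fun i => by simpa only [Fin.append_right] using (hp.2 _).ne')
  rw [funext (dysonIntegrand_eq H W ρ₀ B t m m')]
  exact ((hB.continuousOn_influence (m + m')).comp hcont.continuousOn hne).smul
    (continuous_sandwich H W ρ₀ t t m m').continuousOn

theorem c2Bound_coupling_update (hH : IsSelfAdjoint H) (W : E →L[ℂ] E) {m : ℕ} (s : Fin m → ℝ)
    (i j : Fin m) :
    C2Bound (fun x => coupling H W (Function.update s i x j)) ‖W‖ (2 * ‖H‖) := by
  rcases eq_or_ne j i with rfl | hj
  · simpa only [Function.update_self] using c2Bound_coupling hH W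
  · simp only [Function.update_of_ne hj]
    exact C2Bound.const (norm_coupling_le hH W _) (by positivity)

theorem c2Bound_dysonIntegrand_left (hH : IsSelfAdjoint H) (hB : PureBathBounds B b b' b'')
    (ρ₀ : E →L[ℂ] E) (t : ℝ) {m m' : ℕ} {s : Fin m → ℝ} {s' : Fin m' → ℝ} (hs : s ∈ orthant m)
    (hs' : s' ∈ orthant m') (i : Fin m) :
    C2Bound (fun x => dysonIntegrand H W ρ₀ B t m m' (Function.update s i x, s'))
      (dysonBound ‖ρ₀‖ ‖W‖ b (m + m')) (dysonRate ‖H‖ b' b'' (m + m')) := by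
  have hfixed : ∀ k, k ≠ Fin.castAdd m' i.rev → ∃ c, c ≠ 0 ∧ ∀ x,
      Fin.append (fun k : Fin m => -Function.update s i x k.rev) s' k = c := by
    refine Fin.addCases (fun k hk => ⟨-s k.rev, neg_ne_zero.2 (hs _).ne', fun x => ?_⟩)
      (fun k _ => ⟨s' k, (hs' k).ne', fun x => by rw [Fin.append_right]⟩)
    have hki : k.rev ≠ i := by
      rintro rfl
      exact hk (by rw [Fin.rev_rev])
    rw [Fin.append_left, Function.update_of_ne hki]
  have hinfluence := hB.c2Bound_influence_path (Fin.castAdd m' i.rev) (ε := -1) (Or.inr rfl)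
    (fun x => by simp) hfixed
  have hsandwich := c2Bound_sandwich hH W ρ₀ t t (s := fun x => Function.update s i x)
    (s' := fun _ => s') (c2Bound_coupling_update hH W s i)
    (fun j => C2Bound.const (norm_coupling_le hH W _) (by positivity))
  simp only [dysonIntegrand_eq]
  exact (hinfluence.smul hsandwich).congr (fun _ => rfl) rfl (by rw [dysonRate]; ring)

theorem c2Bound_dysonIntegrand_right (hH : IsSelfAdjoint H) (hB : PureBathBounds B b b' b'')
    (ρ₀ : E →L[ℂ] E) (t : ℝ) {m m' : ℕ} {s : Fin m → ℝ} {s' : Fin m' → ℝ} (hs : s ∈ orthant m)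
    (hs' : s' ∈ orthant m') (i : Fin m') :
    C2Bound (fun x => dysonIntegrand H W ρ₀ B t m m' (s, Function.update s' i x))
      (dysonBound ‖ρ₀‖ ‖W‖ b (m + m')) (dysonRate ‖H‖ b' b'' (m + m')) := by
  have hfixed : ∀ k, k ≠ Fin.natAdd m i → ∃ c, c ≠ 0 ∧ ∀ x,
      Fin.append (fun k : Fin m => -s k.rev) (Function.update s' i x) k = c := by
    refine Fin.addCases
      (fun k _ => ⟨-s k.rev, neg_ne_zero.2 (hs _).ne', fun x => by rw [Fin.append_left]⟩)
      (fun k hk => ⟨s' k, (hs' k).ne', fun x => ?_⟩)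
    rw [Fin.append_right, Function.update_of_ne fun hki => hk (congrArg _ hki)]
  have hinfluence := hB.c2Bound_influence_path (Fin.natAdd m i) (ε := 1) (Or.inl rfl)
    (fun x => by simp) hfixed
  have hsandwich := c2Bound_sandwich hH W ρ₀ t t (s := fun _ => s)
    (s' := fun x => Function.update s' i x)
    (fun j => C2Bound.const (norm_coupling_le hH W _) (by positivity))
    (c2Bound_coupling_update hH W s' i)
  simp only [dysonIntegrand_eq]
  exact (hinfluence.smul hsandwich).congr (fun _ => rfl) rfl (by rw [dysonRate]; ring)

theorem integrableOn_dysonIntegrand (hH : IsSelfAdjoint H) (W ρ₀ : E →L[ℂ] E)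
    (hB : PureBathBounds B b b' b'') (t T : ℝ) (m m' : ℕ) :
    IntegrableOn (dysonIntegrand H W ρ₀ B t m m') (simplex m T ×ˢ simplex m' T) :=
  integrableOn_prod_simplex_comp (f := fun s s' => dysonIntegrand H W ρ₀ B t m m' (s, s'))
    (g := fun s => s) (g' := fun s' => s') (continuousOn_dysonIntegrand H W hB ρ₀ t m m')
    (fun s s' => norm_dysonIntegrand_le hH W ρ₀ hB.bound t (s, s')) measurable_id measurable_id
    (Set.mapsTo_id _) (Set.mapsTo_id _)

theorem norm_setIntegral_dysonIntegrand_sub_le (hH : IsSelfAdjoint H) (W ρ₀ : E →L[ℂ] E)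
    (hB : PureBathBounds B b b' b'') {h T : ℝ} (hh : 0 < h) (hT : 0 ≤ T) (t : ℝ) (m m' : ℕ) :
    ‖(∫ p in simplex m T ×ˢ simplex m' T, dysonIntegrand H W ρ₀ B t m m' p) -
      ∫ p in simplex m T ×ˢ simplex m' T, dysonIntegrand H W ρ₀ B t m m'
        (fun i => gridMid h (p.1 i), fun i => gridMid h (p.2 i))‖ ≤
      midpointError m T (dysonBound ‖ρ₀‖ ‖W‖ b (m + m')) (dysonRate ‖H‖ b' b'' (m + m')) h *
          (T ^ m' / m'.factorial) +
        midpointError m' T (dysonBound ‖ρ₀‖ ‖W‖ b (m + m')) (dysonRate ‖H‖ b' b'' (m + m')) h *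
          (T ^ m / m.factorial) :=
  norm_setIntegral_prod_simplex_sub_le (f := fun s s' => dysonIntegrand H W ρ₀ B t m m' (s, s'))
    hh hT (continuousOn_dysonIntegrand H W hB ρ₀ t m m')
    (fun s s' => norm_dysonIntegrand_le hH W ρ₀ hB.bound t (s, s'))
    (fun _ hs _ hs' => c2Bound_dysonIntegrand_left hH hB ρ₀ t hs hs')
    (fun _ hs _ hs' => c2Bound_dysonIntegrand_right hH hB ρ₀ t hs hs')

/-! ### The midpoint sum as a sum over configurations -/

/-- The integrand of the Dyson series as a function of the multisets of positive times on the two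
branches. -/
def dysonMultiset (H W ρ₀ : E →L[ℂ] E) (B : ℝ → ℝ → ℂ) (t : ℝ) (M M' : Multiset ℝ) :
    E →L[ℂ] E :=
  multisetInfluence B (M.map Neg.neg + M') •
    sandwich H W ρ₀ t t (M.sort (· ≤ ·)) (M'.sort (· ≤ ·))

theorem coe_ofFn_eq_sum {α : Type*} {m : ℕ} (s : Fin m → α) :
    ((List.ofFn s : List α) : Multiset α) = ∑ i, {s i} := by
  rw [List.ofFn_eq_map, ← Multiset.map_coe, ← Multiset.sum_map_singleton (Multiset.map s _),
    Multiset.map_map]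
  rfl

theorem sort_sum_singleton {α : Type*} [LinearOrder α] {m : ℕ} {s : Fin m → α} (hs : Monotone s) :
    (∑ i, {s i} : Multiset α).sort (· ≤ ·) = List.ofFn s := by
  rw [← coe_ofFn_eq_sum, sort_coe_eq_self (List.pairwise_ofFn.2 fun _ _ hij => hs hij.le)]

theorem pairwise_ofFn_append_neg {m m' : ℕ} {s : Fin m → ℝ} {s' : Fin m' → ℝ}
    (hs₀ : s ∈ orthant m) (hs₀' : s' ∈ orthant m') (hs : Monotone s) (hs' : Monotone s') :
    (List.ofFn (Fin.append (fun i : Fin m => -s i.rev) s')).Pairwise (· ≤ ·) := by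
  rw [List.ofFn_fin_append, List.pairwise_append, List.pairwise_ofFn, List.pairwise_ofFn]
  refine ⟨fun i j hij => neg_le_neg (hs (Fin.rev_le_rev.2 hij.le)), fun i j hij => hs' hij.le,
    fun x hx y hy => ?_⟩
  obtain ⟨i, rfl⟩ := (List.mem_ofFn' _ _).1 hx
  obtain ⟨j, rfl⟩ := (List.mem_ofFn' _ _).1 hy
  linarith [hs₀ i.rev, hs₀' j]

theorem coe_ofFn_append_neg {m m' : ℕ} (s : Fin m → ℝ) (s' : Fin m' → ℝ) :
    (List.ofFn (Fin.append (fun i : Fin m => -s i.rev) s') : Multiset ℝ) =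
      (∑ i, {s i} : Multiset ℝ).map Neg.neg + ∑ i, {s' i} := by
  rw [coe_ofFn_eq_sum, Fin.sum_univ_add, ← Multiset.coe_mapAddMonoidHom, map_sum]
  simp only [Fin.append_left, Fin.append_right, Multiset.coe_mapAddMonoidHom,
    Multiset.map_singleton]
  exact congrArg (· + _) (Equiv.sum_comp Fin.revPerm fun i => ({-s i} : Multiset ℝ))

theorem dysonIntegrand_eq_dysonMultiset (H W ρ₀ : E →L[ℂ] E) (B : ℝ → ℝ → ℂ) (t : ℝ) {m m' : ℕ}
    {s : Fin m → ℝ} {s' : Fin m' → ℝ} (hs₀ : s ∈ orthant m) (hs₀' : s' ∈ orthant m')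
    (hs : Monotone s) (hs' : Monotone s') :
    dysonIntegrand H W ρ₀ B t m m' (s, s') =
      dysonMultiset H W ρ₀ B t (∑ i, {s i}) (∑ i, {s' i}) := by
  rw [dysonIntegrand_eq, dysonMultiset, sort_sum_singleton hs, sort_sum_singleton hs',
    ← coe_ofFn_append_neg, multisetInfluence_coe B (pairwise_ofFn_append_neg hs₀ hs₀' hs hs'),
    listInfluence_ofFn]

theorem setIntegral_dysonIntegrand_gridMid (hH : IsSelfAdjoint H) (W ρ₀ : E →L[ℂ] E)
    (hB : PureBathBounds B b b' b'') {h : ℝ} (hh : 0 < h) (t : ℝ) (m m' n : ℕ) :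
    ∫ p in simplex m (n * h) ×ˢ simplex m' (n * h), dysonIntegrand H W ρ₀ B t m m'
      (fun i => gridMid h (p.1 i), fun i => gridMid h (p.2 i)) =
    ∑ k ∈ (Finset.univ : Finset (Fin n)).piAntidiag m,
      ∑ k' ∈ (Finset.univ : Finset (Fin n)).piAntidiag m',
        (cellWeight h k * cellWeight h k') •
          dysonMultiset H W ρ₀ B t (∑ i, k i • {midR h i}) (∑ i, k' i • {midR h i}) :=
  setIntegral_prod_simplex_gridMid (f := fun s s' => dysonIntegrand H W ρ₀ B t m m' (s, s')) hh n
    (fun _ hs₀ _ hs₀' hs hs' => dysonIntegrand_eq_dysonMultiset H W ρ₀ B t hs₀ hs₀' hs hs')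
    (integrableOn_prod_simplex_comp (f := fun s s' => dysonIntegrand H W ρ₀ B t m m' (s, s'))
      (g := fun s i => gridMid h (s i)) (g' := fun s i => gridMid h (s i))
      (continuousOn_dysonIntegrand H W hB ρ₀ t m m')
      (fun s s' => norm_dysonIntegrand_le hH W ρ₀ hB.bound t (s, s')) (measurable_gridMid_pi h m)
      (measurable_gridMid_pi h m') (fun _ _ _ => gridMid_pos hh _)
      (fun _ _ _ => gridMid_pos hh _))

end DysonMidpoint

/-! ### Crowded configurations -/

section Crowded

theorem sum_filter_le_sum_sum_filter {α J : Type*} [Fintype J] {s : Finset α} {f : α → ℝ}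
    (hf : ∀ a ∈ s, 0 ≤ f a) {P : α → Prop} {Q : J → α → Prop} [DecidablePred P]
    [∀ j, DecidablePred (Q j)] (hPQ : ∀ a, P a → ∃ j, Q j a) :
    ∑ a ∈ s with P a, f a ≤ ∑ j, ∑ a ∈ s with Q j a, f a := by
  simp only [Finset.sum_filter]
  rw [Finset.sum_comm]
  refine Finset.sum_le_sum fun a ha => ?_
  have hterm : ∀ j ∈ (Finset.univ : Finset J), 0 ≤ if Q j a then f a else 0 := fun j _ =>
    ite_nonneg (hf a ha) le_rfl
  split_ifs with hP
  · obtain ⟨j, hj⟩ := hPQ a hP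
    calc f a = if Q j a then f a else 0 := (if_pos hj).symm
      _ ≤ _ := Finset.single_le_sum hterm (Finset.mem_univ j)
  · exact Finset.sum_nonneg hterm

theorem cast_pow_three_le_cast_pow_four (N : ℕ) : (N : ℝ) ^ 3 ≤ (N : ℝ) ^ 4 := by
  rcases N.eq_zero_or_pos with rfl | hN
  · simp
  · exact_mod_cast Nat.pow_le_pow_right hN (by norm_num : 3 ≤ 4)

theorem pow_sub_div_factorial_sub_le {x : ℝ} (hx : 0 ≤ x) {V N : ℕ} (hVN : V ≤ N) :
    x ^ (N - V) / (N - V).factorial ≤ x ^ (N - V) * (N : ℝ) ^ V / N.factorial := by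
  have hfactorial : (N.factorial : ℝ) ≤ (N - V).factorial * (N : ℝ) ^ V := by
    rw [← Nat.factorial_mul_descFactorial hVN]
    exact_mod_cast Nat.mul_le_mul_left _ (Nat.descFactorial_le_pow _ _)
  rw [div_le_div_iff₀ (by positivity) (by positivity), mul_assoc, mul_comm ((N : ℝ) ^ V)]
  gcongr

section Core

variable {ι : Type*}

/-- The configurations which the scheme does not reproduce exactly: three points in one interval,
or two points in each of two intervals. -/
def Crowded (k : ι → ℕ) : Prop := (∃ l, 3 ≤ k l) ∨ ∃ l l', l ≠ l' ∧ 2 ≤ k l ∧ 2 ≤ k l'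

variable [DecidableEq ι]

/-- The minimal crowded configurations, together with the (harmless) configurations of four points
in one interval. -/
def crowdedCore : ι ⊕ ι × ι → ι → ℕ :=
  Sum.elim (fun l => Pi.single l 3) fun p => Pi.single p.1 2 + Pi.single p.2 2

theorem Crowded.exists_crowdedCore_le {k : ι → ℕ} (hk : Crowded k) : ∃ c, crowdedCore c ≤ k := by
  rcases hk with ⟨l, hl⟩ | ⟨l, l', hll', hl, hl'⟩
  · refine ⟨.inl l, fun i => ?_⟩
    rcases eq_or_ne i l with rfl | hi
    · simpa [crowdedCore] using hl
    · simp [crowdedCore, hi]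
  · refine ⟨.inr (l, l'), fun i => ?_⟩
    rcases eq_or_ne i l with rfl | hi
    · simpa [crowdedCore, hll'] using hl
    · rcases eq_or_ne i l' with rfl | hi'
      · simpa [crowdedCore, hi] using hl'
      · simp [crowdedCore, hi, hi']

end Core

variable {ι : Type*} [Fintype ι]

theorem cellWeight_nonneg {h : ℝ} (hh : 0 ≤ h) (k : ι → ℕ) : 0 ≤ cellWeight h k :=
  Finset.prod_nonneg fun _ _ => by positivity

theorem cellWeight_le_of_le {h : ℝ} (hh : 0 ≤ h) {k v : ι → ℕ} (hv : v ≤ k) :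
    cellWeight h k ≤ h ^ (∑ l, v l) * cellWeight h (k - v) := by
  rw [cellWeight, cellWeight, ← Finset.prod_pow_eq_pow_sum, ← Finset.prod_mul_distrib]
  refine Finset.prod_le_prod (fun l _ => by positivity) fun l _ => ?_
  rw [← mul_div_assoc, Pi.sub_apply, ← pow_add, Nat.add_sub_cancel' (hv l)]
  have hfactorial : ((k l - v l).factorial : ℝ) ≤ (k l).factorial := by
    exact_mod_cast Nat.factorial_le (Nat.sub_le _ _)
  gcongr

variable [DecidableEq ι]

theorem sum_cellWeight (h : ℝ) (N : ℕ) :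
    ∑ k ∈ (Finset.univ : Finset ι).piAntidiag N, cellWeight h k =
      (Fintype.card ι * h) ^ N / N.factorial := by
  have hmultinomial := Finset.sum_pow_eq_sum_piAntidiag (Finset.univ : Finset ι) (fun _ => h) N
  rw [Finset.sum_const, Finset.card_univ, nsmul_eq_mul] at hmultinomial
  rw [hmultinomial, Finset.sum_div]
  refine Finset.sum_congr rfl fun k hk => ?_
  have hk := (Finset.mem_piAntidiag.1 hk).1
  rw [← pow_div_factorial_mul_multinomial h hk, Finset.prod_pow_eq_pow_sum, hk]
  ring

open scoped Classical in
theorem sum_cellWeight_filter_ge_le {h : ℝ} (hh : 0 ≤ h) (N : ℕ) (v : ι → ℕ) :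
    ∑ k ∈ (Finset.univ : Finset ι).piAntidiag N with v ≤ k, cellWeight h k ≤
      h ^ (∑ l, v l) *
        ∑ k ∈ (Finset.univ : Finset ι).piAntidiag (N - ∑ l, v l), cellWeight h k := by
  have hinj : Set.InjOn (· - v) ({k ∈ (Finset.univ : Finset ι).piAntidiag N | v ≤ k} : Finset _) :=
    fun k hk k' hk' hkk' =>
      (tsub_left_inj (Finset.mem_filter.1 hk).2 (Finset.mem_filter.1 hk').2).1 hkk'
  have hsub : {k ∈ (Finset.univ : Finset ι).piAntidiag N | v ≤ k}.image (· - v) ⊆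
      (Finset.univ : Finset ι).piAntidiag (N - ∑ l, v l) := by
    refine Finset.image_subset_iff.2 fun k hk => ?_
    obtain ⟨hkN, hvk⟩ := Finset.mem_filter.1 hk
    refine Finset.mem_piAntidiag.2 ⟨?_, fun _ _ => Finset.mem_univ _⟩
    simp only [Pi.sub_apply]
    rw [Finset.sum_tsub_distrib _ fun l _ => hvk l, (Finset.mem_piAntidiag.1 hkN).1]
  calc _ ≤ ∑ k ∈ (Finset.univ : Finset ι).piAntidiag N with v ≤ k,
        h ^ (∑ l, v l) * cellWeight h (k - v) :=
        Finset.sum_le_sum fun k hk => cellWeight_le_of_le hh (Finset.mem_filter.1 hk).2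
    _ = h ^ (∑ l, v l) * ∑ k ∈ {k ∈ (Finset.univ : Finset ι).piAntidiag N | v ≤ k}.image (· - v),
        cellWeight h k := by
        rw [← Finset.mul_sum, Finset.sum_image hinj]
    _ ≤ _ := mul_le_mul_of_nonneg_left
        (Finset.sum_le_sum_of_subset_of_nonneg hsub fun k _ _ => cellWeight_nonneg hh k)
        (by positivity)

open scoped Classical in
theorem sum_cellWeight_filter_ge_le_div_factorial {h : ℝ} (hh : 0 ≤ h) (N : ℕ) (v : ι → ℕ) :
    ∑ k ∈ (Finset.univ : Finset ι).piAntidiag N with v ≤ k, cellWeight h k ≤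
      h ^ (∑ l, v l) * ((Fintype.card ι * h) ^ (N - ∑ l, v l) *
        (N : ℝ) ^ (∑ l, v l) / N.factorial) := by
  by_cases hvN : ∑ l, v l ≤ N
  · refine (sum_cellWeight_filter_ge_le hh N v).trans ?_
    rw [sum_cellWeight]
    exact mul_le_mul_of_nonneg_left (pow_sub_div_factorial_sub_le (by positivity) hvN)
      (by positivity)
  · rw [Finset.sum_eq_zero]
    · positivity
    · intro k hk
      obtain ⟨hkN, hvk⟩ := Finset.mem_filter.1 hk
      rw [← (Finset.mem_piAntidiag.1 hkN).1] at hvN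
      exact absurd (Finset.sum_le_sum fun l _ => hvk l) hvN

theorem sum_crowdedCore_inl (l : ι) : ∑ i, crowdedCore (.inl l) i = 3 := by
  simp [crowdedCore]

theorem sum_crowdedCore_inr (p : ι × ι) : ∑ i, crowdedCore (.inr p) i = 4 := by
  simp [crowdedCore, Finset.sum_add_distrib]

open scoped Classical in
theorem sum_cellWeight_crowded_le {h : ℝ} (hh : 0 ≤ h) (N : ℕ) :
    ∑ k ∈ (Finset.univ : Finset ι).piAntidiag N with Crowded k, cellWeight h k ≤
      h ^ 2 * (2 * (N : ℝ) ^ 4 * (1 + Fintype.card ι * h) ^ (N + 2) / N.factorial) := by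
  set X := Fintype.card ι * h with hX
  have hX0 : 0 ≤ X := by positivity
  have hcube := cast_pow_three_le_cast_pow_four N
  have hpow : ∀ j, j ≤ N + 2 → X ^ j ≤ (1 + X) ^ (N + 2) := fun j hj =>
    (pow_le_pow_left₀ hX0 (by linarith) j).trans (pow_le_pow_right₀ (by linarith) hj)
  calc _ ≤ ∑ c : ι ⊕ ι × ι, ∑ k ∈ (Finset.univ : Finset ι).piAntidiag N with crowdedCore c ≤ k,
        cellWeight h k :=
        sum_filter_le_sum_sum_filter (fun k _ => cellWeight_nonneg hh k)
          fun _ hk => hk.exists_crowdedCore_le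
    _ ≤ ∑ c : ι ⊕ ι × ι, h ^ (∑ l, crowdedCore c l) * (X ^ (N - ∑ l, crowdedCore c l) *
        (N : ℝ) ^ (∑ l, crowdedCore c l) / N.factorial) :=
        Finset.sum_le_sum fun c _ => sum_cellWeight_filter_ge_le_div_factorial hh N _
    _ = h ^ 2 * ((X ^ (N - 3 + 1) * (N : ℝ) ^ 3 + X ^ (N - 4 + 2) * (N : ℝ) ^ 4) /
        N.factorial) := by
        simp only [Fintype.sum_sum_type, sum_crowdedCore_inl, sum_crowdedCore_inr,
          Finset.sum_const, Finset.card_univ, Fintype.card_prod, nsmul_eq_mul, Nat.cast_mul, hX]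
        ring
    _ ≤ h ^ 2 * (((1 + X) ^ (N + 2) * (N : ℝ) ^ 4 + (1 + X) ^ (N + 2) * (N : ℝ) ^ 4) /
        N.factorial) := by
        gcongr
        exacts [hpow _ (by omega), hpow _ (by omega)]
    _ = _ := by ring

end Crowded

/-! ### Midpoint sums and chains of operators -/

section Configurations

theorem coe_timeList (h : ℝ) (a : ℕ) (k : Fin a → ℕ) :
    (timeList h a k : Multiset ℝ) = ∑ i : Fin a, k i • {midR h i} := by
  induction a with
  | zero => simp [timeList]
  | succ a ih =>
    rw [timeList, ← Multiset.coe_add, ih, Fin.sum_univ_castSucc, Multiset.coe_replicate,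
      Multiset.nsmul_singleton]
    simp

theorem length_timeList (h : ℝ) (a : ℕ) (k : Fin a → ℕ) :
    (timeList h a k).length = ∑ i, k i := by
  rw [← Multiset.coe_card, coe_timeList]
  simp

theorem exists_eq_midR_of_mem_timeList {h : ℝ} {a : ℕ} {k : Fin a → ℕ} {x : ℝ}
    (hx : x ∈ timeList h a k) : ∃ i : Fin a, x = midR h i := by
  rw [← Multiset.mem_coe, coe_timeList, Multiset.mem_sum] at hx
  obtain ⟨i, -, hi⟩ := hx
  exact ⟨i, Multiset.mem_singleton.1 (Multiset.mem_of_mem_nsmul hi)⟩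

theorem midR_mono {h : ℝ} (hh : 0 ≤ h) : Monotone (midR h) := fun i j hij => by
  unfold midR
  gcongr

theorem pairwise_timeList {h : ℝ} (hh : 0 ≤ h) (a : ℕ) (k : Fin a → ℕ) :
    (timeList h a k).Pairwise (· ≤ ·) := by
  induction a with
  | zero => simp [timeList]
  | succ a ih =>
    rw [timeList, List.pairwise_append]
    refine ⟨ih _, List.pairwise_replicate_of_refl, fun x hx y hy => ?_⟩
    obtain ⟨i, rfl⟩ := exists_eq_midR_of_mem_timeList hx
    rw [List.eq_of_mem_replicate hy]
    exact midR_mono hh i.is_le'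

theorem map_neg_add_eq_timeMultiset (h : ℝ) {a c : ℕ} (k : Interval a c → ℕ) :
    (∑ i, k (.inl i) • {midR h i} : Multiset ℝ).map Neg.neg + ∑ i, k (.inr i) • {midR h i} =
      timeMultiset (mid h) k := by
  rw [timeMultiset, Fintype.sum_sum_type, ← Multiset.coe_mapAddMonoidHom, map_sum]
  congr 1
  refine Finset.sum_congr rfl fun i _ => ?_
  rw [Multiset.coe_mapAddMonoidHom, Multiset.map_nsmul, Multiset.map_singleton]
  simp only [mid, midL, midR, neg_mul]

theorem card_timeMultiset {ι : Type*} [Fintype ι] (μ : ι → ℝ) (k : ι → ℕ) :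
    (timeMultiset μ k).card = ∑ l, k l := by
  simp [timeMultiset]

theorem norm_multisetInfluence_le {B : ℝ → ℝ → ℂ} {b : ℝ} (hB : ∀ x y, ‖B x y‖ ≤ b)
    (M : Multiset ℝ) : ‖multisetInfluence B M‖ ≤ (1 + b) ^ M.card * √M.card.factorial := by
  refine (norm_influence_le hB (M.sort (· ≤ ·)).get).trans (le_of_eq ?_)
  rw [Multiset.length_sort]

theorem prefactor_eq (z : ℂ) (h : ℝ) {a : ℕ} (k : Fin a → ℕ) :
    prefactor (z * h) k = z ^ (∑ i, k i) * (cellWeight h k : ℝ) := by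
  rw [prefactor, cellWeight, ← Finset.prod_pow_eq_pow_sum, Complex.ofReal_prod,
    ← Finset.prod_mul_distrib]
  refine Finset.prod_congr rfl fun i _ => ?_
  push_cast
  ring

theorem cellWeight_sum {ι κ : Type*} [Fintype ι] [Fintype κ] (h : ℝ) (k : ι ⊕ κ → ℕ) :
    cellWeight h k = cellWeight h (fun i => k (.inl i)) * cellWeight h fun i => k (.inr i) :=
  Fintype.prod_sum_type _

variable {E : Type*} [NormedAddCommGroup E] [InnerProductSpace ℂ E] [CompleteSpace E]

theorem dysonMultiset_eq (H W ρ₀ : E →L[ℂ] E) (B : ℝ → ℝ → ℂ) {h : ℝ} (hh : 0 ≤ h) (t : ℝ)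
    {a c : ℕ} (k : Interval a c → ℕ) :
    dysonMultiset H W ρ₀ B t (∑ i, k (.inl i) • {midR h i}) (∑ i, k (.inr i) • {midR h i}) =
      multisetInfluence B (timeMultiset (mid h) k) •
        sandwich H W ρ₀ t t (timeList h a fun i => k (.inl i))
          (timeList h c fun i => k (.inr i)) := by
  rw [dysonMultiset, map_neg_add_eq_timeMultiset, ← coe_timeList h a, ← coe_timeList h c,
    sort_coe_eq_self (pairwise_timeList hh _ _), sort_coe_eq_self (pairwise_timeList hh _ _)]

theorem smul_dysonMultiset_eq (H W ρ₀ : E →L[ℂ] E) (B : ℝ → ℝ → ℂ) {h : ℝ} (hh : 0 ≤ h)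
    {n : ℕ} (k : Interval n n → ℕ) :
    ((-Complex.I) ^ (∑ i, k (.inl i)) * Complex.I ^ (∑ i, k (.inr i))) •
      ((cellWeight h (fun i => k (.inl i)) * cellWeight h fun i => k (.inr i)) •
        dysonMultiset H W ρ₀ B (n * h) (∑ i, k (.inl i) • {midR h i})
          (∑ i, k (.inr i) • {midR h i})) =
      multisetInfluence B (timeMultiset (mid h) k) • chainOp H W ρ₀ h k := by
  rw [dysonMultiset_eq H W ρ₀ B hh, chainOp, prefactor_eq, prefactor_eq, ← Complex.coe_smul,
    smul_smul, smul_smul, smul_smul]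
  congr 1
  push_cast
  ring

theorem norm_prefactor_eq {z : ℂ} (hz : ‖z‖ = 1) {h : ℝ} (hh : 0 ≤ h) {a : ℕ} (k : Fin a → ℕ) :
    ‖prefactor (z * h) k‖ = cellWeight h k := by
  rw [prefactor_eq, norm_mul, norm_pow, hz, one_pow, one_mul, Complex.norm_real,
    Real.norm_of_nonneg (cellWeight_nonneg hh k)]

theorem norm_chainOp_le {H : E →L[ℂ] E} (hH : IsSelfAdjoint H) (W ρ₀ : E →L[ℂ] E) {h : ℝ}
    (hh : 0 ≤ h) {a c : ℕ} (k : Interval a c → ℕ) :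
    ‖chainOp H W ρ₀ h k‖ ≤ cellWeight h k * (‖ρ₀‖ * ‖W‖ ^ (∑ l, k l)) := by
  have hsandwich := norm_sandwich_le hH W ρ₀ (a * h) (c * h) (timeList h a fun i => k (.inl i))
    (timeList h c fun i => k (.inr i))
  rw [length_timeList, length_timeList, ← Fintype.sum_sum_type] at hsandwich
  rw [chainOp, norm_smul, norm_mul, norm_prefactor_eq (by simp) hh,
    norm_prefactor_eq Complex.norm_I hh, ← cellWeight_sum]
  exact mul_le_mul_of_nonneg_left hsandwich (cellWeight_nonneg hh _)

end Configurations

/-! ### The scheme sorted by numbers of coupling operators -/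

section Configs

/-- The numbers of points of a configuration on the left and on the right branch. -/
def bidegree {a c : ℕ} (k : Interval a c → ℕ) : ℕ × ℕ := (∑ i, k (.inl i), ∑ i, k (.inr i))

/-- The configurations with `q.1` points on the left and `q.2` points on the right branch. -/
def configs (n : ℕ) (q : ℕ × ℕ) : Finset (Interval n n → ℕ) :=
  ((Finset.univ : Finset (Interval n n)).piAntidiag (q.1 + q.2)).filter (bidegree · = q)

theorem mem_configs {n : ℕ} {q : ℕ × ℕ} {k : Interval n n → ℕ} :
    k ∈ configs n q ↔ bidegree k = q := by
  rw [configs, Finset.mem_filter, and_iff_right_iff_imp]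
  rintro rfl
  simp [bidegree]

theorem sum_eq_of_mem_configs {n : ℕ} {q : ℕ × ℕ} {k : Interval n n → ℕ} (hk : k ∈ configs n q) :
    ∑ l, k l = q.1 + q.2 := by
  rw [← mem_configs.1 hk, bidegree, Fintype.sum_sum_type]

theorem sum_configs {M : Type*} [AddCommMonoid M] (n : ℕ) (q : ℕ × ℕ)
    (f : (Interval n n → ℕ) → M) :
    ∑ k ∈ (Finset.univ : Finset (Fin n)).piAntidiag q.1,
      ∑ k' ∈ (Finset.univ : Finset (Fin n)).piAntidiag q.2, f (Sum.elim k k') =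
      ∑ k ∈ configs n q, f k := by
  rw [← Finset.sum_product']
  refine Finset.sum_bij' (fun p _ => Sum.elim p.1 p.2)
    (fun k _ => (fun i => k (.inl i), fun i => k (.inr i))) (fun p hp => ?_) (fun k hk => ?_)
    (fun _ _ => rfl) (fun k _ => Sum.elim_comp_inl_inr k) fun _ _ => rfl
  · obtain ⟨hp, hp'⟩ := Finset.mem_product.1 hp
    exact mem_configs.2 (Prod.ext (Finset.mem_piAntidiag.1 hp).1 (Finset.mem_piAntidiag.1 hp').1)
  · rw [mem_configs] at hk
    exact Finset.mem_product.2
      ⟨Finset.mem_piAntidiag.2 ⟨congrArg Prod.fst hk, fun _ _ => Finset.mem_univ _⟩,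
        Finset.mem_piAntidiag.2 ⟨congrArg Prod.snd hk, fun _ _ => Finset.mem_univ _⟩⟩

section ExtendMarks

variable {ι : Type*}

open scoped Classical in
/-- A function of the markings with values in `{0, 1, 2}`, extended by zero to all
configurations. -/
def extendMarks (w : (ι → Fin 3) → ℂ) (k : ι → ℕ) : ℂ :=
  if hk : ∀ l, k l < 3 then w fun l => ⟨k l, hk l⟩ else 0

variable {w : (ι → Fin 3) → ℂ}

theorem extendMarks_counts (K : ι → Fin 3) : extendMarks w (counts K) = w K :=
  dif_pos fun l => (K l).isLt

theorem exists_counts_eq_of_extendMarks_ne_zero {k : ι → ℕ} (hk : extendMarks w k ≠ 0) :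
    ∃ K : ι → Fin 3, counts K = k := by
  by_contra! hne
  exact hk (dif_neg fun hlt => hne (fun l => ⟨k l, hlt l⟩) rfl)

theorem norm_extendMarks_le [Fintype ι] {g : ℕ → ℝ} (hg : ∀ N, 0 ≤ g N)
    (hw : ∀ K, ‖w K‖ ≤ g (∑ l, counts K l)) (k : ι → ℕ) : ‖extendMarks w k‖ ≤ g (∑ l, k l) := by
  by_cases hk : extendMarks w k = 0
  · rw [hk, norm_zero]
    exact hg _
  · obtain ⟨K, rfl⟩ := exists_counts_eq_of_extendMarks_ne_zero hk
    rw [extendMarks_counts]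
    exact hw K

theorem extendMarks_eq_of_not_crowded {f : (ι → ℕ) → ℂ}
    (hw : ∀ K, AtMostOneDouble K → w K = f (counts K)) {k : ι → ℕ} (hk : ¬ Crowded k) :
    extendMarks w k = f k := by
  rw [Crowded, not_or] at hk
  push Not at hk
  obtain ⟨hlt, hdouble⟩ := hk
  set K : ι → Fin 3 := fun l => ⟨k l, hlt l⟩
  rw [show k = counts K from rfl, extendMarks_counts]
  refine hw K fun l l' hl hl' => ?_
  by_contra hll'
  have hkl : k l = 2 := congrArg Fin.val hl
  have hkl' : k l' = 2 := congrArg Fin.val hl'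
  exact absurd (hdouble l l' hll' hkl.ge) hkl'.ge.not_gt

theorem sum_marks_eq_sum_configs {F : Type*} [AddCommGroup F] [Module ℂ F] (n : ℕ) (q : ℕ × ℕ)
    (w : Marks n n → ℂ) (X : (Interval n n → ℕ) → F) :
    ∑ K : Marks n n with q = bidegree (counts K), w K • X (counts K) =
      ∑ k ∈ configs n q, extendMarks w k • X k := by
  refine Finset.sum_of_injOn counts (fun K _ K' _ hKK' => ?_) (fun K hK => ?_)
    (fun k hk hk' => ?_) fun K _ => by rw [extendMarks_counts]
  · exact funext fun l => Fin.ext (congrFun hKK' l)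
  · exact mem_configs.2 (Finset.mem_filter.1 hK).2.symm
  · by_contra hne
    obtain ⟨K, rfl⟩ := exists_counts_eq_of_extendMarks_ne_zero (left_ne_zero_of_smul hne)
    exact hk' ⟨K, Finset.mem_filter.2 ⟨Finset.mem_univ _, (mem_configs.1 hk).symm⟩, rfl⟩

end ExtendMarks

theorem hasSum_sum_fiber {α β M : Type*} [Fintype α] [DecidableEq β] [AddCommMonoid M]
    [TopologicalSpace M] [ContinuousAdd M] (d : α → β) (f : α → M) :
    HasSum (fun q => ∑ a with q = d a, f a) (∑ a, f a) := by
  simp only [Finset.sum_filter]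
  exact hasSum_sum fun a _ => hasSum_ite_eq (d a) (f a)

theorem succ_mul_sqrt_factorial_le (N : ℕ) :
    ((N + 1 : ℕ) : ℝ) * √N.factorial ≤ √(N + 2).factorial := by
  refine Real.le_sqrt_of_sq_le ?_
  rw [mul_pow, Real.sq_sqrt (by positivity)]
  have hfactorial : (N + 1) ^ 2 * N.factorial ≤ (N + 2).factorial := by
    rw [Nat.factorial_succ, Nat.factorial_succ, ← mul_assoc]
    exact Nat.mul_le_mul_right _ (by nlinarith)
  exact_mod_cast hfactorial

theorem mul_pow_mul_sqrt_factorial_le {b : ℝ} (hb : 0 ≤ b) (N : ℕ) :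
    b * N * ((1 + b) ^ (N - 1) * √(N - 1).factorial) ≤
      (1 + b) ^ (N + 1) * √(N + 1).factorial := by
  rcases N with - | N
  · simp only [Nat.cast_zero, mul_zero, zero_mul]
    positivity
  · rw [Nat.add_sub_cancel]
    have hpow : b * (1 + b) ^ N ≤ (1 + b) ^ (N + 2) := by
      rw [pow_add, mul_comm]
      exact mul_le_mul_of_nonneg_left (by nlinarith) (by positivity)
    calc _ = b * (1 + b) ^ N * (((N + 1 : ℕ) : ℝ) * √N.factorial) := by ring
      _ ≤ _ := mul_le_mul hpow (succ_mul_sqrt_factorial_le N) (by positivity) (by positivity)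

variable {E : Type*} [NormedAddCommGroup E] [InnerProductSpace ℂ E] [CompleteSpace E]
  {H W : E →L[ℂ] E} {B : ℝ → ℝ → ℂ} {b h : ℝ} {n : ℕ}

theorem norm_smul_chainOp_sub_le (hH : IsSelfAdjoint H) (W ρ₀ : E →L[ℂ] E) (hh : 0 ≤ h)
    {g : ℝ} {u v : ℂ} (hu : ‖u‖ ≤ g) (hv : ‖v‖ ≤ g) (k : Interval n n → ℕ) :
    ‖u • chainOp H W ρ₀ h k - v • chainOp H W ρ₀ h k‖ ≤
      2 * (g * (‖ρ₀‖ * ‖W‖ ^ (∑ l, k l))) * cellWeight h k := by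
  have hg : 0 ≤ g := (norm_nonneg u).trans hu
  rw [← sub_smul, norm_smul]
  calc _ ≤ (g + g) * (cellWeight h k * (‖ρ₀‖ * ‖W‖ ^ (∑ l, k l))) :=
        mul_le_mul ((norm_sub_le _ _).trans (add_le_add hu hv)) (norm_chainOp_le hH W ρ₀ hh k)
          (norm_nonneg _) (by positivity)
    _ = _ := by ring

open scoped Classical in
theorem norm_sum_configs_sub_le (hH : IsSelfAdjoint H) (W ρ₀ : E →L[ℂ] E) (hh : 0 ≤ h)
    {g : ℕ → ℝ} {u v : (Interval n n → ℕ) → ℂ} (hu : ∀ k, ‖u k‖ ≤ g (∑ l, k l))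
    (hv : ∀ k, ‖v k‖ ≤ g (∑ l, k l)) (huv : ∀ k, ¬ Crowded k → u k = v k) (q : ℕ × ℕ)
    (hg : 0 ≤ g (q.1 + q.2)) :
    ‖∑ k ∈ configs n q, u k • chainOp H W ρ₀ h k -
        ∑ k ∈ configs n q, v k • chainOp H W ρ₀ h k‖ ≤
      2 * (g (q.1 + q.2) * (‖ρ₀‖ * ‖W‖ ^ (q.1 + q.2))) *
        ∑ k ∈ (Finset.univ : Finset (Interval n n)).piAntidiag (q.1 + q.2) with Crowded k,
          cellWeight h k := by
  set c := 2 * (g (q.1 + q.2) * (‖ρ₀‖ * ‖W‖ ^ (q.1 + q.2)))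
  rw [← Finset.sum_sub_distrib]
  calc _ ≤ ∑ k ∈ configs n q, if Crowded k then c * cellWeight h k else 0 := by
        refine norm_sum_le_of_le _ fun k hk => ?_
        split_ifs with hcrowded
        · have hterm := norm_smul_chainOp_sub_le hH W ρ₀ hh (hu k) (hv k) k
          rwa [sum_eq_of_mem_configs hk] at hterm
        · rw [huv k hcrowded, sub_self, norm_zero]
    _ ≤ ∑ k ∈ (Finset.univ : Finset (Interval n n)).piAntidiag (q.1 + q.2),
        if Crowded k then c * cellWeight h k else 0 :=
        Finset.sum_le_sum_of_subset_of_nonneg (Finset.filter_subset _ _) fun k _ _ =>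
          ite_nonneg (mul_nonneg (by positivity) (cellWeight_nonneg hh k)) le_rfl
    _ = _ := by rw [← Finset.sum_filter, Finset.mul_sum]

/-- The bound for the contribution of the crowded configurations with `N` points to the difference
of two sums over configurations whose terms are at most `K` times the weight. -/
def crowdedError (N : ℕ) (T K h : ℝ) : ℝ :=
  2 * K * (h ^ 2 * (2 * (N : ℝ) ^ 4 * (1 + 2 * T) ^ (N + 2) / N.factorial))

theorem exists_hasSum_rhoTilde (ρ₀ : E →L[ℂ] E) (hH : IsSelfAdjoint H) (hW : IsSelfAdjoint W)
    (hh : 0 ≤ h) (hB : ∀ x y, ‖B x y‖ ≤ b) (n : ℕ) :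
    ∃ r : ℕ × ℕ → (E →L[ℂ] E), HasSum r (rhoTilde H W ρ₀ B h n) ∧
      ∀ q, ‖∑ k ∈ configs n q,
          multisetInfluence B (timeMultiset (mid h) k) • chainOp H W ρ₀ h k - r q‖ ≤
        crowdedError (q.1 + q.2) (n * h) (dysonBound ‖ρ₀‖ ‖W‖ b (q.1 + q.2)) h := by
  have hb : 0 ≤ b := (norm_nonneg _).trans (hB 0 0)
  set g : ℕ → ℝ := fun N => (1 + b) ^ N * √N.factorial
  have hg : ∀ N, 0 ≤ g N := fun N => by positivity
  obtain ⟨w, hsum, hbound, hexact⟩ :=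
    exists_rhoTilde_eq (g := g) ρ₀ hH hW hh hB hg (by simp [g]) (mul_pow_mul_sqrt_factorial_le hb) n
  refine ⟨fun q => ∑ k ∈ configs n q, extendMarks w k • chainOp H W ρ₀ h k, ?_, fun q => ?_⟩
  · have hfiber := hasSum_sum_fiber (fun K : Marks n n => bidegree (counts K))
      fun K => w K • chainOp H W ρ₀ h (counts K)
    simpa only [hsum, sum_marks_eq_sum_configs n _ w] using hfiber
  · have hinfluence : ∀ k : Interval n n → ℕ,
        ‖multisetInfluence B (timeMultiset (mid h) k)‖ ≤ g (∑ l, k l) := fun k => by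
      simpa only [card_timeMultiset] using norm_multisetInfluence_le hB (timeMultiset (mid h) k)
    have hcard : (Fintype.card (Interval n n) : ℝ) * h = 2 * (n * h) := by
      simp only [Fintype.card_sum, Fintype.card_fin, Nat.cast_add]
      ring
    refine (norm_sum_configs_sub_le hH W ρ₀ hh hinfluence (norm_extendMarks_le hg hbound)
      (fun k hk => (extendMarks_eq_of_not_crowded (f := fun k =>
        multisetInfluence B (timeMultiset (mid h) k)) hexact hk).symm) q (hg _)).trans ?_
    rw [crowdedError, dysonBound, ← hcard]
    exact mul_le_mul_of_nonneg_left (sum_cellWeight_crowded_le hh _) (by positivity)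

end Configs

/-! ### Summation of the errors -/

section ErrorBound

/-- The summable majorant of the errors of the terms of the double series; the square roots are
what is left of the factorials after compensation of the growth of the number of pairings. -/
def sqrtFactorialTerm (R : ℝ) (q : ℕ × ℕ) : ℝ :=
  R ^ q.1 / √q.1.factorial * (R ^ q.2 / √q.2.factorial)

theorem summable_pow_div_sqrt_factorial {R : ℝ} (hR : 0 ≤ R) :
    Summable fun m : ℕ => R ^ m / √m.factorial := by
  have hmajorant : Summable fun m : ℕ => (1 / 4 : ℝ) ^ m + (4 * R ^ 2) ^ m / m.factorial :=
    (summable_geometric_of_lt_one (by norm_num) (by norm_num)).add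
      (Real.summable_pow_div_factorial _)
  refine Summable.of_nonneg_of_le (fun m => by positivity) (fun m => ?_) hmajorant
  set x := (1 / 2 : ℝ) ^ m
  set y := (2 * R) ^ m / √m.factorial
  have hx : x ^ 2 = (1 / 4) ^ m := by
    rw [← pow_mul, mul_comm m 2, pow_mul]
    norm_num
  have hy : y ^ 2 = (4 * R ^ 2) ^ m / m.factorial := by
    rw [div_pow, Real.sq_sqrt (by positivity), ← pow_mul, mul_comm m 2, pow_mul, mul_pow]
    norm_num
  have hxy : x * y = R ^ m / √m.factorial := by
    rw [← mul_div_assoc, ← mul_pow]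
    ring_nf
  have hxy₀ : 0 ≤ x * y := by positivity
  rw [← hx, ← hy, ← hxy]
  linarith [two_mul_le_add_sq x y]

theorem summable_sqrtFactorialTerm {R : ℝ} (hR : 0 ≤ R) : Summable (sqrtFactorialTerm R) :=
  (summable_pow_div_sqrt_factorial hR).mul_of_nonneg (summable_pow_div_sqrt_factorial hR)
    (fun m => by positivity) (fun m => by positivity)

theorem sqrt_factorial_add_le (m m' : ℕ) :
    √(m + m').factorial ≤ 2 ^ (m + m') * (√m.factorial * √m'.factorial) := by
  have hchoose : (m + m').factorial ≤ 2 ^ (m + m') * (m.factorial * m'.factorial) := by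
    rw [← Nat.add_choose_mul_factorial_mul_factorial, mul_assoc]
    exact Nat.mul_le_mul_right _ (Nat.choose_le_two_pow _ _)
  rw [← Real.sqrt_mul (by positivity)]
  refine Real.sqrt_le_iff.2 ⟨by positivity, ?_⟩
  rw [mul_pow, Real.sq_sqrt (by positivity)]
  calc ((m + m').factorial : ℝ) ≤ 2 ^ (m + m') * (m.factorial * m'.factorial) := by
        exact_mod_cast hchoose
    _ ≤ _ := mul_le_mul_of_nonneg_right
        (le_self_pow₀ (one_le_pow₀ (by norm_num)) (by norm_num)) (by positivity)

theorem cast_pow_four_le_pow (N : ℕ) : (N : ℝ) ^ 4 ≤ 16 ^ N := by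
  have hN : (N : ℝ) ≤ 2 ^ N := by exact_mod_cast N.lt_two_pow_self.le
  calc (N : ℝ) ^ 4 ≤ (2 ^ N) ^ 4 := by gcongr
    _ = 16 ^ N := by rw [← pow_mul, mul_comm, pow_mul]; norm_num

theorem mul_pow_pred_div_factorial_le {x y : ℝ} (hx : 0 ≤ x) (hxy : x ≤ y) (hy : 1 ≤ y) (m : ℕ) :
    m * (x ^ (m - 1) / (m - 1).factorial) ≤ (m : ℝ) ^ 2 * (y ^ m / m.factorial) := by
  rcases m with - | m
  · simp
  · have hpow : x ^ m ≤ y ^ (m + 1) :=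
      (pow_le_pow_left₀ hx hxy m).trans (pow_le_pow_right₀ hy (Nat.le_succ m))
    calc _ ≤ ((m + 1 : ℕ) : ℝ) * (y ^ (m + 1) / m.factorial) := by
          rw [Nat.add_sub_cancel]
          gcongr
      _ = _ := by
          rw [Nat.factorial_succ, Nat.cast_mul]
          field_simp

theorem midpointError_mul_pow_div_factorial_le {m m' N : ℕ} {T K lam : ℝ} (hT : 0 ≤ T)
    (hK : 0 ≤ K) (hlam : 0 ≤ lam) (h : ℝ) (hN : m + m' = N) :
    midpointError m T K (N * lam) h * (T ^ m' / m'.factorial) ≤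
      2 * (lam ^ 2 * T + lam) *
        (K * (N : ℝ) ^ 4 * ((1 + 2 * T) ^ N / (m.factorial * m'.factorial))) * h ^ 2 := by
  set Q := (1 + 2 * T) ^ N / (m.factorial * m'.factorial : ℝ) with hQ
  have hprod : (1 + 2 * T) ^ m / m.factorial * ((1 + 2 * T) ^ m' / m'.factorial) = Q := by
    rw [hQ, ← hN, pow_add, div_mul_div_comm]
  set S := 2 * (K * (N * lam) ^ 2 * T + K * (N * lam)) * h ^ 2 with hS
  have hmN : (m : ℝ) ≤ N := by exact_mod_cast hN ▸ Nat.le_add_right m m'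
  have hcube := cast_pow_three_le_cast_pow_four N
  calc _ = S * ((m * (T ^ (m - 1) / (m - 1).factorial)) * (T ^ m' / m'.factorial)) := by
        rw [midpointError]
        ring
    _ ≤ S * (((m : ℝ) ^ 2 * ((1 + 2 * T) ^ m / m.factorial)) *
          ((1 + 2 * T) ^ m' / m'.factorial)) := by
        gcongr S * (?_ * (?_ ^ _ / _))
        · exact mul_pow_pred_div_factorial_le hT (by linarith) (by linarith) m
        · linarith
    _ = S * ((m : ℝ) ^ 2 * Q) := by
        rw [← hprod, mul_assoc ((m : ℝ) ^ 2)]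
    _ ≤ S * ((N : ℝ) ^ 2 * Q) := by gcongr
    _ = 2 * (lam ^ 2 * T * (K * (N : ℝ) ^ 4 * Q) + lam * (K * (N : ℝ) ^ 3 * Q)) * h ^ 2 := by
        rw [hS]
        ring
    _ ≤ 2 * (lam ^ 2 * T * (K * (N : ℝ) ^ 4 * Q) + lam * (K * (N : ℝ) ^ 4 * Q)) * h ^ 2 := by
        gcongr
    _ = _ := by ring

theorem crowdedError_le (m m' : ℕ) {T K : ℝ} (hT : 0 ≤ T) (hK : 0 ≤ K) (h : ℝ) :
    crowdedError (m + m') T K h ≤ 4 * (1 + 2 * T) ^ 2 * (K * ((m + m' : ℕ) : ℝ) ^ 4 *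
      ((1 + 2 * T) ^ (m + m') / (m.factorial * m'.factorial))) * h ^ 2 := by
  have hfactorial : (m.factorial * m'.factorial : ℝ) ≤ (m + m').factorial := by
    exact_mod_cast Nat.le_of_dvd (Nat.factorial_pos _)
      (Nat.factorial_mul_factorial_dvd_factorial_add m m')
  calc _ = 4 * (1 + 2 * T) ^ 2 * (K * ((m + m' : ℕ) : ℝ) ^ 4 *
        ((1 + 2 * T) ^ (m + m') / (m + m').factorial)) * h ^ 2 := by
        rw [crowdedError, pow_add _ _ 2]
        ring
    _ ≤ _ := by gcongr

/-- The growth rate of the errors of the terms of the double series; the factor `32 = 2 * 16` comes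
from `sqrt_factorial_add_le` and `cast_pow_four_le_pow`. -/
def errorRate (w b T : ℝ) : ℝ := 32 * (1 + b) * w * (1 + 2 * T)

theorem errorRate_nonneg {w b T : ℝ} (hw : 0 ≤ w) (hb : 0 ≤ b) (hT : 0 ≤ T) :
    0 ≤ errorRate w b T := by
  unfold errorRate
  positivity

theorem dysonBound_nonneg {ρ w b : ℝ} (hρ : 0 ≤ ρ) (hw : 0 ≤ w) (hb : 0 ≤ b) (N : ℕ) :
    0 ≤ dysonBound ρ w b N := by
  unfold dysonBound
  positivity

theorem dysonBound_mul_le_sqrtFactorialTerm {ρ w b T : ℝ} (hρ : 0 ≤ ρ) (hw : 0 ≤ w) (hb : 0 ≤ b)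
    (hT : 0 ≤ T) (m m' : ℕ) :
    dysonBound ρ w b (m + m') * ((m + m' : ℕ) : ℝ) ^ 4 *
        ((1 + 2 * T) ^ (m + m') / (m.factorial * m'.factorial)) ≤
      ρ * sqrtFactorialTerm (errorRate w b T) (m, m') := by
  set N := m + m' with hN
  have h32 : (32 : ℝ) ^ N = 2 ^ N * 16 ^ N := by
    rw [← mul_pow]
    norm_num
  calc _ ≤ (1 + b) ^ N * (2 ^ N * (√m.factorial * √m'.factorial)) * (ρ * w ^ N) * 16 ^ N *
        ((1 + 2 * T) ^ N / (m.factorial * m'.factorial)) := by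
        rw [dysonBound]
        gcongr
        exacts [sqrt_factorial_add_le m m', cast_pow_four_le_pow N]
    _ = ρ * ((32 ^ N * (1 + b) ^ N * w ^ N * (1 + 2 * T) ^ N) /
        (√m.factorial * √m'.factorial)) := by
        rw [h32]
        field_simp
        rw [Real.sq_sqrt (by positivity), Real.sq_sqrt (by positivity)]
        ring
    _ = _ := by
        rw [sqrtFactorialTerm, div_mul_div_comm, ← pow_add, ← hN, errorRate, mul_pow, mul_pow,
          mul_pow]

/-- The sum of the coefficients with which the two midpoint errors and the crowded configurations
enter the error estimate. -/
def errorConst (η ρ b' b'' T : ℝ) : ℝ :=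
  4 * ((1 + b' + b'' + 2 * η) ^ 2 * T + (1 + b' + b'' + 2 * η) + (1 + 2 * T) ^ 2) * ρ

theorem midpointError_add_crowdedError_le {η ρ w b b' b'' T : ℝ} (hη : 0 ≤ η) (hρ : 0 ≤ ρ)
    (hw : 0 ≤ w) (hb : 0 ≤ b) (hb' : 0 ≤ b') (hb'' : 0 ≤ b'') (hT : 0 ≤ T) (h : ℝ) (m m' : ℕ) :
    midpointError m T (dysonBound ρ w b (m + m')) (dysonRate η b' b'' (m + m')) h *
          (T ^ m' / m'.factorial) +
        midpointError m' T (dysonBound ρ w b (m + m')) (dysonRate η b' b'' (m + m')) h *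
          (T ^ m / m.factorial) +
      crowdedError (m + m') T (dysonBound ρ w b (m + m')) h ≤
    errorConst η ρ b' b'' T * sqrtFactorialTerm (errorRate w b T) (m, m') * h ^ 2 := by
  set lam := 1 + b' + b'' + 2 * η with hlam
  have hlam₀ : 0 ≤ lam := by positivity
  have hK := dysonBound_nonneg hρ hw hb (m + m')
  have hleft := midpointError_mul_pow_div_factorial_le hT hK hlam₀ h (rfl : m + m' = m + m')
  have hright := midpointError_mul_pow_div_factorial_le hT hK hlam₀ h (add_comm m' m)
  rw [mul_comm (m'.factorial : ℝ)] at hright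
  have hterm := dysonBound_mul_le_sqrtFactorialTerm hρ hw hb hT m m'
  refine (add_le_add (add_le_add hleft hright) (crowdedError_le m m' hT hK h)).trans ?_
  set X := dysonBound ρ w b (m + m') * ((m + m' : ℕ) : ℝ) ^ 4 *
    ((1 + 2 * T) ^ (m + m') / (m.factorial * m'.factorial))
  calc _ = 4 * (lam ^ 2 * T + lam + (1 + 2 * T) ^ 2) * X * h ^ 2 := by ring
    _ ≤ 4 * (lam ^ 2 * T + lam + (1 + 2 * T) ^ 2) *
        (ρ * sqrtFactorialTerm (errorRate w b T) (m, m')) * h ^ 2 := by gcongr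
    _ = _ := by
        rw [errorConst, hlam]
        ring

variable {E : Type*} [NormedAddCommGroup E] [InnerProductSpace ℂ E] [CompleteSpace E]
  {H W : E →L[ℂ] E} {B : ℝ → ℝ → ℂ} {b b' b'' h : ℝ}

theorem smul_setIntegral_dysonIntegrand_gridMid (hH : IsSelfAdjoint H) (W ρ₀ : E →L[ℂ] E)
    (hB : PureBathBounds B b b' b'') (hh : 0 < h) (n : ℕ) (q : ℕ × ℕ) :
    ((-Complex.I) ^ q.1 * Complex.I ^ q.2) •
      ∫ p in simplex q.1 (n * h) ×ˢ simplex q.2 (n * h), dysonIntegrand H W ρ₀ B (n * h) q.1 q.2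
        (fun i => gridMid h (p.1 i), fun i => gridMid h (p.2 i)) =
    ∑ k ∈ configs n q, multisetInfluence B (timeMultiset (mid h) k) • chainOp H W ρ₀ h k := by
  rw [setIntegral_dysonIntegrand_gridMid hH W ρ₀ hB hh, Finset.smul_sum, ← sum_configs]
  refine Finset.sum_congr rfl fun k hk => ?_
  rw [Finset.smul_sum]
  refine Finset.sum_congr rfl fun k' hk' => ?_
  rw [← smul_dysonMultiset_eq H W ρ₀ B hh.le]
  simp only [Sum.elim_inl, Sum.elim_inr, (Finset.mem_piAntidiag.1 hk).1,
    (Finset.mem_piAntidiag.1 hk').1]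

theorem norm_dysonTerm_sub_sum_configs_le (hH : IsSelfAdjoint H) (W ρ₀ : E →L[ℂ] E)
    (hB : PureBathBounds B b b' b'') (hh : 0 < h) (n : ℕ) (q : ℕ × ℕ) :
    ‖dysonTerm H W ρ₀ B (n * h) q -
        ∑ k ∈ configs n q, multisetInfluence B (timeMultiset (mid h) k) • chainOp H W ρ₀ h k‖ ≤
      midpointError q.1 (n * h) (dysonBound ‖ρ₀‖ ‖W‖ b (q.1 + q.2))
          (dysonRate ‖H‖ b' b'' (q.1 + q.2)) h * ((n * h) ^ q.2 / q.2.factorial) +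
        midpointError q.2 (n * h) (dysonBound ‖ρ₀‖ ‖W‖ b (q.1 + q.2))
          (dysonRate ‖H‖ b' b'' (q.1 + q.2)) h * ((n * h) ^ q.1 / q.1.factorial) := by
  have hphase : ‖(-Complex.I) ^ q.1 * Complex.I ^ q.2‖ = 1 := by simp
  rw [← smul_setIntegral_dysonIntegrand_gridMid hH W ρ₀ hB hh, dysonTerm, ← smul_sub, norm_smul,
    hphase, one_mul]
  exact norm_setIntegral_dysonIntegrand_sub_le hH W ρ₀ hB hh (by positivity) (n * h) q.1 q.2

theorem exists_hasSum_rhoTilde_sub_dysonTerm_le (hH : IsSelfAdjoint H) (hW : IsSelfAdjoint W)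
    (ρ₀ : E →L[ℂ] E) (hB : PureBathBounds B b b' b'') (hh : 0 < h) (n : ℕ) :
    ∃ r : ℕ × ℕ → (E →L[ℂ] E), HasSum r (rhoTilde H W ρ₀ B h n) ∧
      ∀ q, ‖r q - dysonTerm H W ρ₀ B (n * h) q‖ ≤ errorConst ‖H‖ ‖ρ₀‖ b' b'' (n * h) *
        sqrtFactorialTerm (errorRate ‖W‖ b (n * h)) q * h ^ 2 := by
  obtain ⟨hb, hb', hb''⟩ := hB.nonneg
  obtain ⟨r, hr, hcrowded⟩ := exists_hasSum_rhoTilde ρ₀ hH hW hh.le hB.bound n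
  refine ⟨r, hr, fun q => ?_⟩
  rw [norm_sub_rev]
  calc _ ≤ _ := norm_sub_le_norm_sub_add_norm_sub _ _ _
    _ ≤ _ := add_le_add (norm_dysonTerm_sub_sum_configs_le hH W ρ₀ hB hh n q) (hcrowded q)
    _ ≤ _ := midpointError_add_crowdedError_le (norm_nonneg H) (norm_nonneg ρ₀) (norm_nonneg W)
        hb hb' hb'' (by positivity) h q.1 q.2

end ErrorBound

end

end FRODS

theorem mainTheorem1_general :
    ∃ C : ℝ → ℝ → ℝ → ℝ → ℝ → ℝ → ℝ → ℝ,
      ∀ (E : Type*) [NormedAddCommGroup E] [InnerProductSpace ℂ E] [CompleteSpace E]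
        (H W ρ₀ : E →L[ℂ] E) (B : ℝ → ℝ → ℂ) (b b' b'' : ℝ),
        IsSelfAdjoint H → IsSelfAdjoint W → FRODS.PureBathBounds B b b' b'' →
        ∀ (n : ℕ) (Δt : ℝ), 0 < Δt →
          (∀ m m' : ℕ, MeasureTheory.IntegrableOn
            (FRODS.dysonIntegrand H W ρ₀ B (n * Δt) m m')
            (FRODS.simplex m (n * Δt) ×ˢ FRODS.simplex m' (n * Δt))) ∧
          Summable (FRODS.dysonTerm H W ρ₀ B (n * Δt)) ∧
          ‖FRODS.rhoTilde H W ρ₀ B Δt n - FRODS.rhoExact H W ρ₀ B (n * Δt)‖ ≤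
            C ‖H‖ ‖ρ₀‖ ‖W‖ b b' b'' (n * Δt) * Δt ^ 2 := by
  refine ⟨fun η ρ ω b b' b'' T => FRODS.errorConst η ρ b' b'' T *
    ∑' q, FRODS.sqrtFactorialTerm (FRODS.errorRate ω b T) q, ?_⟩
  intro E _ _ _ H W ρ₀ B b b' b'' hH hW hB n Δt hΔt
  obtain ⟨r, hr, hrq⟩ := FRODS.exists_hasSum_rhoTilde_sub_dysonTerm_le hH hW ρ₀ hB hΔt n
  have hrate : 0 ≤ FRODS.errorRate ‖W‖ b (n * Δt) :=
    FRODS.errorRate_nonneg (norm_nonneg W) hB.nonneg.1 (by positivity)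
  have hbound := ((FRODS.summable_sqrtFactorialTerm hrate).hasSum.mul_left
    (FRODS.errorConst ‖H‖ ‖ρ₀‖ b' b'' (n * Δt))).mul_right (Δt ^ 2)
  have hdiff : Summable fun q => r q - FRODS.dysonTerm H W ρ₀ B (n * Δt) q :=
    Summable.of_norm_bounded hbound.summable hrq
  have hdyson : Summable (FRODS.dysonTerm H W ρ₀ B (n * Δt)) := by
    simpa using hr.summable.sub hdiff
  refine ⟨FRODS.integrableOn_dysonIntegrand hH W ρ₀ hB _ _, hdyson, ?_⟩
  rw [FRODS.rhoExact, ← hr.tsum_eq, ← hr.summable.tsum_sub hdyson]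
  exact tsum_of_norm_bounded hbound hrq

theorem mainTheorem1 :
    ∃ C : ℝ → ℝ → ℝ → ℝ → ℝ → ℝ → ℝ → ℝ,
      ∀ (E : Type*) [NormedAddCommGroup E] [InnerProductSpace ℂ E] [CompleteSpace E]
        (H W ρ₀ : E →L[ℂ] E) (B : ℝ → ℝ → ℂ) (b b' b'' : ℝ),
        IsSelfAdjoint H → IsSelfAdjoint W → FRODS.BathBounds B b b' b'' →
        ∀ (n : ℕ) (Δt : ℝ), 0 < Δt →
          (∀ m m' : ℕ, MeasureTheory.IntegrableOn
            (FRODS.dysonIntegrand H W ρ₀ B (n * Δt) m m')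
            (FRODS.simplex m (n * Δt) ×ˢ FRODS.simplex m' (n * Δt))) ∧
          Summable (FRODS.dysonTerm H W ρ₀ B (n * Δt)) ∧
          ‖FRODS.rhoTilde H W ρ₀ B Δt n - FRODS.rhoExact H W ρ₀ B (n * Δt)‖ ≤
            C ‖H‖ ‖ρ₀‖ ‖W‖ b b' b'' (n * Δt) * Δt ^ 2 := by
  obtain ⟨C, hC⟩ := mainTheorem1_general
  exact ⟨C, fun E _ _ _ H W ρ₀ B b b' b'' hH hW hB => hC E H W ρ₀ B b b' b'' hH hW hB.pure⟩
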